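/- All graphs are finite and simple. A dissociation set of a graph $G$ is a set $F$ of vertices such that the induced subgraph $G[F]$ has maximum degree at most $1$; it is maximal if it is not a proper subset of another dissociation set. Let $\phi(G)$ be the number of maximal dissociation sets of $G$. For a positive integer $m$, let $K_m^*$ denote any graph obtained from the complete graph $K_m$ by deleting $i$ pairwise non-adjacent edges (i.e. no two of them share an endpoint) for some $0\le i\le m/2$. Write $\cup$ for disjoint union and $\ell K_m^*$ for a disjoint union of $\ell$ graphs, each of which is a $K_m^*$ (the deleted edges may be chosen differently in different components). **Theorem.** Let $n\ge 8$ and write $n=5t+r$ with integers $t\ge 1$ and $0\le r\le 4$. The maximum of $\phi(G)$ over all graphs $G$ of order $n$ is $$ M=\begin{cases} 10^t, & n=5t,\\ 15\cdot 10^{t-1}, & n=5t+1,\\ 225\cdot 10^{t-2}, & n=5t+2,\\ 36\cdot 10^{t-1}, & n=5t+3,\\ 6\cdot 10^{t}, & n=5t+4, \end{cases} $$ and a graph $G$ of order $n$ satisfies $\phi(G)=M$ if and only if $$ G\cong\begin{cases} tK_5^*, & n=5t,\\ K_6^*\cup (t-1)K_5^*, & n=5t+1,\\ 2K_6^*\cup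 (t-2)K_5^*, & n=5t+2,\\ 2K_4^*\cup (t-1)K_5^*, & n=5t+3,\\ K_4^*\cup tK_5^*, & n=5t+4. \end{cases} $$ -/

import Mathlib

namespace SimpleGraph

/-- A set `F` of vertices is a dissociation set of `G` if the induced subgraph `G[F]` has maximum
degree at most `1`, i.e. every vertex of `F` has at most one neighbour inside `F`. -/
def IsDissociationSet {V : Type*} (G : SimpleGraph V) (F : Set V) : Prop :=
  ∀ v ∈ F, ∀ u ∈ F, ∀ w ∈ F, G.Adj v u → G.Adj v w → u = w

/-- `MD(G)`: the set of all maximal dissociation sets of `G` (maximal with respect to inclusion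
among the dissociation sets). -/
def maximalDissociationSets {V : Type*} (G : SimpleGraph V) : Set (Set V) :=
  {F | Maximal G.IsDissociationSet F}

/-- `φ(G)`: the number of maximal dissociation sets of `G` (for `G` on a finite vertex set). -/
noncomputable def numMaximalDissociationSets {V : Type*} (G : SimpleGraph V) : ℕ :=
  G.maximalDissociationSets.ncard

/-- `H` is one of the graphs `K_m^*`: it is obtained from the complete graph on the `m` vertices
`0, …, m - 1` by deleting a set `D` of `i` edges, `0 ≤ i ≤ m / 2`, no two of which share an
endpoint. -/
def IsCompleteMinusMatching {m : ℕ} (H : SimpleGraph (Fin m)) : Prop :=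
  ∃ D : Finset (Sym2 (Fin m)),
    (D : Set (Sym2 (Fin m))) ⊆ (⊤ : SimpleGraph (Fin m)).edgeSet ∧
    2 * D.card ≤ m ∧
    (∀ e ∈ D, ∀ f ∈ D, e ≠ f → ∀ v, ¬ (v ∈ e ∧ v ∈ f)) ∧
    H = (⊤ : SimpleGraph (Fin m)).deleteEdges (D : Set (Sym2 (Fin m)))

/-- The disjoint union of a family of graphs: two vertices are adjacent iff they lie in the same
member of the family and are adjacent there. -/
def disjointUnion {ι : Type*} {W : ι → Type*} (H : ∀ i, SimpleGraph (W i)) :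
    SimpleGraph (Σ i, W i) where
  Adj x y := ∃ (i : ι) (a b : W i), (H i).Adj a b ∧ x = ⟨i, a⟩ ∧ y = ⟨i, b⟩
  symm := ⟨fun _ _ ⟨i, a, b, h, hx, hy⟩ => ⟨i, b, a, h.symm, hy, hx⟩⟩
  loopless := ⟨by
    rintro _ ⟨i, a, b, h, rfl, hy⟩
    cases hy
    exact h.ne rfl⟩

/-- For a list `[m₁, …, mₖ]` of natural numbers: `G ≅ K_{m₁}^* ∪ ⋯ ∪ K_{mₖ}^*`, where each
`K_m^*` stands for some graph obtained from `K_m` by deleting a matching; the deleted matchings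
in different components are chosen independently. -/
def IsUnionOfCompleteMinusMatching {V : Type*} (G : SimpleGraph V) (s : List ℕ) : Prop :=
  ∃ H : ∀ i : Fin s.length, SimpleGraph (Fin (s.get i)),
    (∀ i, (H i).IsCompleteMinusMatching) ∧ Nonempty (G ≃g disjointUnion H)

end SimpleGraph

/-!
The maximal dissociation sets are counted by branching at a vertex `v`. A vertex of a maximal
dissociation set `F` is isolated in `F` or matched to a neighbour, and when a component `A` of
`G[F]` has been chosen, `F \ A` is a maximal dissociation set of what is left outside the closed
neighbourhood of `A`. Hence the number of sets `F` with `A` as a component is at most the count for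
`S \ N[A]` (`countIn_isolates_le`). Splitting by whether `v` lies in `F`, and by the component of
`v` if it does, gives `card_maxDissocIn_le_branch`. Splitting instead by the components of `G[F]`
that prevent `v` from being added gives the covering inequality `BoundBelow.le_of_cover`, which is
the stronger one when all degrees are small. Everything takes place in the finite sets `S` of
vertices of one fixed graph, so that the induction is on `S`.

The claimed maximum is extended to a rational function `extremalBound` of an integer order, which
satisfies `extremalBound (z - 5) = extremalBound z / 10` and is supermultiplicative
(`extremalBound_mul_le`). As counts multiply over disjoint unions, the bound for a disconnected
graph follows from the bound for its parts, with equality only if the parts attain it as well. A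
complete graph minus a matching on `m` vertices has exactly the pairs of vertices as maximal
dissociation sets, hence `m.choose 2` of them, which is the value of the bound for `m = 4, 5, 6`.
The heart of the proof is that the bound is strict for every other connected graph
(`IsReduced.card_lt`). After substituting the inductive bound in the branching inequalities this is
a linear inequality between values of `extremalBound`, all of which are fixed multiples of one
number once the order modulo `5` is known (`extremalBound_ratios`). A vertex of degree at least `6`
is immediate. For degrees `5` and `4` the neighbours are distinguished by whether they have
neighbours outside the closed neighbourhood of `v`; where the estimate is tight, deleting `v` would
leave an extremal graph, whose blocks are known by induction and contradict the adjacencies at `v`.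
Graphs of maximum degree `3` are treated through a vertex of degree at most `1`, a vertex of degree
`2`, or, if the graph is cubic, a diamond, a triangle or any vertex.

So an extremal graph is a disjoint union of complete graphs minus matchings of orders `4`, `5` and
`6`. Comparing products (`6 * 15 < 10 ^ 2`, `6 ^ 3 < 15 ^ 2`, `15 ^ 3 < 6 ^ 2 * 10 ^ 2`) leaves one
multiset of orders for each order of the graph (`perm_of_prod_eq_extremalBound`).
-/

set_option linter.unusedSectionVars false

namespace SimpleGraph

/-! ### The extremal function -/

/-- The factor of the extremal value that depends on the order modulo `5`. -/
def extremalCoeff (r : ℤ) : ℚ :=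
  if r = 0 then 1 else if r = 1 then 3 / 2 else if r = 2 then 9 / 4 else if r = 3 then 18 / 5 else 6

/-- The extremal value as a function of the order, `extremalCoeff r * 10 ^ q` at `5 * q + r`. It is
rational and defined on all integers, so that shifts of the order never truncate; at the orders
`1`, `2`, `3` and `7` it is not an integer and the bound by it is strict. -/
def extremalBound (z : ℤ) : ℚ := extremalCoeff (z % 5) * 10 ^ (z / 5)

theorem extremalBound_eq (q r : ℤ) (h0 : 0 ≤ r) (h5 : r < 5) :
    extremalBound (5 * q + r) = extremalCoeff r * 10 ^ q := by
  have h1 : (5 * q + r) % 5 = r := by omega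
  have h2 : (5 * q + r) / 5 = q := by omega
  rw [extremalBound, h1, h2]

theorem extremalBound_sub_five (z : ℤ) : extremalBound (z - 5) = extremalBound z / 10 := by
  have h1 : (z - 5) % 5 = z % 5 := by omega
  have h2 : (z - 5) / 5 = z / 5 - 1 := by omega
  rw [extremalBound, extremalBound, h1, h2, zpow_sub_one₀ (by norm_num)]
  ring

/-- The values of `extremalBound` at `z, …, z - 13` up to a common factor, by residue of `z`. All
numerical inequalities below follow from this by linear arithmetic. -/
theorem extremalBound_ratios (z : ℤ) : ∃ p : ℚ, 0 < p ∧
    (extremalBound (z - 5) = extremalBound z / 10 ∧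
      extremalBound (z - 6) = extremalBound (z - 1) / 10 ∧
      extremalBound (z - 7) = extremalBound (z - 2) / 10 ∧
      extremalBound (z - 8) = extremalBound (z - 3) / 10 ∧
      extremalBound (z - 9) = extremalBound (z - 4) / 10 ∧
      extremalBound (z - 10) = extremalBound z / 100 ∧
      extremalBound (z - 11) = extremalBound (z - 1) / 100 ∧
      extremalBound (z - 12) = extremalBound (z - 2) / 100 ∧
      extremalBound (z - 13) = extremalBound (z - 3) / 100) ∧
    ((z % 5 = 0 ∧ extremalBound z = p ∧ extremalBound (z - 1) = 6 / 10 * p ∧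
        extremalBound (z - 2) = 36 / 100 * p ∧ extremalBound (z - 3) = 225 / 1000 * p ∧
        extremalBound (z - 4) = 15 / 100 * p) ∨
      (z % 5 = 1 ∧ extremalBound z = 3 / 2 * p ∧ extremalBound (z - 1) = p ∧
        extremalBound (z - 2) = 6 / 10 * p ∧ extremalBound (z - 3) = 36 / 100 * p ∧
        extremalBound (z - 4) = 225 / 1000 * p) ∨
      (z % 5 = 2 ∧ extremalBound z = 9 / 4 * p ∧ extremalBound (z - 1) = 3 / 2 * p ∧
        extremalBound (z - 2) = p ∧ extremalBound (z - 3) = 6 / 10 * p ∧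
        extremalBound (z - 4) = 36 / 100 * p) ∨
      (z % 5 = 3 ∧ extremalBound z = 18 / 5 * p ∧ extremalBound (z - 1) = 9 / 4 * p ∧
        extremalBound (z - 2) = 3 / 2 * p ∧ extremalBound (z - 3) = p ∧
        extremalBound (z - 4) = 6 / 10 * p) ∨
      (z % 5 = 4 ∧ extremalBound z = 6 * p ∧ extremalBound (z - 1) = 18 / 5 * p ∧
        extremalBound (z - 2) = 9 / 4 * p ∧ extremalBound (z - 3) = 3 / 2 * p ∧
        extremalBound (z - 4) = p)) := by
  have h5 := extremalBound_sub_five z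
  have h6 := extremalBound_sub_five (z - 1)
  have h7 := extremalBound_sub_five (z - 2)
  have h8 := extremalBound_sub_five (z - 3)
  have h9 := extremalBound_sub_five (z - 4)
  have h10 := extremalBound_sub_five (z - 5)
  have h11 := extremalBound_sub_five (z - 6)
  have h12 := extremalBound_sub_five (z - 7)
  have h13 := extremalBound_sub_five (z - 8)
  simp only [sub_sub] at h6 h7 h8 h9 h10 h11 h12 h13
  norm_num at h6 h7 h8 h9 h10 h11 h12 h13
  obtain ⟨q, r, h0, h4, rfl⟩ : ∃ q r : ℤ, 0 ≤ r ∧ r < 5 ∧ z = 5 * q + r :=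
    ⟨z / 5, z % 5, by omega, by omega, by omega⟩
  refine ⟨10 ^ q, by positivity,
    ⟨h5, h6, h7, h8, h9, by linarith, by linarith, by linarith, by linarith⟩, ?_⟩
  have hs (k r' : ℤ) (hk : 5 * q + r - k = 5 * (q - 1) + r') (h0 : 0 ≤ r') (h5 : r' < 5) :
      extremalBound (5 * q + r - k) = extremalCoeff r' / 10 * 10 ^ q := by
    rw [hk, extremalBound_eq _ _ h0 h5, zpow_sub_one₀ (by norm_num)]
    ring
  have ht (k r' : ℤ) (hk : 5 * q + r - k = 5 * q + r') (h0 : 0 ≤ r') (h5 : r' < 5) :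
      extremalBound (5 * q + r - k) = extremalCoeff r' * 10 ^ q := by
    rw [hk, extremalBound_eq _ _ h0 h5]
  have hz := extremalBound_eq q r h0 h4
  obtain rfl | rfl | rfl | rfl | rfl : r = 0 ∨ r = 1 ∨ r = 2 ∨ r = 3 ∨ r = 4 := by omega
  · left
    rw [hs 1 4 (by ring) (by omega) (by omega), hs 2 3 (by ring) (by omega) (by omega),
      hs 3 2 (by ring) (by omega) (by omega), hs 4 1 (by ring) (by omega) (by omega), hz]
    norm_num [extremalCoeff]
  · right; left
    rw [ht 1 0 (by ring) (by omega) (by omega), hs 2 4 (by ring) (by omega) (by omega),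
      hs 3 3 (by ring) (by omega) (by omega), hs 4 2 (by ring) (by omega) (by omega), hz]
    norm_num [extremalCoeff]
  · right; right; left
    rw [ht 1 1 (by ring) (by omega) (by omega), ht 2 0 (by ring) (by omega) (by omega),
      hs 3 4 (by ring) (by omega) (by omega), hs 4 3 (by ring) (by omega) (by omega), hz]
    norm_num [extremalCoeff]
  · right; right; right; left
    rw [ht 1 2 (by ring) (by omega) (by omega), ht 2 1 (by ring) (by omega) (by omega),
      ht 3 0 (by ring) (by omega) (by omega), hs 4 4 (by ring) (by omega) (by omega), hz]
    norm_num [extremalCoeff]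
  · right; right; right; right
    rw [ht 1 3 (by ring) (by omega) (by omega), ht 2 2 (by ring) (by omega) (by omega),
      ht 3 1 (by ring) (by omega) (by omega), ht 4 0 (by ring) (by omega) (by omega), hz]
    norm_num [extremalCoeff]

theorem extremalBound_pos (z : ℤ) : 0 < extremalBound z := by
  obtain ⟨p, hp, -, h⟩ := extremalBound_ratios z
  rcases h with h | h | h | h | h <;> rw [h.2.1] <;> positivity

theorem extremalBound_sub_one_le (z : ℤ) :
    extremalBound (z - 1) ≤ 2 / 3 * extremalBound z := by
  obtain ⟨p, hp, -, h⟩ := extremalBound_ratios z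
  rcases h with h | h | h | h | h <;> linarith [h.2.1, h.2.2.1]

theorem extremalBound_mono : Monotone extremalBound :=
  monotone_int_of_le_succ fun z => by
    have h := extremalBound_sub_one_le (z + 1)
    have h' := extremalBound_pos (z + 1)
    rw [add_sub_cancel_right] at h
    linarith

/-- A vertex of degree at least `6` is already too many for the crude recursion. -/
theorem extremalBound_large_degree (z : ℤ) (k : ℕ) (hk : 6 ≤ k) :
    extremalBound (z - 1) + (k + 1) * extremalBound (z - 1 - k) < extremalBound z := by
  have key : ∀ j : ℕ, ((j + 6 : ℕ) + 1 : ℚ) * extremalBound (z - 1 - (j + 6 : ℕ)) ≤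
      7 * extremalBound (z - 7) := by
    intro j
    induction j with
    | zero => norm_num [sub_sub]
    | succ j ih =>
      refine le_trans ?_ ih
      have h := extremalBound_sub_one_le (z - 1 - (j + 6 : ℕ))
      have h' := extremalBound_pos (z - 1 - (j + 6 : ℕ))
      have e : z - 1 - ((j + 1 + 6 : ℕ) : ℤ) = z - 1 - (j + 6 : ℕ) - 1 := by push_cast; ring
      rw [e]
      push_cast at h h' ⊢
      have hj : (0 : ℚ) ≤ j := j.cast_nonneg
      nlinarith
  obtain ⟨j, rfl⟩ := Nat.exists_eq_add_of_le' hk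
  have := key j
  obtain ⟨p, hp, ⟨h5, h6, h7, -⟩, h⟩ := extremalBound_ratios z
  rcases h with ⟨-, h0, h1, h2, -⟩ | ⟨-, h0, h1, h2, -⟩ | ⟨-, h0, h1, h2, -⟩ | ⟨-, h0, h1, h2, -⟩ |
    ⟨-, h0, h1, h2, -⟩ <;> linarith

theorem extremalBound_mul_le (a b : ℤ) :
    extremalBound a * extremalBound b ≤ extremalBound (a + b) := by
  obtain ⟨q, r, h0, h4, rfl⟩ : ∃ q r : ℤ, 0 ≤ r ∧ r < 5 ∧ a = 5 * q + r :=
    ⟨a / 5, a % 5, by omega, by omega, by omega⟩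
  obtain ⟨q', r', h0', h4', rfl⟩ : ∃ q r : ℤ, 0 ≤ r ∧ r < 5 ∧ b = 5 * q + r :=
    ⟨b / 5, b % 5, by omega, by omega, by omega⟩
  rw [extremalBound_eq _ _ h0 h4, extremalBound_eq _ _ h0' h4']
  have hp : (0 : ℚ) < 10 ^ q * 10 ^ q' := by positivity
  have key (s : ℤ) (hs : r + r' = s) (h5 : s < 5) :
      extremalBound (5 * q + r + (5 * q' + r')) = extremalCoeff s * (10 ^ q * 10 ^ q') := by
    rw [← zpow_add₀ (by norm_num), ← extremalBound_eq _ _ (by omega) h5]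
    congr 1
    omega
  have key' (s : ℤ) (hs : r + r' = 5 + s) (h5 : 0 ≤ s) :
      extremalBound (5 * q + r + (5 * q' + r')) = extremalCoeff s * (10 * (10 ^ q * 10 ^ q')) := by
    rw [← zpow_add₀ (by norm_num), ← zpow_one_add₀ (by norm_num),
      ← extremalBound_eq _ _ h5 (by omega)]
    congr 1
    omega
  obtain h | h : r + r' < 5 ∨ 5 ≤ r + r' := by omega
  · rw [key (r + r') rfl h, mul_mul_mul_comm]
    refine mul_le_mul_of_nonneg_right ?_ hp.le
    interval_cases r <;> interval_cases r' <;> first | omega | norm_num [extremalCoeff]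
  · rw [key' (r + r' - 5) (by ring) (by omega), mul_mul_mul_comm,
      ← mul_assoc _ (10 : ℚ)]
    refine mul_le_mul_of_nonneg_right ?_ hp.le
    interval_cases r <;> interval_cases r' <;> first | omega | norm_num [extremalCoeff]

section

/-! ### Maximal dissociation subsets of a finite set of vertices -/

variable {V : Type*} [DecidableEq V] (G : SimpleGraph V)

/-- The maximal dissociation sets of the subgraph induced by `S`, as subsets of the ambient vertex
set. Working with subsets of a fixed vertex set avoids changing types in inductions. -/
noncomputable def maxDissocIn (S : Finset V) : Finset (Finset V) := by
  classical
  exact {F ∈ S.powerset | G.IsDissociationSet (F : Set V) ∧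
    ∀ x ∈ S, x ∉ F → ¬ G.IsDissociationSet ((insert x F : Finset V) : Set V)}

/-- The neighbours of `v` in `S`. -/
noncomputable def nbrIn (S : Finset V) (v : V) : Finset V := by
  classical
  exact {u ∈ S | G.Adj v u}

/-- The closed neighbourhood of `A` in `S`. -/
noncomputable def closedNbrIn (S A : Finset V) : Finset V := by
  classical
  exact {x ∈ S | x ∈ A ∨ ∃ a ∈ A, G.Adj a x}

/-- The number of maximal dissociation sets of `G[S]` with the property `P`. -/
noncomputable def countIn (S : Finset V) (P : Finset V → Prop) : ℕ := by
  classical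
  exact {F ∈ G.maxDissocIn S | P F}.card

/-- `A` is a union of components of `G[F]`. -/
def Isolates (A F : Finset V) : Prop := A ⊆ F ∧ ∀ a ∈ A, ∀ x ∈ F, G.Adj a x → x ∈ A

variable {G} {S T H F A : Finset V} {u v w x : V}

theorem mem_maxDissocIn : F ∈ G.maxDissocIn S ↔ F ⊆ S ∧ G.IsDissociationSet (F : Set V) ∧
    ∀ x ∈ S, x ∉ F → ¬ G.IsDissociationSet ((insert x F : Finset V) : Set V) := by
  simp [maxDissocIn]

theorem mem_nbrIn : u ∈ G.nbrIn S v ↔ u ∈ S ∧ G.Adj v u := by simp [nbrIn]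

theorem mem_closedNbrIn : x ∈ G.closedNbrIn S A ↔ x ∈ S ∧ (x ∈ A ∨ ∃ a ∈ A, G.Adj a x) := by
  simp [closedNbrIn]

theorem IsDissociationSet.mono {F F' : Set V} (h : G.IsDissociationSet F) (hF : F' ⊆ F) :
    G.IsDissociationSet F' :=
  fun v hv u hu w hw => h v (hF hv) u (hF hu) w (hF hw)

theorem countIn_mono {P Q : Finset V → Prop} (h : ∀ F ∈ G.maxDissocIn S, P F → Q F) :
    G.countIn S P ≤ G.countIn S Q := by
  classical
  refine Finset.card_le_card fun F hF => ?_
  simp only [Finset.mem_filter] at hF ⊢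
  exact ⟨hF.1, h F hF.1 hF.2⟩

theorem countIn_le_card (P : Finset V → Prop) : G.countIn S P ≤ (G.maxDissocIn S).card := by
  classical
  exact Finset.card_filter_le _ _

theorem countIn_true (P : Finset V → Prop) (h : ∀ F ∈ G.maxDissocIn S, P F) :
    G.countIn S P = (G.maxDissocIn S).card := by
  classical
  rw [countIn, Finset.filter_true_of_mem h]

theorem countIn_eq_zero {P : Finset V → Prop} (h : ∀ F ∈ G.maxDissocIn S, ¬ P F) :
    G.countIn S P = 0 := by
  classical
  rw [countIn, Finset.filter_false_of_mem h, Finset.card_empty]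

theorem countIn_or (P Q : Finset V → Prop) :
    G.countIn S (fun F => P F ∨ Q F) ≤ G.countIn S P + G.countIn S Q := by
  classical
  refine (Finset.card_le_card (t := {F ∈ G.maxDissocIn S | P F} ∪ {F ∈ G.maxDissocIn S | Q F})
    fun F hF => ?_).trans (Finset.card_union_le _ _)
  simp only [Finset.mem_filter, Finset.mem_union] at hF ⊢
  tauto

theorem countIn_exists_mem {ι : Type*} (N : Finset ι) (P : ι → Finset V → Prop) :
    G.countIn S (fun F => ∃ i ∈ N, P i F) ≤ ∑ i ∈ N, G.countIn S (P i) := by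
  classical
  refine (Finset.card_le_card (t := N.biUnion fun i => {F ∈ G.maxDissocIn S | P i F})
    fun F hF => ?_).trans Finset.card_biUnion_le
  simp only [Finset.mem_filter, Finset.mem_biUnion] at hF ⊢
  obtain ⟨h, i, hi, hP⟩ := hF
  exact ⟨i, hi, h, hP⟩

/-- A maximal dissociation set of `G[S]` lying in `T ⊆ S` is one of `G[T]`. -/
theorem maxDissocIn_of_subset (hF : F ∈ G.maxDissocIn S) (hFT : F ⊆ T) (hT : T ⊆ S) :
    F ∈ G.maxDissocIn T := by
  rw [mem_maxDissocIn] at hF ⊢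
  exact ⟨hFT, hF.2.1, fun x hx => hF.2.2 x (hT hx)⟩

theorem countIn_notMem_le (S : Finset V) (v : V) :
    G.countIn S (fun F => v ∉ F) ≤ (G.maxDissocIn (S.erase v)).card := by
  classical
  refine Finset.card_le_card fun F hF => ?_
  simp only [Finset.mem_filter] at hF
  refine maxDissocIn_of_subset hF.1 ?_ (S.erase_subset v)
  exact Finset.subset_erase.2 ⟨(mem_maxDissocIn.1 hF.1).1, hF.2⟩

/-- Removing components of `G[F]` from a maximal dissociation set `F` leaves a maximal dissociation
set of what lies outside the closed neighbourhood of these components. -/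
theorem Isolates.sdiff_mem (hF : F ∈ G.maxDissocIn S) (hA : G.Isolates A F) :
    F \ A ∈ G.maxDissocIn (S \ G.closedNbrIn S A) := by
  rw [mem_maxDissocIn] at hF ⊢
  obtain ⟨hFS, hd, hm⟩ := hF
  refine ⟨fun x hx => ?_, hd.mono (by simp), fun x hx hxF hx' => ?_⟩
  · rw [Finset.mem_sdiff] at hx ⊢
    refine ⟨hFS hx.1, fun hxN => ?_⟩
    obtain h | ⟨a, ha, hax⟩ := (mem_closedNbrIn.1 hxN).2
    · exact hx.2 h
    · exact hx.2 (hA.2 a ha x hx.1 hax)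
  · rw [Finset.mem_sdiff, mem_closedNbrIn] at hx
    push Not at hx
    obtain ⟨hxS, hxN⟩ := hx
    obtain ⟨hxA, hxN⟩ := hxN hxS
    have hxF' : x ∉ F := fun h => hxF (Finset.mem_sdiff.2 ⟨h, hxA⟩)
    refine hm x hxS hxF' fun v hv u hu w hw hvu hvw => ?_
    simp only [Finset.coe_insert, Set.mem_insert_iff, Finset.mem_coe] at hv hu hw
    have hin (y : V) (hy : y = x ∨ y ∈ F) (hyA : y ∉ A) :
        y ∈ ((insert x (F \ A) : Finset V) : Set V) := by
      obtain rfl | hy := hy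
      · simp
      · simp [hy, hyA]
    by_cases hvA : v ∈ A
    · have hF' (y : V) (hy : y = x ∨ y ∈ F) (hvy : G.Adj v y) : y ∈ F := by
        obtain rfl | hy := hy
        · exact absurd hvy (hxN v hvA)
        · exact hy
      exact hd v (hA.1 hvA) u (hF' u hu hvu) w (hF' w hw hvw) hvu hvw
    · have hF' (y : V) (hy : y = x ∨ y ∈ F) (hvy : G.Adj v y) : y ∉ A := fun hyA => by
        obtain rfl | hv := hv
        · exact hxN y hyA hvy.symm
        · exact hvA (hA.2 y hyA v hv hvy.symm)
      exact hx' v (hin v hv hvA) u (hin u hu (hF' u hu hvu)) w (hin w hw (hF' w hw hvw)) hvu hvw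

theorem countIn_isolates_and_le {P Q : Finset V → Prop}
    (h : ∀ F ∈ G.maxDissocIn S, G.Isolates A F → P F → Q (F \ A)) :
    G.countIn S (fun F => G.Isolates A F ∧ P F) ≤ G.countIn (S \ G.closedNbrIn S A) Q := by
  classical
  refine Finset.card_le_card_of_injOn (· \ A) (fun F hF => ?_) fun F hF F' hF' hFF => ?_
  · simp only [Finset.coe_filter, Set.mem_ofPred_eq] at hF ⊢
    exact ⟨hF.2.1.sdiff_mem hF.1, h F hF.1 hF.2.1 hF.2.2⟩
  · simp only [Finset.coe_filter, Set.mem_ofPred_eq] at hF hF'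
    rw [← Finset.sdiff_union_of_subset hF.2.1.1, ← Finset.sdiff_union_of_subset hF'.2.1.1]
    exact congrArg (· ∪ A) hFF

theorem countIn_isolates_le (S A : Finset V) :
    G.countIn S (G.Isolates A) ≤ (G.maxDissocIn (S \ G.closedNbrIn S A)).card := by
  have h := countIn_isolates_and_le (G := G) (S := S) (A := A) (P := fun _ => True)
    (Q := fun _ => True) fun _ _ _ _ => trivial
  refine le_trans (countIn_mono fun F _ hF => ⟨hF, trivial⟩) (h.trans (countIn_le_card _))

theorem isolates_pair (hd : G.IsDissociationSet (F : Set V)) (hu : u ∈ F) (hw : w ∈ F)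
    (h : G.Adj u w) : G.Isolates {u, w} F := by
  refine ⟨by simp [Finset.insert_subset_iff, hu, hw], fun a ha x hx hax => ?_⟩
  simp only [Finset.mem_insert, Finset.mem_singleton] at ha ⊢
  obtain rfl | rfl := ha
  · exact Or.inr (hd a hu x hx w hw hax h)
  · exact Or.inl (hd a hw x hx u hu hax h.symm)

theorem isolates_singleton_iff : G.Isolates {v} F ↔ v ∈ F ∧ ∀ x ∈ F, ¬ G.Adj v x := by
  simp only [Isolates, Finset.singleton_subset_iff, Finset.mem_singleton, forall_eq]
  refine and_congr_right fun _ => forall₂_congr fun x _ => ⟨fun h hx => ?_, fun h hx => absurd hx h⟩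
  exact hx.ne (h hx).symm

theorem Isolates.pair (hu : G.Isolates {u} F) (hw : G.Isolates {w} F) : G.Isolates {u, w} F := by
  rw [isolates_singleton_iff] at hu hw
  refine ⟨by simp [Finset.insert_subset_iff, hu.1, hw.1], fun a ha x hx hax => ?_⟩
  simp only [Finset.mem_insert, Finset.mem_singleton] at ha
  obtain rfl | rfl := ha
  · exact absurd hax (hu.2 x hx)
  · exact absurd hax (hw.2 x hx)

/-- A vertex of a maximal dissociation set is isolated or matched in it. -/
theorem isolates_of_mem (hF : F ∈ G.maxDissocIn S) (hv : v ∈ F) :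
    G.Isolates {v} F ∨ ∃ u ∈ G.nbrIn S v, G.Isolates {v, u} F := by
  rw [mem_maxDissocIn] at hF
  by_cases h : ∃ u ∈ F, G.Adj v u
  · obtain ⟨u, hu, hvu⟩ := h
    exact Or.inr ⟨u, mem_nbrIn.2 ⟨hF.1 hu, hvu⟩, isolates_pair hF.2.1 hv hu hvu⟩
  · push Not at h
    exact Or.inl (isolates_singleton_iff.2 ⟨hv, h⟩)

/-- A vertex outside a maximal dissociation set is blocked by a matched neighbour or by two isolated
neighbours. -/
theorem isolates_of_notMem (hF : F ∈ G.maxDissocIn S) (hvS : v ∈ S) (hv : v ∉ F) :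
    (∃ u ∈ G.nbrIn S v, ∃ w ∈ G.nbrIn S u, w ≠ v ∧ G.Isolates {u, w} F) ∨
      ∃ u ∈ G.nbrIn S v, ∃ w ∈ G.nbrIn S v, u ≠ w ∧ ¬ G.Adj u w ∧ G.Isolates {u, w} F := by
  have hF' := mem_maxDissocIn.1 hF
  by_contra! hcon
  obtain ⟨h1, h2⟩ := hcon
  have hiso (u : V) (hu : u ∈ F) (hvu : G.Adj v u) : G.Isolates {u} F := by
    obtain h | ⟨w, hw, h⟩ := isolates_of_mem hF hu
    · exact h
    · refine absurd h (h1 u (mem_nbrIn.2 ⟨hF'.1 hu, hvu⟩) w hw ?_)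
      rintro rfl
      exact hv (h.1 (by simp))
  have huniq (u w : V) (hu : u ∈ F) (hw : w ∈ F) (hvu : G.Adj v u) (hvw : G.Adj v w) : u = w := by
    by_contra hne
    have h := hiso u hu hvu
    exact h2 u (mem_nbrIn.2 ⟨hF'.1 hu, hvu⟩) w (mem_nbrIn.2 ⟨hF'.1 hw, hvw⟩) hne
      ((isolates_singleton_iff.1 h).2 w hw) (h.pair (hiso w hw hvw))
  refine hF'.2.2 v hvS hv fun a ha b hb c hc hab hac => ?_
  simp only [Finset.coe_insert, Set.mem_insert_iff, Finset.mem_coe] at ha hb hc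
  obtain rfl | ha := ha
  · exact huniq b c (hb.resolve_left hab.ne') (hc.resolve_left hac.ne') hab hac
  · by_cases hva : G.Adj v a
    · have h := (isolates_singleton_iff.1 (hiso a ha hva)).2
      rw [hb.resolve_right fun hb => h b hb hab, hc.resolve_right fun hc => h c hc hac]
    · have hne (y : V) (hy : y = v ∨ y ∈ F) (hay : G.Adj a y) : y ∈ F :=
        hy.resolve_left (by rintro rfl; exact hva hay.symm)
      exact hF'.2.1 a ha b (hne b hb hab) c (hne c hc hac) hab hac

/-- If `v` is isolated in a maximal dissociation set `F`, a neighbour `u` of `v` cannot be added, so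
it has a neighbour in `F` other than `v`. -/
theorem Isolates.exists_adj (hF : F ∈ G.maxDissocIn S) (h : G.Isolates {v} F)
    (hu : u ∈ G.nbrIn S v) : ∃ w ∈ F, G.Adj u w ∧ w ≠ v ∧ ¬ G.Adj v w := by
  have hF' := mem_maxDissocIn.1 hF
  rw [isolates_singleton_iff] at h
  rw [mem_nbrIn] at hu
  by_contra! hcon
  have hcon' : ∀ w ∈ F, G.Adj u w → w = v := fun w hw huw => by
    by_contra hne
    exact h.2 w hw (hcon w hw huw hne)
  refine hF'.2.2 u hu.1 (fun huF => h.2 u huF hu.2) fun a ha b hb c hc hab hac => ?_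
  simp only [Finset.coe_insert, Set.mem_insert_iff, Finset.mem_coe] at ha hb hc
  obtain rfl | ha := ha
  · rw [hcon' b (hb.resolve_left hab.ne') hab, hcon' c (hc.resolve_left hac.ne') hac]
  · by_cases hav : a = v
    · subst hav
      rw [hb.resolve_right fun hb => h.2 b hb hab, hc.resolve_right fun hc => h.2 c hc hac]
    · have hne (y : V) (hy : y = u ∨ y ∈ F) (hay : G.Adj a y) : y ∈ F :=
        hy.resolve_left (by rintro rfl; exact hav (hcon' a ha hay.symm))
      exact hF'.2.1 a ha b (hne b hb hab) c (hne c hc hac) hab hac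

/-- The branching inequality at a vertex. -/
theorem card_maxDissocIn_le_branch (S : Finset V) (v : V) :
    (G.maxDissocIn S).card ≤ (G.maxDissocIn (S.erase v)).card + (G.countIn S (G.Isolates {v}) +
      ∑ u ∈ G.nbrIn S v, G.countIn S (G.Isolates {v, u})) := by
  rw [← countIn_true (fun F => v ∉ F ∨ (G.Isolates {v} F ∨ ∃ u ∈ G.nbrIn S v,
    G.Isolates {v, u} F)) fun F hF => ?_]
  · refine (countIn_or _ _).trans (add_le_add (countIn_notMem_le S v) ?_)
    exact (countIn_or _ _).trans (add_le_add le_rfl (countIn_exists_mem _ _))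
  · by_cases hv : v ∈ F
    · exact Or.inr (isolates_of_mem hF hv)
    · exact Or.inl hv

theorem countIn_mem_le (S : Finset V) (v : V) :
    G.countIn S (fun F => v ∈ F) ≤ G.countIn S (G.Isolates {v}) +
      ∑ u ∈ G.nbrIn S v, G.countIn S (G.Isolates {v, u}) := by
  refine (countIn_mono fun F hF hv => isolates_of_mem hF hv).trans ((countIn_or _ _).trans ?_)
  exact add_le_add le_rfl (countIn_exists_mem _ _)

/-- A count is at most the sum over a list of sets one of which is isolated by each counted set. -/
theorem countIn_le_sum_of_cover (l : List (Finset V)) {P : Finset V → Prop}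
    (h : ∀ F ∈ G.maxDissocIn S, P F → ∃ A ∈ l, G.Isolates A F) :
    G.countIn S P ≤ (l.map fun A => G.countIn S (G.Isolates A)).sum := by
  induction l generalizing P with
  | nil => simpa using countIn_eq_zero fun F hF hP => by simpa using h F hF hP
  | cons A l ih =>
    have h' := ih (P := fun F => ∃ A ∈ l, G.Isolates A F) fun F _ hF => hF
    rw [List.map_cons, List.sum_cons]
    refine (countIn_mono fun F hF hP => ?_).trans
      ((countIn_or (G.Isolates A) fun F => ∃ A ∈ l, G.Isolates A F).trans (add_le_add le_rfl h'))
    obtain ⟨B, hB, hBF⟩ := h F hF hP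
    obtain rfl | hB := List.mem_cons.1 hB
    · exact Or.inl hBF
    · exact Or.inr ⟨B, hB, hBF⟩

/-! ### Disjoint unions and nearly complete graphs -/

theorem isDissociationSet_union {A B : Finset V} (h : ∀ a ∈ A, ∀ b ∈ B, ¬ G.Adj a b)
    (hA : G.IsDissociationSet (A : Set V)) (hB : G.IsDissociationSet (B : Set V)) :
    G.IsDissociationSet ((A ∪ B : Finset V) : Set V) := by
  intro v hv x hx w hw hvx hvw
  simp only [Finset.coe_union, Set.mem_union, Finset.mem_coe] at hv hx hw
  obtain hv | hv := hv
  · exact hA v hv x (hx.resolve_right fun hx => h v hv x hx hvx) w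
      (hw.resolve_right fun hw => h v hv w hw hvw) hvx hvw
  · exact hB v hv x (hx.resolve_left fun hx => h x hx v hv hvx.symm) w
      (hw.resolve_left fun hw => h w hw v hv hvw.symm) hvx hvw

/-- Counts of maximal dissociation sets multiply over disjoint unions. -/
theorem card_maxDissocIn_union (hd : Disjoint S T) (h : ∀ a ∈ S, ∀ b ∈ T, ¬ G.Adj a b) :
    (G.maxDissocIn (S ∪ T)).card = (G.maxDissocIn S).card * (G.maxDissocIn T).card := by
  rw [← Finset.card_product]
  have hins (x : V) (A B : Finset V) : insert x (A ∪ B) = insert x A ∪ B := by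
    rw [Finset.insert_union]
  refine Finset.card_nbij' (fun F => (F ∩ S, F ∩ T)) (fun p => p.1 ∪ p.2) ?_ ?_ ?_ ?_
  · intro F hF
    simp only [Finset.mem_coe, Finset.mem_product, mem_maxDissocIn] at hF ⊢
    obtain ⟨hFS, hFd, hm⟩ := hF
    have hF' : F = (F ∩ S) ∪ (F ∩ T) := by
      rw [← Finset.inter_union_distrib_left, Finset.inter_eq_left.2 hFS]
    refine ⟨⟨Finset.inter_subset_right, hFd.mono (by simp), fun x hx hxF hxd => ?_⟩,
      Finset.inter_subset_right, hFd.mono (by simp), fun x hx hxF hxd => ?_⟩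
    · refine hm x (Finset.mem_union_left _ hx) (fun hxF' => hxF (by simp [hx, hxF'])) ?_
      rw [hF', hins]
      refine isDissociationSet_union (fun a ha b hb => ?_) hxd (hFd.mono (by simp))
      have ha' : a ∈ S := by
        rw [Finset.mem_insert, Finset.mem_inter] at ha
        obtain rfl | ha := ha
        exacts [hx, ha.2]
      exact h a ha' b (Finset.mem_inter.1 hb).2
    · refine hm x (Finset.mem_union_right _ hx) (fun hxF' => hxF (by simp [hx, hxF'])) ?_
      rw [hF', Finset.union_comm, hins]
      refine isDissociationSet_union (fun a ha b hb hab => ?_) hxd (hFd.mono (by simp))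
      have ha' : a ∈ T := by
        rw [Finset.mem_insert, Finset.mem_inter] at ha
        obtain rfl | ha := ha
        exacts [hx, ha.2]
      exact h b (Finset.mem_inter.1 hb).2 a ha' hab.symm
  · rintro ⟨A, B⟩ hp
    simp only [Finset.mem_coe, Finset.mem_product, mem_maxDissocIn] at hp ⊢
    obtain ⟨⟨hA, hAd, hAm⟩, hB, hBd, hBm⟩ := hp
    refine ⟨Finset.union_subset_union hA hB,
      isDissociationSet_union (fun a ha b hb => h a (hA ha) b (hB hb)) hAd hBd,
      fun x hx hxF hxd => ?_⟩
    rw [Finset.mem_union, not_or] at hxF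
    obtain hx | hx := Finset.mem_union.1 hx
    · exact hAm x hx hxF.1 (hxd.mono (by
        simp only [Finset.coe_insert, Finset.coe_union]
        exact Set.insert_subset_insert Set.subset_union_left))
    · exact hBm x hx hxF.2 (hxd.mono (by
        simp only [Finset.coe_insert, Finset.coe_union]
        exact Set.insert_subset_insert Set.subset_union_right))
  · intro F hF
    have hFS := (mem_maxDissocIn.1 hF).1
    simp only
    rw [← Finset.inter_union_distrib_left, Finset.inter_eq_left.2 hFS]
  · rintro ⟨A, B⟩ hp
    simp only [Finset.mem_coe, Finset.mem_product, mem_maxDissocIn] at hp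
    have h1 := hp.1.1
    have h2 := hp.2.1
    simp only [Prod.mk.injEq]
    constructor
    · rw [Finset.union_inter_distrib_right, Finset.inter_eq_left.2 h1,
        Finset.disjoint_iff_inter_eq_empty.1 (hd.symm.mono_left h2), Finset.union_empty]
    · rw [Finset.union_inter_distrib_right, Finset.inter_eq_left.2 h2,
        Finset.disjoint_iff_inter_eq_empty.1 (hd.mono_left h1), Finset.empty_union]

theorem isDissociationSet_of_card_le_two (h : F.card ≤ 2) : G.IsDissociationSet (F : Set V) := by
  intro v hv u hu w hw hvu hvw
  by_contra hne
  have h3 : ({v, u, w} : Finset V).card = 3 := by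
    rw [Finset.card_eq_three]
    exact ⟨v, u, w, hvu.ne, hvw.ne, hne, rfl⟩
  have hsub : ({v, u, w} : Finset V) ⊆ F := by
    simp only [Finset.insert_subset_iff, Finset.singleton_subset_iff]
    exact ⟨hv, hu, hw⟩
  have := Finset.card_le_card hsub
  omega

theorem card_maxDissocIn_of_card_le_two (h : S.card ≤ 2) : (G.maxDissocIn S).card = 1 := by
  rw [Finset.card_eq_one]
  refine ⟨S, Finset.eq_singleton_iff_unique_mem.2 ⟨?_, fun F hF => ?_⟩⟩
  · exact mem_maxDissocIn.2 ⟨subset_rfl, isDissociationSet_of_card_le_two h,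
      fun x hx hx' => absurd hx hx'⟩
  · rw [mem_maxDissocIn] at hF
    refine hF.1.antisymm fun x hx => ?_
    by_contra hxF
    refine hF.2.2 x hx hxF (isDissociationSet_of_card_le_two ?_)
    exact (Finset.card_le_card (Finset.insert_subset hx hF.1)).trans h

variable (G) in
/-- `G[S]` arises from a complete graph by deleting a matching. -/
def IsNearlyComplete (S : Finset V) : Prop :=
  ∀ x ∈ S, ∀ y ∈ S, ∀ z ∈ S, x ≠ y → x ≠ z → ¬ G.Adj x y → ¬ G.Adj x z → y = z

theorem IsNearlyComplete.card_le_two (hS : G.IsNearlyComplete S) (hF : F ⊆ S)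
    (hd : G.IsDissociationSet (F : Set V)) : F.card ≤ 2 := by
  by_contra! h
  obtain ⟨a, ha, b, hb, c, hc, hab, hac, hbc⟩ := Finset.two_lt_card.1 h
  have key (x y z : V) (hx : x ∈ F) (hy : y ∈ F) (hz : z ∈ F) (hxy : x ≠ y) (hxz : x ≠ z)
      (hyz : y ≠ z) : ¬ G.Adj x y ∨ ¬ G.Adj x z := by
    by_contra! hcon
    exact hyz (hd x hx y hy z hz hcon.1 hcon.2)
  have key' (x y z : V) (hx : x ∈ F) (hy : y ∈ F) (hz : z ∈ F) (hxy : x ≠ y) (hxz : x ≠ z)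
      (hyz : y ≠ z) : G.Adj x y ∨ G.Adj x z := by
    by_contra! hcon
    exact hyz (hS x (hF hx) y (hF hy) z (hF hz) hxy hxz hcon.1 hcon.2)
  have e1 := key a b c ha hb hc hab hac hbc
  have e2 := key b a c hb ha hc hab.symm hbc hac
  have e3 := key c a b hc ha hb hac.symm hbc.symm hab
  have f1 := key' a b c ha hb hc hab hac hbc
  have f2 := key' b a c hb ha hc hab.symm hbc hac
  have f3 := key' c a b hc ha hb hac.symm hbc.symm hab
  rw [G.adj_comm b a] at e2 f2
  rw [G.adj_comm c a, G.adj_comm c b] at e3 f3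
  tauto

/-- The maximal dissociation sets of a nearly complete graph are exactly the pairs of vertices. -/
theorem IsNearlyComplete.card_maxDissocIn (hS : G.IsNearlyComplete S) (h2 : 2 ≤ S.card) :
    (G.maxDissocIn S).card = S.card.choose 2 := by
  rw [← Finset.card_powersetCard]
  congr 1
  ext F
  rw [mem_maxDissocIn, Finset.mem_powersetCard]
  refine ⟨fun ⟨hF, hd, hm⟩ => ⟨hF, ?_⟩, fun ⟨hF, hc⟩ =>
    ⟨hF, isDissociationSet_of_card_le_two hc.le, fun x hx hxF hd => ?_⟩⟩
  · have hle := hS.card_le_two hF hd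
    by_contra hne
    obtain ⟨x, hx, hxF⟩ := Finset.exists_mem_notMem_of_card_lt_card
      (show F.card < S.card by omega)
    refine hm x hx hxF (isDissociationSet_of_card_le_two ?_)
    rw [Finset.card_insert_of_notMem hxF]
    omega
  · have := hS.card_le_two (Finset.insert_subset hx hF) hd
    rw [Finset.card_insert_of_notMem hxF] at this
    omega

/-! ### Bounds relative to smaller vertex sets -/

variable (G) in
/-- The extremal bound holds on all proper subsets of `S`. -/
def BoundBelow (S : Finset V) : Prop :=
  ∀ T ⊂ S, ((G.maxDissocIn T).card : ℚ) ≤ extremalBound T.card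

theorem BoundBelow.mono (hB : G.BoundBelow S) (h : T ⊆ S) : G.BoundBelow T :=
  fun U hU => hB U (hU.trans_subset h)

theorem BoundBelow.card_le (hB : G.BoundBelow S) (hT : T ⊆ S) {k : ℤ} (h1 : 1 ≤ k)
    (hk : (T.card : ℤ) ≤ S.card - k) :
    ((G.maxDissocIn T).card : ℚ) ≤ extremalBound (S.card - k) := by
  refine (hB T (Finset.ssubset_iff_subset_ne.2 ⟨hT, ?_⟩)).trans (extremalBound_mono hk)
  rintro rfl
  omega

theorem closedNbrIn_subset : G.closedNbrIn S A ⊆ S := fun _ hx => (mem_closedNbrIn.1 hx).1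

theorem nbrIn_subset : G.nbrIn S v ⊆ S := fun _ hx => (mem_nbrIn.1 hx).1

theorem nbrIn_mono (h : T ⊆ S) : G.nbrIn T v ⊆ G.nbrIn S v :=
  fun _ hx => mem_nbrIn.2 ⟨h (mem_nbrIn.1 hx).1, (mem_nbrIn.1 hx).2⟩

theorem notMem_nbrIn : v ∉ G.nbrIn S v := fun h => (mem_nbrIn.1 h).2.ne rfl

theorem card_insert_nbrIn : (insert v (G.nbrIn S v)).card = (G.nbrIn S v).card + 1 :=
  Finset.card_insert_of_notMem notMem_nbrIn

theorem closedNbrIn_singleton (hv : v ∈ S) :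
    G.closedNbrIn S {v} = insert v (G.nbrIn S v) := by
  ext x
  simp only [mem_closedNbrIn, Finset.mem_singleton, Finset.mem_insert, mem_nbrIn]
  constructor
  · rintro ⟨hx, h | ⟨a, rfl, h⟩⟩
    exacts [Or.inl h, Or.inr ⟨hx, h⟩]
  · rintro (rfl | ⟨hx, h⟩)
    exacts [⟨hv, Or.inl rfl⟩, ⟨hx, Or.inr ⟨v, rfl, h⟩⟩]

theorem nbrIn_subset_closedNbrIn (hv : v ∈ A) : G.nbrIn S v ⊆ G.closedNbrIn S A := fun x hx => by
  rw [mem_nbrIn] at hx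
  exact mem_closedNbrIn.2 ⟨hx.1, Or.inr ⟨v, hv, hx.2⟩⟩

theorem insert_nbrIn_subset_closedNbrIn (hv : v ∈ A) (hS : v ∈ S) :
    insert v (G.nbrIn S v) ⊆ G.closedNbrIn S A :=
  Finset.insert_subset (mem_closedNbrIn.2 ⟨hS, Or.inl hv⟩) (nbrIn_subset_closedNbrIn hv)

theorem card_sdiff_closedNbrIn :
    ((S \ G.closedNbrIn S A).card : ℤ) = S.card - (G.closedNbrIn S A).card := by
  have := Finset.card_sdiff_add_card_eq_card (closedNbrIn_subset (G := G) (S := S) (A := A))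
  omega

theorem BoundBelow.isolates_le (hB : G.BoundBelow S) {k : ℤ} (h1 : 1 ≤ k)
    (hk : k ≤ (G.closedNbrIn S A).card) :
    (G.countIn S (G.Isolates A) : ℚ) ≤ extremalBound (S.card - k) := by
  refine le_trans (by exact_mod_cast countIn_isolates_le S A)
    (hB.card_le Finset.sdiff_subset h1 ?_)
  rw [card_sdiff_closedNbrIn]
  omega

theorem BoundBelow.isolates_singleton_le (hB : G.BoundBelow S) (hv : v ∈ S) :
    (G.countIn S (G.Isolates {v}) : ℚ) ≤
      extremalBound (S.card - 1 - (G.nbrIn S v).card) := by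
  have := hB.isolates_le (A := {v}) (k := 1 + (G.nbrIn S v).card) (by omega)
    (by rw [closedNbrIn_singleton hv, card_insert_nbrIn]; push_cast; omega)
  rwa [← sub_sub] at this

theorem BoundBelow.isolates_pair_le_nbrIn (hB : G.BoundBelow S) (hv : v ∈ S) (u : V) :
    (G.countIn S (G.Isolates {v, u}) : ℚ) ≤
      extremalBound (S.card - 1 - (G.nbrIn S v).card) := by
  have := hB.isolates_le (A := {v, u}) (k := 1 + (G.nbrIn S v).card) (by omega) (by
    have := Finset.card_le_card (insert_nbrIn_subset_closedNbrIn (G := G) (A := {v, u})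
      (by simp) hv)
    rw [card_insert_nbrIn] at this
    omega)
  rwa [← sub_sub] at this

/-- Bound for the maximal dissociation sets through a given vertex. -/
theorem BoundBelow.mem_le (hB : G.BoundBelow S) (hv : v ∈ S) :
    (G.countIn S (fun F => v ∈ F) : ℚ) ≤
      ((G.nbrIn S v).card + 1) * extremalBound (S.card - 1 - (G.nbrIn S v).card) := by
  have h : (G.countIn S (fun F => v ∈ F) : ℚ) ≤ G.countIn S (G.Isolates {v}) +
      ∑ u ∈ G.nbrIn S v, (G.countIn S (G.Isolates {v, u}) : ℚ) := by
    exact_mod_cast countIn_mem_le S v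
  have h1 := hB.isolates_singleton_le hv
  have h2 := Finset.sum_le_card_nsmul (G.nbrIn S v)
    (fun u => (G.countIn S (G.Isolates {v, u}) : ℚ)) _
    fun u _ => hB.isolates_pair_le_nbrIn hv u
  rw [nsmul_eq_mul] at h2
  linarith

theorem countIn_mem_eq_zero (h : v ∉ S) : G.countIn S (fun F => v ∈ F) = 0 :=
  countIn_eq_zero fun _ hF hv => h ((mem_maxDissocIn.1 hF).1 hv)

/-- Bound for the maximal dissociation sets through two given non-adjacent vertices of degree at
most `3`; the two degrees enter only through the hypothesis on the bound `X`. -/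
theorem BoundBelow.mem_mem_le (hB : G.BoundBelow H) (hw : w ∈ H) (hne : w ≠ x)
    (hwx : ¬ G.Adj w x) (hk : (G.nbrIn H w).card ≤ 3) (hl : (G.nbrIn H x).card ≤ 3) {X : ℚ}
    (hX : ∀ k l : ℕ, k ≤ 3 → l ≤ 3 →
      (k + 1) * ((l + 1) * extremalBound (H.card - 2 - k - l)) ≤ X) :
    (G.countIn H (fun F => w ∈ F ∧ x ∈ F) : ℚ) ≤ X := by
  set k := (G.nbrIn H w).card with hkdef
  have hkpos : (0 : ℚ) < k + 1 := by positivity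
  have key (A : Finset V) (hwA : w ∈ A) (hxA : x ∉ A) :
      (G.countIn H (fun F => G.Isolates A F ∧ x ∈ F) : ℚ) ≤ X / (k + 1) := by
    have h1 : G.countIn H (fun F => G.Isolates A F ∧ x ∈ F) ≤
        G.countIn (H \ G.closedNbrIn H A) (fun F => x ∈ F) :=
      countIn_isolates_and_le fun F _ _ hxF => Finset.mem_sdiff.2 ⟨hxF, hxA⟩
    have h1' : (G.countIn H (fun F => G.Isolates A F ∧ x ∈ F) : ℚ) ≤
        G.countIn (H \ G.closedNbrIn H A) (fun F => x ∈ F) := by exact_mod_cast h1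
    refine h1'.trans ?_
    have hsub : H \ G.closedNbrIn H A ⊆ H := Finset.sdiff_subset
    by_cases hx : x ∈ H \ G.closedNbrIn H A
    · have h2 := (hB.mono hsub).mem_le hx
      have h3 := (Finset.card_le_card (nbrIn_mono (G := G) (v := x) hsub)).trans hl
      set l := (G.nbrIn (H \ G.closedNbrIn H A) x).card
      refine h2.trans ?_
      rw [le_div_iff₀ hkpos, mul_comm]
      refine le_trans ?_ (hX k l hk h3)
      refine mul_le_mul_of_nonneg_left (mul_le_mul_of_nonneg_left (extremalBound_mono ?_)
        (by positivity)) hkpos.le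
      have h4 := Finset.card_le_card (insert_nbrIn_subset_closedNbrIn (G := G) hwA hw)
      rw [card_insert_nbrIn] at h4
      have h5 := card_sdiff_closedNbrIn (G := G) (S := H) (A := A)
      omega
    · rw [countIn_mem_eq_zero hx, Nat.cast_zero]
      refine div_nonneg (le_trans ?_ (hX 0 0 (by omega) (by omega))) hkpos.le
      have := extremalBound_pos (H.card - 2 - (0 : ℕ) - (0 : ℕ))
      positivity
  have h1 : G.countIn H (fun F => w ∈ F ∧ x ∈ F) ≤
      G.countIn H (fun F => G.Isolates {w} F ∧ x ∈ F) +
      ∑ y ∈ G.nbrIn H w, G.countIn H (fun F => G.Isolates {w, y} F ∧ x ∈ F) := by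
    refine le_trans (countIn_mono (Q := fun F => (G.Isolates {w} F ∧ x ∈ F) ∨
      ∃ y ∈ G.nbrIn H w, (G.Isolates {w, y} F ∧ x ∈ F)) fun F hF hP => ?_)
      ((countIn_or _ _).trans (add_le_add le_rfl (countIn_exists_mem _ _)))
    obtain h | ⟨y, hy, h⟩ := isolates_of_mem hF hP.1
    · exact Or.inl ⟨h, hP.2⟩
    · exact Or.inr ⟨y, hy, h, hP.2⟩
  have h1' : (G.countIn H (fun F => w ∈ F ∧ x ∈ F) : ℚ) ≤
      G.countIn H (fun F => G.Isolates {w} F ∧ x ∈ F) +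
      ∑ y ∈ G.nbrIn H w, (G.countIn H (fun F => G.Isolates {w, y} F ∧ x ∈ F) : ℚ) := by
    exact_mod_cast h1
  have h2 := key {w} (by simp) (by simpa using hne.symm)
  have h3 := Finset.sum_le_card_nsmul (G.nbrIn H w)
    (fun y => (G.countIn H (fun F => G.Isolates {w, y} F ∧ x ∈ F) : ℚ)) (X / (k + 1))
    fun y hy => key {w, y} (by simp) (by
      have : x ≠ y := by
        rintro rfl
        exact hwx (mem_nbrIn.1 hy).2
      simp [hne.symm, this])
  rw [nsmul_eq_mul, ← hkdef] at h3
  have h4 : X = X / (k + 1) + k * (X / (k + 1)) := by field_simp; ring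
  linarith

/-- Two adjacent vertices of a maximal dissociation set are matched. -/
theorem BoundBelow.mem_mem_le_of_adj (hB : G.BoundBelow H) (hw : w ∈ H) (hx : x ∈ H)
    (hwx : G.Adj w x) :
    (G.countIn H (fun F => w ∈ F ∧ x ∈ F) : ℚ) ≤ extremalBound (H.card - 2) := by
  have h : G.countIn H (fun F => w ∈ F ∧ x ∈ F) ≤ G.countIn H (G.Isolates {w, x}) :=
    countIn_mono fun F hF hP => isolates_pair (mem_maxDissocIn.1 hF).2.1 hP.1 hP.2 hwx
  refine le_trans (by exact_mod_cast h) (hB.isolates_le (by omega) ?_)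
  have h2 : ({w, x} : Finset V) ⊆ G.closedNbrIn H {w, x} := fun y hy => by
    refine mem_closedNbrIn.2 ⟨?_, Or.inl hy⟩
    simp only [Finset.mem_insert, Finset.mem_singleton] at hy
    obtain rfl | rfl := hy <;> assumption
  have := Finset.card_le_card h2
  rw [Finset.card_pair hwx.ne] at this
  exact_mod_cast this

theorem BoundBelow.union_le (hB : G.BoundBelow S) (hd : Disjoint T H) (hT : T ⊂ S) (hH : H ⊂ S)
    (h : ∀ a ∈ T, ∀ b ∈ H, ¬ G.Adj a b) :
    ((G.maxDissocIn (T ∪ H)).card : ℚ) ≤ extremalBound T.card * extremalBound H.card := by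
  rw [card_maxDissocIn_union hd h, Nat.cast_mul]
  exact mul_le_mul (hB T hT) (hB H hH) (by positivity) (extremalBound_pos _).le

/-- The maximal dissociation sets through a vertex of degree `1`. -/
theorem BoundBelow.mem_le_of_nbrIn_eq_singleton (hB : G.BoundBelow H) (hw : w ∈ H)
    (hy : G.nbrIn H w = {x}) :
    (G.countIn H (fun F => w ∈ F) : ℚ) ≤
      extremalBound (H.card - 2) + extremalBound (H.card - 3) := by
  have hx : x ∈ G.nbrIn H w := by simp [hy]
  rw [mem_nbrIn] at hx
  have hsub : ({w, x} : Finset V) ⊆ G.closedNbrIn H {w, x} := fun y hy => by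
    refine mem_closedNbrIn.2 ⟨?_, Or.inl hy⟩
    simp only [Finset.mem_insert, Finset.mem_singleton] at hy
    obtain rfl | rfl := hy
    exacts [hw, hx.1]
  have hc2 : ({w, x} : Finset V).card = 2 := Finset.card_pair hx.2.ne
  have hpos := extremalBound_pos ((H.card : ℤ) - 3)
  by_cases hc : G.closedNbrIn H {w, x} = {w, x}
  · -- here `{w, x}` is a component with a single maximal dissociation set
    have hH : H = {w, x} ∪ (H \ {w, x}) := by
      rw [Finset.union_sdiff_of_subset]
      exact hsub.trans closedNbrIn_subset
    have hprod := card_maxDissocIn_union (G := G) (S := {w, x}) (T := H \ {w, x})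
      Finset.disjoint_sdiff fun a ha b hb hab => (Finset.mem_sdiff.1 hb).2 (by
        rw [← hc]
        exact mem_closedNbrIn.2 ⟨(Finset.mem_sdiff.1 hb).1, Or.inr ⟨a, ha, hab⟩⟩)
    rw [← hH, card_maxDissocIn_of_card_le_two hc2.le, one_mul] at hprod
    have h1 := countIn_le_card (G := G) (S := H) (fun F => w ∈ F)
    rw [hprod] at h1
    have h2 : ((G.maxDissocIn (H \ {w, x})).card : ℚ) ≤ extremalBound (H.card - 2) := by
      refine hB.card_le Finset.sdiff_subset (by omega) ?_
      rw [← hc, card_sdiff_closedNbrIn, hc, hc2]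
      norm_num
    have h3 : (G.countIn H (fun F => w ∈ F) : ℚ) ≤ (G.maxDissocIn (H \ {w, x})).card := by
      exact_mod_cast h1
    linarith
  · have h3 : 2 < (G.closedNbrIn H {w, x}).card := by
      rw [← hc2]
      exact Finset.card_lt_card (Finset.ssubset_iff_subset_ne.2 ⟨hsub, Ne.symm hc⟩)
    have h1 : (G.countIn H (fun F => w ∈ F) : ℚ) ≤ G.countIn H (G.Isolates {w}) +
        ∑ u ∈ G.nbrIn H w, (G.countIn H (G.Isolates {w, u}) : ℚ) := by
      exact_mod_cast countIn_mem_le H w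
    rw [hy, Finset.sum_singleton] at h1
    have h2 := hB.isolates_singleton_le hw
    rw [hy, Finset.card_singleton, sub_sub] at h2
    norm_num at h2
    have h4 := hB.isolates_le (A := {w, x}) (k := 3) (by omega) (by exact_mod_cast h3)
    linarith

/-! ### Reduced vertex sets -/

variable (G) in
/-- The situation of the induction step: the bound and the part of the description of the extremal
graphs that is needed hold for all proper subsets of `S`, while `G[S]` is connected and not itself
one of the extremal components. -/
structure IsReduced (S : Finset V) : Prop where
  bound : G.BoundBelow S
  block : ∀ T ⊂ S, ((G.maxDissocIn T).card : ℚ) = extremalBound T.card → ∀ x ∈ T,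
    ∃ B ⊆ T, x ∈ B ∧ G.IsNearlyComplete B ∧ 4 ≤ B.card ∧
      ((T.card : ℤ) % 5 = 0 ∨ (T.card : ℤ) % 5 = 1 → 5 ≤ B.card)
  connected : ∀ A ⊆ S, A.Nonempty → (∀ a ∈ A, ∀ x ∈ S, G.Adj a x → x ∈ A) → A = S
  not_nearlyComplete : 4 ≤ S.card → S.card ≤ 6 → ¬ G.IsNearlyComplete S
  nonempty : S.Nonempty

variable (G) in
/-- The neighbours of `u` in `S` outside the closed neighbourhood of `v`. -/
noncomputable def outNbrIn (S : Finset V) (v u : V) : Finset V :=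
  G.nbrIn S u \ insert v (G.nbrIn S v)

theorem mem_outNbrIn : x ∈ G.outNbrIn S v u ↔ x ∈ S ∧ G.Adj u x ∧ x ≠ v ∧ ¬ G.Adj v x := by
  simp only [outNbrIn, Finset.mem_sdiff, Finset.mem_insert, mem_nbrIn]
  tauto

theorem card_closedNbrIn_pair (hv : v ∈ S) :
    (G.nbrIn S v).card + 1 + (G.outNbrIn S v u).card ≤ (G.closedNbrIn S {v, u}).card := by
  rw [← card_insert_nbrIn, outNbrIn, ← Finset.card_union_of_disjoint Finset.disjoint_sdiff]
  refine Finset.card_le_card (Finset.union_subset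
    (insert_nbrIn_subset_closedNbrIn (by simp) hv) ?_)
  exact Finset.sdiff_subset.trans (nbrIn_subset_closedNbrIn (by simp))

theorem countIn_isolates_eq_zero (hu : u ∈ G.nbrIn S v) (h : G.outNbrIn S v u = ∅) :
    G.countIn S (G.Isolates {v}) = 0 :=
  countIn_eq_zero fun F hF hi => by
    obtain ⟨w, hw, huw, hwv, hvw⟩ := hi.exists_adj hF hu
    have : w ∈ G.outNbrIn S v u :=
      mem_outNbrIn.2 ⟨(mem_maxDissocIn.1 hF).1 hw, huw, hwv, hvw⟩
    simp [h] at this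

/-- If `v` is isolated in `F` and the neighbour `u` of `v` has only one neighbour `w` outside the
closed neighbourhood of `v`, then `w ∈ F`. -/
theorem Isolates.mem_of_outNbrIn (hF : F ∈ G.maxDissocIn S) (hi : G.Isolates {v} F)
    (hu : u ∈ G.nbrIn S v) (h : G.outNbrIn S v u = {w}) : w ∈ F \ {v} := by
  obtain ⟨x, hx, hux, hxv, hvx⟩ := hi.exists_adj hF hu
  have : x ∈ G.outNbrIn S v u := mem_outNbrIn.2 ⟨(mem_maxDissocIn.1 hF).1 hx, hux, hxv, hvx⟩
  rw [h, Finset.mem_singleton] at this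
  subst this
  simp [hx, hxv]

theorem countIn_isolates_singleton_le {Q : Finset V → Prop}
    (h : ∀ F ∈ G.maxDissocIn S, G.Isolates {v} F → Q (F \ {v})) :
    G.countIn S (G.Isolates {v}) ≤ G.countIn (S \ G.closedNbrIn S {v}) Q :=
  (countIn_mono fun _ _ hF => ⟨hF, trivial⟩).trans
    (countIn_isolates_and_le (P := fun _ => True) fun F hF hi _ => h F hF hi)

theorem BoundBelow.branch_le (hB : G.BoundBelow S) (hv : v ∈ S) :
    ((G.maxDissocIn S).card : ℚ) ≤ (G.maxDissocIn (S.erase v)).card +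
      (G.countIn S (G.Isolates {v}) + ∑ u ∈ G.nbrIn S v,
        extremalBound (S.card - ((G.nbrIn S v).card + 1 + (G.outNbrIn S v u).card))) := by
  have h : ((G.maxDissocIn S).card : ℚ) ≤ (G.maxDissocIn (S.erase v)).card +
      (G.countIn S (G.Isolates {v}) +
        ∑ u ∈ G.nbrIn S v, (G.countIn S (G.Isolates {v, u}) : ℚ)) := by
    exact_mod_cast card_maxDissocIn_le_branch S v
  refine h.trans (add_le_add le_rfl (add_le_add le_rfl (Finset.sum_le_sum fun u _ => ?_)))
  exact hB.isolates_le (by omega) (by exact_mod_cast card_closedNbrIn_pair hv)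

theorem BoundBelow.erase_le (hB : G.BoundBelow S) (hv : v ∈ S) :
    ((G.maxDissocIn (S.erase v)).card : ℚ) ≤ extremalBound (S.card - 1) := by
  refine hB.card_le (S.erase_subset v) le_rfl ?_
  rw [Finset.card_erase_of_mem hv]
  have := Finset.card_pos.2 ⟨v, hv⟩
  omega

theorem sum_le_of_filter {ι : Type*} (N : Finset ι) (P : ι → Prop) [DecidablePred P] (f : ι → ℚ)
    {x y : ℚ} (hx : ∀ i ∈ N, P i → f i ≤ x) (hy : ∀ i ∈ N, ¬ P i → f i ≤ y) :
    ∑ i ∈ N, f i ≤ (N.filter P).card * x + (N.card - (N.filter P).card) * y := by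
  rw [← Finset.sum_filter_add_sum_filter_not N P]
  have h1 := Finset.sum_le_card_nsmul (N.filter P) f x fun i hi =>
    hx i (Finset.mem_filter.1 hi).1 (Finset.mem_filter.1 hi).2
  have h2 := Finset.sum_le_card_nsmul (N.filter fun i => ¬ P i) f y fun i hi =>
    hy i (Finset.mem_filter.1 hi).1 (Finset.mem_filter.1 hi).2
  rw [nsmul_eq_mul] at h1 h2
  have h3 : ((N.filter P).card : ℚ) + (N.filter fun i => ¬ P i).card = N.card := by
    exact_mod_cast Finset.card_filter_add_card_filter_not P
  rw [← h3]
  linarith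

/-- The branching inequality at `v`, with one bound for the neighbours with the property `P` and
one for the others. -/
theorem BoundBelow.branch_filter_le (hB : G.BoundBelow S) (hv : v ∈ S) (P : V → Prop)
    [DecidablePred P] {k m : ℤ}
    (hk : ∀ u ∈ G.nbrIn S v, P u → k ≤ (G.nbrIn S v).card + 1 + (G.outNbrIn S v u).card)
    (hm : ∀ u ∈ G.nbrIn S v, ¬ P u → m ≤ (G.nbrIn S v).card + 1 + (G.outNbrIn S v u).card) :
    ((G.maxDissocIn S).card : ℚ) ≤ (G.maxDissocIn (S.erase v)).card +
      (G.countIn S (G.Isolates {v}) +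
        (((G.nbrIn S v).filter P).card * extremalBound (S.card - k) +
          ((G.nbrIn S v).card - ((G.nbrIn S v).filter P).card) * extremalBound (S.card - m))) :=
  (hB.branch_le hv).trans <| add_le_add le_rfl <| add_le_add le_rfl <|
    sum_le_of_filter _ P _
      (fun u hu hP => extremalBound_mono (by have := hk u hu hP; omega))
      (fun u hu hP => extremalBound_mono (by have := hm u hu hP; omega))

/-- If all neighbours of `v` have their neighbours in the closed neighbourhood of `v`, then `S` is
this closed neighbourhood. -/
theorem IsReduced.eq_insert (hS : G.IsReduced S) (hv : v ∈ S)
    (h : ∀ u ∈ G.nbrIn S v, G.outNbrIn S v u = ∅) : insert v (G.nbrIn S v) = S := by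
  refine hS.connected _ (Finset.insert_subset hv nbrIn_subset) ⟨v, by simp⟩
    fun a ha x hx hax => ?_
  rw [Finset.mem_insert] at ha
  obtain rfl | ha := ha
  · exact Finset.mem_insert_of_mem (mem_nbrIn.2 ⟨hx, hax⟩)
  · by_contra hxN
    have : x ∈ G.outNbrIn S v a := Finset.mem_sdiff.2 ⟨mem_nbrIn.2 ⟨hx, hax⟩, hxN⟩
    simp [h a ha] at this

/-- If `v` is adjacent to all but at most one vertex of `S`, and the exceptional vertex `w` to
all but `v`, then `S - v` is not extremal. -/
theorem IsReduced.erase_lt (hS : G.IsReduced S) (hv : v ∈ S) (h5 : 5 ≤ S.card) (h6 : S.card ≤ 6)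
    (h : ∀ x ∈ S, x ≠ v → ¬ G.Adj v x → ∀ y ∈ S, y ≠ v → y ≠ x → G.Adj x y ∧ G.Adj v y) :
    ((G.maxDissocIn (S.erase v)).card : ℚ) < extremalBound (S.card - 1) := by
  refine lt_of_le_of_ne (hS.bound.erase_le hv) fun heq => ?_
  have hcard : ((S.erase v).card : ℤ) = S.card - 1 := by
    rw [Finset.card_erase_of_mem hv]
    omega
  rw [← hcard] at heq
  obtain ⟨y, hy⟩ : (S.erase v).Nonempty := Finset.card_pos.1 (by omega)
  obtain ⟨B, hBS, -, hBN, hB4, hB5⟩ := hS.block _ (Finset.erase_ssubset hv) heq y hy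
  have hBeq : B = S.erase v := by
    refine Finset.eq_of_subset_of_card_le hBS ?_
    obtain h | h : S.card = 5 ∨ S.card = 6 := by omega
    · omega
    · have := hB5 (by omega)
      omega
  subst hBeq
  refine hS.not_nearlyComplete (by omega) h6 fun a ha b hb c hc hab hac hnb hnc => ?_
  by_contra hbc
  by_cases hav : a = v
  · subst hav
    exact hnc (h b hb hab.symm hnb c hc hac.symm (Ne.symm hbc)).2
  by_cases hbv : b = v
  · subst hbv
    exact hnc (h a ha hav (fun h => hnb h.symm) c hc (Ne.symm hbc) hac.symm).1
  by_cases hcv : c = v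
  · subst hcv
    exact hnb (h a ha hav (fun h => hnc h.symm) b hb hbc hab.symm).1
  exact hbc (hBN a (Finset.mem_erase.2 ⟨hav, ha⟩) b (Finset.mem_erase.2 ⟨hbv, hb⟩) c
    (Finset.mem_erase.2 ⟨hcv, hc⟩) hab hac hnb hnc)

/-! ### Vertices of degree at least five -/

theorem IsReduced.lt_of_six_le_degree (hS : G.IsReduced S) (hv : v ∈ S)
    (hd : 6 ≤ (G.nbrIn S v).card) : ((G.maxDissocIn S).card : ℚ) < extremalBound S.card := by
  have h1 := hS.bound.branch_le hv
  have h2 := hS.bound.erase_le hv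
  have h3 := hS.bound.isolates_singleton_le hv
  have h4 := Finset.sum_le_card_nsmul (G.nbrIn S v) (fun u =>
    extremalBound (S.card - ((G.nbrIn S v).card + 1 + (G.outNbrIn S v u).card))) _
    fun u _ => extremalBound_mono
      (show _ ≤ (S.card : ℤ) - 1 - (G.nbrIn S v).card by omega)
  rw [nsmul_eq_mul] at h4
  have h5 := extremalBound_large_degree S.card _ hd
  linarith

theorem IsReduced.lt_of_degree_eq_five (hS : G.IsReduced S) (hv : v ∈ S)
    (hd : (G.nbrIn S v).card = 5) : ((G.maxDissocIn S).card : ℚ) < extremalBound S.card := by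
  classical
  have h1 := hS.bound.branch_filter_le hv (fun u => G.outNbrIn S v u = ∅) (k := 6) (m := 7)
    (fun u _ _ => by omega)
    (fun u _ hu => by
      have := Finset.card_pos.2 (Finset.nonempty_iff_ne_empty.2 hu)
      omega)
  have h2 := hS.bound.erase_le hv
  have h3 := hS.bound.isolates_singleton_le hv
  set a := ((G.nbrIn S v).filter fun u => G.outNbrIn S v u = ∅).card with ha
  have ha5 : a ≤ 5 := hd ▸ Finset.card_filter_le _ _
  obtain ⟨p, hp, ⟨h5, h6, h7, -⟩, h⟩ := extremalBound_ratios S.card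
  rw [hd, sub_sub] at h3
  norm_num at h3
  rw [hd] at h1
  obtain ha0 | ha0 := Nat.eq_zero_or_pos a
  · rw [ha0] at h1
    norm_num at h1
    rcases h with ⟨-, h⟩ | ⟨-, h⟩ | ⟨-, h⟩ | ⟨-, h⟩ | ⟨-, h⟩ <;>
    · obtain ⟨h0, h1, h2, -⟩ := h
      linarith
  · obtain ⟨u, hu⟩ := Finset.card_pos.1 ha0
    rw [Finset.mem_filter] at hu
    rw [countIn_isolates_eq_zero hu.1 hu.2, Nat.cast_zero] at h1
    obtain ha5' | ha5' : a = 5 ∨ a ≤ 4 := by omega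
    · have hall : ∀ u ∈ G.nbrIn S v, G.outNbrIn S v u = ∅ :=
        Finset.filter_eq_self.1 (Finset.eq_of_subset_of_card_le (Finset.filter_subset _ _)
          (by omega))
      have hSeq := hS.eq_insert hv hall
      have hS6 : S.card = 6 := by rw [← hSeq, card_insert_nbrIn, hd]
      have hlt := hS.erase_lt hv (by omega) (by omega) fun x hx hxv hvx => by
        rw [← hSeq, Finset.mem_insert, mem_nbrIn] at hx
        tauto
      rw [ha5'] at h1
      norm_num at h1
      rcases h with ⟨-, h⟩ | ⟨-, h⟩ | ⟨-, h⟩ | ⟨-, h⟩ | ⟨-, h⟩ <;>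
      · obtain ⟨h0, h1, h2, -⟩ := h
        linarith
    · have ha4 : (a : ℚ) ≤ 4 := by exact_mod_cast ha5'
      have hm : extremalBound (S.card - 7) ≤ extremalBound (S.card - 6) :=
        extremalBound_mono (by omega)
      have h4' : (a : ℚ) * extremalBound (S.card - 6) + ((5 : ℕ) - a) * extremalBound (S.card - 7) ≤
          4 * extremalBound (S.card - 6) + extremalBound (S.card - 7) := by
        push_cast
        nlinarith
      rcases h with ⟨-, h⟩ | ⟨-, h⟩ | ⟨-, h⟩ | ⟨-, h⟩ | ⟨-, h⟩ <;>
      · obtain ⟨h0, h1, h2, -⟩ := h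
        linarith

/-! ### Vertices of degree four -/

theorem extremalBound_three : extremalBound 3 = 18 / 5 := by
  norm_num [extremalBound, extremalCoeff]

theorem extremalBound_four : extremalBound 4 = 6 := by
  norm_num [extremalBound, extremalCoeff]

/-- If `u` separates `C` from the rest of `S`, deleting `u` gives a disjoint union. -/
theorem BoundBelow.erase_le_of_cut (hB : G.BoundBelow S) {C : Finset V} (hC : C ⊆ S) (hu : u ∈ S)
    (huC : u ∉ C) (hcl : ∀ a ∈ C, ∀ x ∈ S, G.Adj a x → x ∈ C ∨ x = u) :
    ((G.maxDissocIn (S.erase u)).card : ℚ) ≤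
      extremalBound C.card * extremalBound (S.card - 1 - C.card) := by
  have hsub : insert u C ⊆ S := Finset.insert_subset hu hC
  have hun : S.erase u = C ∪ (S \ insert u C) := by
    ext z
    have h := @hC z
    simp only [Finset.mem_erase, Finset.mem_union, Finset.mem_sdiff, Finset.mem_insert]
    by_cases hz : z ∈ C
    · have : z ≠ u := by rintro rfl; exact huC hz
      simp [hz, this, h hz]
    · simp [hz, and_comm]
  have hcard : ((S \ insert u C).card : ℤ) = S.card - 1 - C.card := by
    have := Finset.card_sdiff_add_card_eq_card hsub
    rw [Finset.card_insert_of_notMem huC] at this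
    omega
  rw [hun, ← hcard]
  refine hB.union_le (Finset.disjoint_sdiff.mono_left (Finset.subset_insert _ _))
    (Finset.ssubset_iff_subset_ne.2 ⟨hC, by rintro rfl; exact huC hu⟩)
    (Finset.sdiff_ssubset hsub ⟨u, by simp⟩) fun a ha b hb hab => ?_
  rw [Finset.mem_sdiff, Finset.mem_insert, not_or] at hb
  exact (hcl a ha b hb.1 hab).elim hb.2.2 hb.2.1

/-- If `u` separates `C` from the rest of `S` and all but two vertices of `C` are neighbours of `u`,
then after removing a closed neighbourhood containing that of `u`, the remainder of `C`
contributes a factor one. -/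
theorem BoundBelow.isolates_le_of_cut (hB : G.BoundBelow S) {C : Finset V} {q : V} (hC : C ⊆ S)
    (hu : u ∈ S) (huC : u ∉ C) (hcl : ∀ a ∈ C, ∀ x ∈ S, G.Adj a x → x ∈ C ∨ x = u) (hq : q ∈ S)
    (hqC : q ∉ C) (huq : G.Adj u q) (h2 : (C \ G.nbrIn S u).card ≤ 2) (huA : u ∈ A) :
    (G.countIn S (G.Isolates A) : ℚ) ≤ extremalBound (S.card - (C.card + 2)) := by
  refine (Nat.cast_le.2 (countIn_isolates_le S A)).trans ?_
  set T := S \ G.closedNbrIn S A with hT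
  have hTS : T ⊆ S := Finset.sdiff_subset
  have hTN (z : V) (hz : z = u ∨ G.Adj u z) (hzS : z ∈ S) : z ∉ T := fun h => by
    refine (Finset.mem_sdiff.1 h).2 (mem_closedNbrIn.2 ⟨hzS, ?_⟩)
    obtain rfl | hz := hz
    exacts [Or.inl huA, Or.inr ⟨u, huA, hz⟩]
  have huT := hTN u (Or.inl rfl) hu
  have hprod := card_maxDissocIn_union (G := G) (S := T ∩ C) (T := T \ C)
    (Finset.disjoint_sdiff.mono_left Finset.inter_subset_right) fun a ha b hb hab => by
      rw [Finset.mem_inter] at ha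
      rw [Finset.mem_sdiff] at hb
      obtain h | rfl := hcl a ha.2 b (hTS hb.1) hab
      exacts [hb.2 h, huT hb.1]
  have hTC : (T ∩ C).card ≤ 2 := by
    refine (Finset.card_le_card fun z hz => ?_).trans h2
    rw [Finset.mem_inter] at hz
    exact Finset.mem_sdiff.2 ⟨hz.2, fun h => hTN z (Or.inr (mem_nbrIn.1 h).2) (hC hz.2) hz.1⟩
  rw [Finset.union_comm, Finset.sdiff_union_inter, card_maxDissocIn_of_card_le_two hTC,
    one_mul] at hprod
  rw [hprod]
  refine hB.card_le (Finset.sdiff_subset.trans hTS) (by omega) ?_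
  have hquC : q ∉ insert u C := by simp [huq.ne', hqC]
  have hdis : Disjoint (T \ C) (insert q (insert u C)) := by
    rw [Finset.disjoint_insert_right, Finset.disjoint_insert_right]
    refine ⟨fun h => ?_, fun h => huT (Finset.mem_sdiff.1 h).1, Finset.sdiff_disjoint⟩
    exact hTN q (Or.inr huq) hq (Finset.mem_sdiff.1 h).1
  have := Finset.card_le_card (Finset.union_subset ((Finset.sdiff_subset (t := C)).trans hTS)
    (Finset.insert_subset hq (Finset.insert_subset hu hC)))
  rw [Finset.card_union_of_disjoint hdis, Finset.card_insert_of_notMem hquC,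
    Finset.card_insert_of_notMem huC] at this
  omega

/-- A vertex `v` of degree `4` whose neighbours other than the cut vertex `u` have no neighbours
outside the closed neighbourhood of `v`. -/
theorem IsReduced.lt_of_degree_eq_four_of_cut (hS : G.IsReduced S)
    (hΔ : (G.nbrIn S u).card ≤ 4) (hv : v ∈ S) (hd : (G.nbrIn S v).card = 4)
    (hu : u ∈ G.nbrIn S v) (hout : G.outNbrIn S v u ≠ ∅)
    (h : ∀ y ∈ G.nbrIn S v, y ≠ u → G.outNbrIn S v y = ∅) :
    ((G.maxDissocIn S).card : ℚ) < extremalBound S.card := by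
  obtain ⟨p, hp, ⟨e5, e6, -⟩, hr⟩ := extremalBound_ratios S.card
  have huS := mem_nbrIn.1 hu
  have hclosed : ∀ a ∈ G.nbrIn S v, a ≠ u → ∀ x ∈ S, G.Adj a x → x = v ∨ x ∈ G.nbrIn S v := by
    intro a ha hau x hx hax
    by_contra hcon
    have : x ∈ G.outNbrIn S v a :=
      Finset.mem_sdiff.2 ⟨mem_nbrIn.2 ⟨hx, hax⟩, by simpa using hcon⟩
    simp [h a ha hau] at this
  obtain ⟨N, hN⟩ : ∃ N, N = (G.nbrIn S v).erase u := ⟨_, rfl⟩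
  have hmemN (z : V) : z ∈ N ↔ z ≠ u ∧ z ∈ G.nbrIn S v := by rw [hN, Finset.mem_erase]
  have hNS : N ⊆ S := hN ▸ (Finset.erase_subset _ _).trans nbrIn_subset
  have hN3 : N.card = 3 := by rw [hN, Finset.card_erase_of_mem hu, hd]
  have hvN : v ∉ N := fun h => notMem_nbrIn ((hmemN v).1 h).2
  have huN : u ∉ N := fun h => ((hmemN u).1 h).1 rfl
  have hS0 : (insert v N).card = 4 := by rw [Finset.card_insert_of_notMem hvN, hN3]
  have hS0S : insert v N ⊆ S := Finset.insert_subset hv hNS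
  have huS0 : u ∉ insert v N := by simp [huS.2.ne', huN]
  have hcl0 : ∀ a ∈ insert v N, ∀ x ∈ S, G.Adj a x → x ∈ insert v N ∨ x = u := by
    intro a ha x hx hax
    rw [or_comm, or_iff_not_imp_left]
    intro hxu
    rw [Finset.mem_insert, hmemN] at ha ⊢
    obtain rfl | ha := ha
    · exact Or.inr ⟨hxu, mem_nbrIn.2 ⟨hx, hax⟩⟩
    · exact (hclosed a ha.2 ha.1 x hx hax).imp_right fun h => ⟨hxu, h⟩
  by_cases hj : ∃ y ∈ N, G.Adj u y
  · obtain ⟨y, hyN, huy⟩ := hj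
    obtain ⟨q, hq⟩ := Finset.nonempty_iff_ne_empty.2 hout
    rw [mem_outNbrIn] at hq
    have hqS0 : q ∉ insert v N := by
      rw [Finset.mem_insert, not_or, hmemN]
      exact ⟨hq.2.2.1, fun h => hq.2.2.2 (mem_nbrIn.1 h.2).2⟩
    have h2 : (insert v N \ G.nbrIn S u).card ≤ 2 := by
      have hsub : insert v N \ G.nbrIn S u ⊆ N.erase y := by
        intro z hz
        rw [Finset.mem_sdiff, Finset.mem_insert] at hz
        refine Finset.mem_erase.2 ⟨?_, hz.1.resolve_left ?_⟩
        · rintro rfl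
          exact hz.2 (mem_nbrIn.2 ⟨hNS hyN, huy⟩)
        · rintro rfl
          exact hz.2 (mem_nbrIn.2 ⟨hv, huS.2.symm⟩)
      have := Finset.card_le_card hsub
      rw [Finset.card_erase_of_mem hyN, hN3] at this
      exact this
    have hA := hS.bound.erase_le_of_cut hS0S huS.1 huS0 hcl0
    have hB (A : Finset V) (huA : u ∈ A) :=
      hS.bound.isolates_le_of_cut hS0S huS.1 huS0 hcl0 hq.1 hqS0 hq.2.1 h2 huA
    rw [hS0, sub_sub] at hA
    rw [hS0] at hB
    norm_num [extremalBound_four] at hA hB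
    have h1 : ((G.maxDissocIn S).card : ℚ) ≤ (G.maxDissocIn (S.erase u)).card +
        (G.countIn S (G.Isolates {u}) +
          ∑ y ∈ G.nbrIn S u, (G.countIn S (G.Isolates {u, y}) : ℚ)) := by
      exact_mod_cast card_maxDissocIn_le_branch S u
    have h2 := hB {u} (by simp)
    have h3 := Finset.sum_le_card_nsmul (G.nbrIn S u)
      (fun y => (G.countIn S (G.Isolates {u, y}) : ℚ)) _ fun y _ => hB {u, y} (by simp)
    have h4 : ((G.nbrIn S u).card : ℚ) ≤ 4 := by exact_mod_cast hΔ
    have h6 := mul_le_mul_of_nonneg_right h4 (extremalBound_pos (S.card - 6)).le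
    rw [nsmul_eq_mul] at h3
    rcases hr with ⟨-, h⟩ | ⟨-, h⟩ | ⟨-, h⟩ | ⟨-, h⟩ | ⟨-, h⟩ <;>
    · obtain ⟨h0, h1, h2, -⟩ := h
      linarith
  · push Not at hj
    have h1 := hS.bound.branch_filter_le hv (fun y => y ≠ u) (k := 5) (m := 6)
      (fun y _ _ => by omega)
      (fun y _ hy => by
        obtain rfl : y = u := not_not.1 hy
        have := Finset.card_pos.2 (Finset.nonempty_iff_ne_empty.2 hout)
        omega)
    have hf : ((G.nbrIn S v).filter fun y => y ≠ u).card = 3 := by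
      rw [Finset.filter_ne', ← hN, hN3]
    obtain ⟨y, hy⟩ : N.Nonempty := Finset.card_pos.1 (by omega)
    have hy' := (hmemN y).1 hy
    rw [hf, hd, countIn_isolates_eq_zero hy'.2 (h y hy'.2 hy'.1)] at h1
    have h2 := hS.bound.erase_le_of_cut hNS hv hvN fun a ha x hx hax => by
      obtain h | rfl := hcl0 a (Finset.mem_insert_of_mem ha) x hx hax
      · exact (Finset.mem_insert.1 h).symm
      · exact absurd hax.symm (hj a ha)
    rw [hN3, sub_sub] at h2
    norm_num [extremalBound_three] at h1 h2
    rcases hr with ⟨-, h⟩ | ⟨-, h⟩ | ⟨-, h⟩ | ⟨-, h⟩ | ⟨-, h⟩ <;>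
    · obtain ⟨h0, h1, h2, h3, h4⟩ := h
      linarith

/-- A vertex of degree `4`, exactly two of whose neighbours have no neighbours outside its closed
neighbourhood. The estimate is attained only if `S - v` is extremal, and then the block of `S - v`
at one of the two contains a vertex missed by both. -/
theorem IsReduced.lt_of_degree_eq_four_of_two (hS : G.IsReduced S) (hv : v ∈ S)
    (hd : (G.nbrIn S v).card = 4) (hu : u ∈ G.nbrIn S v) (hw : w ∈ G.nbrIn S v) (huw : u ≠ w)
    (hu0 : G.outNbrIn S v u = ∅) (hw0 : G.outNbrIn S v w = ∅)
    (h : ∀ y ∈ G.nbrIn S v, y ≠ u → y ≠ w → G.outNbrIn S v y ≠ ∅) :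
    ((G.maxDissocIn S).card : ℚ) < extremalBound S.card := by
  classical
  have h1 := hS.bound.branch_filter_le hv (fun y => y = u ∨ y = w) (k := 5) (m := 6)
    (fun y _ _ => by omega)
    (fun y hy hyn => by
      rw [not_or] at hyn
      have := Finset.card_pos.2 (Finset.nonempty_iff_ne_empty.2 (h y hy hyn.1 hyn.2))
      omega)
  have hf : (G.nbrIn S v).filter (fun y => y = u ∨ y = w) = {u, w} := by
    ext y
    simp only [Finset.mem_filter, Finset.mem_insert, Finset.mem_singleton]
    constructor
    · exact fun h => h.2
    · rintro (rfl | rfl)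
      exacts [⟨hu, Or.inl rfl⟩, ⟨hw, Or.inr rfl⟩]
  rw [hf, Finset.card_pair huw, hd, countIn_isolates_eq_zero hu hu0] at h1
  norm_num at h1
  have h2 := hS.bound.erase_le hv
  obtain ⟨p, hp, ⟨e5, e6, -⟩, hr⟩ := extremalBound_ratios S.card
  have key : (S.card : ℤ) % 5 = 1 ∨ (S.card : ℤ) % 5 = 2 →
      ((G.maxDissocIn (S.erase v)).card : ℚ) < extremalBound (S.card - 1) := by
    intro hmod
    refine lt_of_le_of_ne h2 fun heq => ?_
    have hcard : ((S.erase v).card : ℤ) = S.card - 1 := by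
      rw [Finset.card_erase_of_mem hv]
      have := Finset.card_pos.2 ⟨v, hv⟩
      omega
    rw [← hcard] at heq
    have hu' := mem_nbrIn.1 hu
    have hw' := mem_nbrIn.1 hw
    obtain ⟨B, hBS, huB, hBN, -, hB5⟩ := hS.block _ (Finset.erase_ssubset hv) heq u
      (Finset.mem_erase.2 ⟨hu'.2.ne', hu'.1⟩)
    have hB5 := hB5 (by omega)
    have hBv (z : V) (hz : z ∈ B) : z ≠ v ∧ z ∈ S := Finset.mem_erase.1 (hBS hz)
    have hmiss (a : V) (ha : G.outNbrIn S v a = ∅) (z : V) (hz : z ∈ B)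
        (hzN : z ∉ G.nbrIn S v) : ¬ G.Adj a z := fun haz => by
      have : z ∈ G.outNbrIn S v a := by
        refine mem_outNbrIn.2 ⟨(hBv z hz).2, haz, (hBv z hz).1, fun hvz => hzN ?_⟩
        exact mem_nbrIn.2 ⟨(hBv z hz).2, hvz⟩
      simp [ha] at this
    have hone : (B \ G.nbrIn S v).card ≤ 1 := by
      rw [Finset.card_le_one]
      intro a ha b hb
      rw [Finset.mem_sdiff] at ha hb
      refine hBN u huB a ha.1 b hb.1 ?_ ?_ (hmiss u hu0 a ha.1 ha.2) (hmiss u hu0 b hb.1 hb.2)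
      · rintro rfl; exact ha.2 hu
      · rintro rfl; exact hb.2 hu
    have hsum := Finset.card_sdiff_add_card_inter B (G.nbrIn S v)
    have hNB : B ∩ G.nbrIn S v = G.nbrIn S v :=
      Finset.eq_of_subset_of_card_le Finset.inter_subset_right (by omega)
    have hwB : w ∈ B := (Finset.mem_inter.1 (hNB.symm ▸ hw)).1
    have hcN : (B ∩ G.nbrIn S v).card = 4 := by rw [hNB, hd]
    obtain ⟨z, hz⟩ : (B \ G.nbrIn S v).Nonempty := Finset.card_pos.1 (by omega)
    rw [Finset.mem_sdiff] at hz
    refine huw (hBN z hz.1 u huB w hwB ?_ ?_ (fun h => hmiss u hu0 z hz.1 hz.2 h.symm)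
      fun h => hmiss w hw0 z hz.1 hz.2 h.symm)
    · rintro rfl; exact hz.2 hu
    · rintro rfl; exact hz.2 hw
  rcases hr with ⟨-, h⟩ | ⟨hm, h⟩ | ⟨hm, h⟩ | ⟨-, h⟩ | ⟨-, h⟩
  · linarith [h.1, h.2.1]
  · linarith [h.1, h.2.1, key (Or.inl hm)]
  · linarith [h.1, h.2.1, key (Or.inr hm)]
  · linarith [h.1, h.2.1]
  · linarith [h.1, h.2.1]

theorem card_nbrIn_sdiff_add_le {U : Finset V} (hU : U ⊆ G.nbrIn S v) (hUw : ∀ u ∈ U, G.Adj u w) :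
    (G.nbrIn (S \ G.closedNbrIn S {v}) w).card + U.card ≤ (G.nbrIn S w).card := by
  rw [← Finset.card_union_of_disjoint]
  · refine Finset.card_le_card (Finset.union_subset (nbrIn_mono Finset.sdiff_subset) fun u hu => ?_)
    exact mem_nbrIn.2 ⟨nbrIn_subset (hU hu), (hUw u hu).symm⟩
  · rw [Finset.disjoint_left]
    intro u hu huU
    exact (Finset.mem_sdiff.1 (mem_nbrIn.1 hu).1).2
      (nbrIn_subset_closedNbrIn (Finset.mem_singleton_self v) (hU huU))

theorem mem_sdiff_of_mem_outNbrIn (h : w ∈ G.outNbrIn S v u) :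
    w ∈ S \ G.closedNbrIn S {v} := by
  rw [mem_outNbrIn] at h
  rw [Finset.mem_sdiff, mem_closedNbrIn]
  simp [h.1, h.2.2.1, h.2.2.2]

/-- The factor `24 / 25` leaves the strict inequality needed when two vertices are forced. -/
theorem extremalBound_two_forced (z : ℤ) (hz : z % 5 = 1 ∨ z % 5 = 2) (k l : ℕ) (hk : k ≤ 3)
    (hl : l ≤ 3) :
    (k + 1) * ((l + 1) * extremalBound (z - 5 - 2 - k - l)) ≤ 24 / 25 * extremalBound (z - 6) := by
  obtain ⟨p, hp, ⟨-, e6, e7, e8, e9, e10, e11, e12, e13⟩, hr⟩ := extremalBound_ratios z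
  have e : z - 5 - 2 - k - l = z - (7 + k + l : ℕ) := by push_cast; ring
  rw [e]
  rcases hr with ⟨hm, -⟩ | ⟨-, h⟩ | ⟨-, h⟩ | ⟨hm, -⟩ | ⟨hm, -⟩
  · omega
  · obtain ⟨h0, h1, h2, h3, h4⟩ := h
    interval_cases k <;> interval_cases l <;> norm_num <;> linarith
  · obtain ⟨h0, h1, h2, h3, h4⟩ := h
    interval_cases k <;> interval_cases l <;> norm_num <;> linarith
  · omega
  · omega

/-- A vertex of degree `4` all of whose neighbours have neighbours outside its closed neighbourhood.
Unless at most two of them have just one such neighbour, a set in which `v` is isolated contains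
the outer neighbours of the others, which makes these sets rare. -/
theorem IsReduced.lt_of_degree_eq_four_of_forall (hS : G.IsReduced S)
    (hΔ : ∀ x ∈ S, (G.nbrIn S x).card ≤ 4) (hv : v ∈ S) (hd : (G.nbrIn S v).card = 4)
    (hout : ∀ u ∈ G.nbrIn S v, G.outNbrIn S v u ≠ ∅) :
    ((G.maxDissocIn S).card : ℚ) < extremalBound S.card := by
  classical
  have hpos (u : V) (hu : u ∈ G.nbrIn S v) : 0 < (G.outNbrIn S v u).card :=
    Finset.card_pos.2 (Finset.nonempty_iff_ne_empty.2 (hout u hu))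
  have h1 := hS.bound.branch_filter_le hv (fun u => (G.outNbrIn S v u).card = 1) (k := 6) (m := 7)
    (fun u _ hu => by omega) (fun u hu hu1 => by have := hpos u hu; omega)
  have h2 := hS.bound.erase_le hv
  have h3 := hS.bound.isolates_singleton_le hv
  obtain ⟨U, hU⟩ : ∃ U, U = (G.nbrIn S v).filter fun u => (G.outNbrIn S v u).card = 1 := ⟨_, rfl⟩
  have hUmem (u : V) : u ∈ U ↔ u ∈ G.nbrIn S v ∧ (G.outNbrIn S v u).card = 1 := by
    rw [hU, Finset.mem_filter]
  have hU4 : U.card ≤ 4 := by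
    rw [hU, ← hd]
    exact Finset.card_filter_le _ _
  obtain ⟨p, hp, ⟨e5, e6, e7, e8, -⟩, hr⟩ := extremalBound_ratios S.card
  rw [← hU, hd] at h1
  rw [hd, sub_sub] at h3
  norm_num at h3
  by_cases hU2 : U.card ≤ 2
  · rcases hr with ⟨-, h⟩ | ⟨-, h⟩ | ⟨-, h⟩ | ⟨-, h⟩ | ⟨-, h⟩ <;>
    · obtain ⟨h0, h1, h2, -⟩ := h
      interval_cases U.card <;> norm_num at * <;> linarith
  obtain ⟨u, hu⟩ : U.Nonempty := Finset.card_pos.1 (by omega)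
  have hu' := (hUmem u).1 hu
  obtain ⟨w, hw⟩ := Finset.card_eq_one.1 hu'.2
  have hwmem : w ∈ G.outNbrIn S v u := by simp [hw]
  have hwout := mem_outNbrIn.1 hwmem
  have hwH := mem_sdiff_of_mem_outNbrIn hwmem
  have hBH : G.BoundBelow (S \ G.closedNbrIn S {v}) := hS.bound.mono Finset.sdiff_subset
  have hHcard : ((S \ G.closedNbrIn S {v}).card : ℤ) = S.card - 5 := by
    rw [card_sdiff_closedNbrIn, closedNbrIn_singleton hv, card_insert_nbrIn, hd]
    rfl
  by_cases hsame : ∀ y ∈ U, G.outNbrIn S v y = {w}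
  · have hUw : ∀ y ∈ U, G.Adj y w := fun y hy => by
      have : w ∈ G.outNbrIn S v y := by simp [hsame y hy]
      exact (mem_outNbrIn.1 this).2.1
    have hdeg := (card_nbrIn_sdiff_add_le (fun y hy => ((hUmem y).1 hy).1) hUw).trans
      (hΔ w hwout.1)
    have h4 : (G.countIn S (G.Isolates {v}) : ℚ) ≤
        G.countIn (S \ G.closedNbrIn S {v}) (fun F => w ∈ F) := by
      exact Nat.cast_le.2 (countIn_isolates_singleton_le (Q := fun F => w ∈ F)
        fun F hF hi => hi.mem_of_outNbrIn hF hu'.1 hw)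
    have h5 := hBH.mem_le hwH
    obtain hU4' | hU3 : U.card = 4 ∨ U.card = 3 := by omega
    · have hUeq : U = G.nbrIn S v :=
        Finset.eq_of_subset_of_card_le (fun y hy => ((hUmem y).1 hy).1) (by omega)
      have hk0 : (G.nbrIn (S \ G.closedNbrIn S {v}) w).card = 0 := by omega
      rw [hk0, hHcard] at h5
      norm_num [sub_sub] at h5
      have hSeq : insert w (insert v (G.nbrIn S v)) = S := by
        refine hS.connected _ (Finset.insert_subset hwout.1 (Finset.insert_subset hv nbrIn_subset))
          ⟨v, by simp⟩ fun a ha x hx hax => ?_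
        rw [Finset.mem_insert, Finset.mem_insert] at ha
        obtain rfl | rfl | ha := ha
        · by_contra hxN
          rw [Finset.mem_insert, Finset.mem_insert, mem_nbrIn] at hxN
          push Not at hxN
          have : x ∈ G.nbrIn (S \ G.closedNbrIn S {v}) a := by
            refine mem_nbrIn.2 ⟨Finset.mem_sdiff.2 ⟨hx, ?_⟩, hax⟩
            rw [mem_closedNbrIn]
            simp only [Finset.mem_singleton, exists_eq_left]
            exact fun h => h.2.elim hxN.2.1 (hxN.2.2 hx)
          rw [Finset.card_eq_zero.1 hk0] at this
          simp at this
        · exact Finset.mem_insert_of_mem (Finset.mem_insert_of_mem (mem_nbrIn.2 ⟨hx, hax⟩))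
        · by_contra hxN
          rw [Finset.mem_insert, not_or] at hxN
          have : x ∈ G.outNbrIn S v a := Finset.mem_sdiff.2 ⟨mem_nbrIn.2 ⟨hx, hax⟩, hxN.2⟩
          rw [hsame a (hUeq ▸ ha), Finset.mem_singleton] at this
          exact hxN.1 this
      have hS6 : S.card = 6 := by
        rw [← hSeq, Finset.card_insert_of_notMem, card_insert_nbrIn, hd]
        rw [Finset.mem_insert, mem_nbrIn]
        exact fun h => h.elim hwout.2.2.1 fun h => hwout.2.2.2 h.2
      have hlt := hS.erase_lt hv (by omega) (by omega) fun x hx hxv hvx y hy hyv hyx => by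
        have hxw : x = w := by
          rw [← hSeq, Finset.mem_insert, Finset.mem_insert, mem_nbrIn] at hx
          tauto
        subst hxw
        have hyN : y ∈ G.nbrIn S v := by
          rw [← hSeq, Finset.mem_insert, Finset.mem_insert] at hy
          tauto
        exact ⟨(hUw y (hUeq ▸ hyN)).symm, (mem_nbrIn.1 hyN).2⟩
      rw [hU4'] at h1
      norm_num at h1
      rcases hr with ⟨-, h⟩ | ⟨-, h⟩ | ⟨-, h⟩ | ⟨-, h⟩ | ⟨-, h⟩ <;>
      · obtain ⟨h0, h1, h2, -⟩ := h
        linarith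
    · rw [hU3] at h1
      norm_num at h1
      obtain hk | hk : (G.nbrIn (S \ G.closedNbrIn S {v}) w).card = 0 ∨
          (G.nbrIn (S \ G.closedNbrIn S {v}) w).card = 1 := by omega
      · rw [hk, hHcard] at h5
        norm_num [sub_sub] at h5
        rcases hr with ⟨-, h⟩ | ⟨-, h⟩ | ⟨-, h⟩ | ⟨-, h⟩ | ⟨-, h⟩ <;>
        · obtain ⟨h0, h1, h2, -⟩ := h
          linarith
      · obtain ⟨y, hy⟩ := Finset.card_eq_one.1 hk
        have h6 := hBH.mem_le_of_nbrIn_eq_singleton hwH hy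
        rw [hHcard] at h6
        norm_num [sub_sub] at h6
        rcases hr with ⟨-, h⟩ | ⟨-, h⟩ | ⟨-, h⟩ | ⟨-, h⟩ | ⟨-, h⟩ <;>
        · obtain ⟨h0, h1, h2, h3, -⟩ := h
          linarith
  · push Not at hsame
    obtain ⟨y, hy, hyw⟩ := hsame
    have hy' := (hUmem y).1 hy
    obtain ⟨x, hx⟩ := Finset.card_eq_one.1 hy'.2
    have hxmem : x ∈ G.outNbrIn S v y := by simp [hx]
    have hxout := mem_outNbrIn.1 hxmem
    have hxH := mem_sdiff_of_mem_outNbrIn hxmem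
    have hwx : w ≠ x := by
      rintro rfl
      exact hyw hx
    have h4 : (G.countIn S (G.Isolates {v}) : ℚ) ≤
        G.countIn (S \ G.closedNbrIn S {v}) (fun F => w ∈ F ∧ x ∈ F) := by
      exact Nat.cast_le.2 (countIn_isolates_singleton_le (Q := fun F => w ∈ F ∧ x ∈ F)
        fun F hF hi => ⟨hi.mem_of_outNbrIn hF hu'.1 hw, hi.mem_of_outNbrIn hF hy'.1 hx⟩)
    have h1' : ((G.maxDissocIn S).card : ℚ) ≤ (G.maxDissocIn (S.erase v)).card +
        (G.countIn S (G.Isolates {v}) + 4 * extremalBound (S.card - 6)) := by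
      have hm : extremalBound (S.card - 7) ≤ extremalBound (S.card - 6) :=
        extremalBound_mono (by omega)
      have hU4' : (U.card : ℚ) ≤ 4 := by exact_mod_cast hU4
      push_cast at h1
      nlinarith
    have key : (S.card : ℤ) % 5 = 1 ∨ (S.card : ℤ) % 5 = 2 →
        (G.countIn (S \ G.closedNbrIn S {v}) (fun F => w ∈ F ∧ x ∈ F) : ℚ) <
          extremalBound (S.card - 6) := by
      intro hmod
      by_cases hadj : G.Adj w x
      · have h5 := hBH.mem_mem_le_of_adj hwH hxH hadj
        rw [hHcard] at h5
        norm_num [sub_sub] at h5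
        have h6 := extremalBound_sub_one_le (S.card - 6)
        have h7 := extremalBound_pos (S.card - 6)
        rw [sub_sub] at h6
        norm_num at h6
        linarith
      · have hdw := (card_nbrIn_sdiff_add_le (U := {u}) (by simpa using hu'.1)
          (by simpa using hwout.2.1)).trans (hΔ w hwout.1)
        have hdx := (card_nbrIn_sdiff_add_le (U := {y}) (by simpa using hy'.1)
          (by simpa using hxout.2.1)).trans (hΔ x hxout.1)
        rw [Finset.card_singleton] at hdw hdx
        have h5 := hBH.mem_mem_le hwH hwx hadj (by omega) (by omega)
          (X := 24 / 25 * extremalBound (S.card - 6)) fun k l hk hl => by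
            rw [hHcard]
            exact extremalBound_two_forced _ hmod k l hk hl
        have h7 := extremalBound_pos (S.card - 6)
        linarith
    rcases hr with ⟨-, h⟩ | ⟨hm, h⟩ | ⟨hm, h⟩ | ⟨-, h⟩ | ⟨-, h⟩
    · linarith [h.1, h.2.1, h.2.2.1]
    · linarith [h.1, h.2.1, h.2.2.1, key (Or.inl hm)]
    · linarith [h.1, h.2.1, h.2.2.1, key (Or.inr hm)]
    · linarith [h.1, h.2.1, h.2.2.1]
    · linarith [h.1, h.2.1, h.2.2.1]

theorem IsReduced.lt_of_degree_eq_four (hS : G.IsReduced S)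
    (hΔ : ∀ x ∈ S, (G.nbrIn S x).card ≤ 4) (hv : v ∈ S) (hd : (G.nbrIn S v).card = 4) :
    ((G.maxDissocIn S).card : ℚ) < extremalBound S.card := by
  classical
  obtain ⟨N, hN⟩ : ∃ N, N = (G.nbrIn S v).filter fun u => G.outNbrIn S v u = ∅ := ⟨_, rfl⟩
  have hNmem (u : V) : u ∈ N ↔ u ∈ G.nbrIn S v ∧ G.outNbrIn S v u = ∅ := by
    rw [hN, Finset.mem_filter]
  have hNsub : N ⊆ G.nbrIn S v := fun u hu => ((hNmem u).1 hu).1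
  have hN4 : N.card ≤ 4 := hd ▸ Finset.card_le_card hNsub
  have h1 := hS.bound.branch_filter_le hv (fun u => G.outNbrIn S v u = ∅) (k := 5) (m := 6)
    (fun u _ _ => by omega)
    (fun u _ hu => by
      have := Finset.card_pos.2 (Finset.nonempty_iff_ne_empty.2 hu)
      omega)
  rw [← hN, hd] at h1
  have h2 := hS.bound.erase_le hv
  have hz (u : V) (hu : u ∈ N) : G.countIn S (G.Isolates {v}) = 0 :=
    countIn_isolates_eq_zero ((hNmem u).1 hu).1 ((hNmem u).1 hu).2
  obtain ⟨p, hp, ⟨e5, e6, -⟩, hr⟩ := extremalBound_ratios S.card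
  obtain hc | hc | hc | hc | hc : N.card = 0 ∨ N.card = 1 ∨ N.card = 2 ∨ N.card = 3 ∨
    N.card = 4 := by omega
  · refine hS.lt_of_degree_eq_four_of_forall hΔ hv hd fun u hu hu0 => ?_
    have := (hNmem u).2 ⟨hu, hu0⟩
    rw [Finset.card_eq_zero.1 hc] at this
    simp at this
  · obtain ⟨u, hu⟩ := Finset.card_eq_one.1 hc
    rw [hz u (by simp [hu]), hc] at h1
    norm_num at h1
    rcases hr with ⟨-, h⟩ | ⟨-, h⟩ | ⟨-, h⟩ | ⟨-, h⟩ | ⟨-, h⟩ <;>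
    · obtain ⟨h0, h1, h2, -⟩ := h
      linarith
  · obtain ⟨u, w, huw, hNeq⟩ := Finset.card_eq_two.1 hc
    have hu := (hNmem u).1 (by simp [hNeq])
    have hw := (hNmem w).1 (by simp [hNeq])
    refine hS.lt_of_degree_eq_four_of_two hv hd hu.1 hw.1 huw hu.2 hw.2 fun y hy hyu hyw hy0 => ?_
    have := (hNmem y).2 ⟨hy, hy0⟩
    rw [hNeq] at this
    simp [hyu, hyw] at this
  · have hsd := Finset.card_sdiff_add_card_eq_card hNsub
    obtain ⟨u, hu⟩ := Finset.card_eq_one.1 (show (G.nbrIn S v \ N).card = 1 by omega)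
    have hu' : u ∈ G.nbrIn S v \ N := by simp [hu]
    rw [Finset.mem_sdiff] at hu'
    refine hS.lt_of_degree_eq_four_of_cut (hΔ u (nbrIn_subset hu'.1)) hv hd hu'.1
      (fun h => hu'.2 ((hNmem u).2 ⟨hu'.1, h⟩)) fun y hy hyu => ?_
    by_contra hy0
    have : y ∈ G.nbrIn S v \ N := Finset.mem_sdiff.2 ⟨hy, fun h => hy0 ((hNmem y).1 h).2⟩
    rw [hu, Finset.mem_singleton] at this
    exact hyu this
  · have hNeq : N = G.nbrIn S v := Finset.eq_of_subset_of_card_le hNsub (by omega)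
    have hall : ∀ u ∈ G.nbrIn S v, G.outNbrIn S v u = ∅ := fun u hu =>
      ((hNmem u).1 (hNeq ▸ hu)).2
    have hSeq := hS.eq_insert hv hall
    have hS5 : S.card = 5 := by rw [← hSeq, card_insert_nbrIn, hd]
    have hlt := hS.erase_lt hv (by omega) (by omega) fun x hx hxv hvx => by
      rw [← hSeq, Finset.mem_insert, mem_nbrIn] at hx
      tauto
    obtain ⟨u, hu⟩ : N.Nonempty := Finset.card_pos.1 (by omega)
    rw [hz u hu, hc] at h1
    norm_num at h1
    rcases hr with ⟨-, h⟩ | ⟨hm, -⟩ | ⟨hm, -⟩ | ⟨hm, -⟩ | ⟨hm, -⟩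
    · linarith [h.1, h.2.1]
    all_goals omega

/-! ### Graphs of maximum degree at most three -/

theorem le_card_closedNbrIn_pair (l : List V) (hn : l.Nodup)
    (h : ∀ x ∈ l, x ∈ S ∧ (x = u ∨ x = w ∨ G.Adj u x ∨ G.Adj w x)) :
    l.length ≤ (G.closedNbrIn S {u, w}).card := by
  rw [← List.toFinset_card_of_nodup hn]
  refine Finset.card_le_card fun x hx => ?_
  have hx := h x (List.mem_toFinset.1 hx)
  rw [mem_closedNbrIn]
  simp only [Finset.mem_insert, Finset.mem_singleton, exists_eq_or_imp, exists_eq_left]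
  tauto

/-- The covering inequality at `v`: a maximal dissociation set has `v` as an isolated vertex, or
contains as a component an edge meeting the neighbourhood of `v`, or contains two non-adjacent
neighbours of `v` as isolated vertices. The list gives these pairs together with lower bounds for
the sizes of their closed neighbourhoods. -/
theorem BoundBelow.le_of_cover (hB : G.BoundBelow S) (hv : v ∈ S) (l : List ((V × V) × ℕ))
    (hk : ∀ p ∈ l, 1 ≤ p.2 ∧ p.2 ≤ (G.closedNbrIn S {p.1.1, p.1.2}).card)
    (hE : ∀ u ∈ G.nbrIn S v, ∀ w ∈ G.nbrIn S u, ∃ p ∈ l, p.1 = (u, w) ∨ p.1 = (w, u))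
    (hP : ∀ u ∈ G.nbrIn S v, ∀ w ∈ G.nbrIn S v, u ≠ w → ¬ G.Adj u w →
      ∃ p ∈ l, p.1 = (u, w) ∨ p.1 = (w, u)) :
    ((G.maxDissocIn S).card : ℚ) ≤ G.countIn S (G.Isolates {v}) +
      (l.map fun p => extremalBound (S.card - p.2)).sum := by
  have hpair (u w : V) (F : Finset V) (h : ∃ p ∈ l, p.1 = (u, w) ∨ p.1 = (w, u))
      (hi : G.Isolates {u, w} F) : ∃ A ∈ l.map (fun p => ({p.1.1, p.1.2} : Finset V)),
      G.Isolates A F := by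
    obtain ⟨p, hp, h | h⟩ := h
    · exact ⟨_, List.mem_map_of_mem hp, by simpa [h] using hi⟩
    · exact ⟨_, List.mem_map_of_mem hp, by simpa [h, Finset.pair_comm] using hi⟩
  have h1 : (G.maxDissocIn S).card ≤ G.countIn S (G.Isolates {v}) +
      ((l.map fun p => ({p.1.1, p.1.2} : Finset V)).map
        fun A => G.countIn S (G.Isolates A)).sum := by
    rw [← countIn_true (G := G) (S := S) (fun F => G.Isolates {v} F ∨
      ∃ A ∈ l.map (fun p => ({p.1.1, p.1.2} : Finset V)), G.Isolates A F) fun F hF => ?_]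
    · exact (countIn_or _ _).trans (add_le_add le_rfl (countIn_le_sum_of_cover _ fun F _ h => h))
    · by_cases hvF : v ∈ F
      · obtain h | ⟨u, hu, h⟩ := isolates_of_mem hF hvF
        · exact Or.inl h
        · refine Or.inr (hpair u v F (hE u hu v ?_) (Finset.pair_comm v u ▸ h))
          exact mem_nbrIn.2 ⟨hv, (mem_nbrIn.1 hu).2.symm⟩
      · obtain ⟨u, hu, w, hw, -, h⟩ | ⟨u, hu, w, hw, hne, hnadj, h⟩ :=
          isolates_of_notMem hF hv hvF
        · exact Or.inr (hpair u w F (hE u hu w hw) h)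
        · exact Or.inr (hpair u w F (hP u hu w hw hne hnadj) h)
  have h2 : ((l.map fun p => ({p.1.1, p.1.2} : Finset V)).map
      fun A => (G.countIn S (G.Isolates A) : ℚ)).sum ≤
      (l.map fun p => extremalBound (S.card - p.2)).sum := by
    rw [List.map_map]
    refine List.sum_le_sum fun p hp => ?_
    exact hB.isolates_le (by have := (hk p hp).1; omega) (by exact_mod_cast (hk p hp).2)
  have h3 : ((G.maxDissocIn S).card : ℚ) ≤ G.countIn S (G.Isolates {v}) +
      ((l.map fun p => ({p.1.1, p.1.2} : Finset V)).map
        fun A => (G.countIn S (G.Isolates A) : ℚ)).sum := by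
    have : ((G.maxDissocIn S).card : ℚ) ≤ _ := Nat.cast_le.2 h1
    rwa [Nat.cast_add, Nat.cast_list_sum, List.map_map] at this
  exact h3.trans (add_le_add le_rfl h2)

theorem nbrIn_eq_pair {a b : V} (h : G.nbrIn S v = {a, b}) :
    (a ∈ S ∧ b ∈ S) ∧ (G.Adj v a ∧ G.Adj v b) ∧ ∀ x ∈ S, G.Adj v x → x = a ∨ x = b := by
  have h' (x : V) : x ∈ S ∧ G.Adj v x ↔ x = a ∨ x = b := by
    rw [← mem_nbrIn, h, Finset.mem_insert, Finset.mem_singleton]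
  have ha := (h' a).2 (Or.inl rfl)
  have hb := (h' b).2 (Or.inr rfl)
  exact ⟨⟨ha.1, hb.1⟩, ⟨ha.2, hb.2⟩, fun x hx hvx => (h' x).1 ⟨hx, hvx⟩⟩

theorem nbrIn_eq_triple {a b c : V} (h : G.nbrIn S v = {a, b, c}) :
    (a ∈ S ∧ b ∈ S ∧ c ∈ S) ∧ (G.Adj v a ∧ G.Adj v b ∧ G.Adj v c) ∧
      ∀ x ∈ S, G.Adj v x → x = a ∨ x = b ∨ x = c := by
  have h' (x : V) : x ∈ S ∧ G.Adj v x ↔ x = a ∨ x = b ∨ x = c := by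
    rw [← mem_nbrIn, h, Finset.mem_insert, Finset.mem_insert, Finset.mem_singleton]
  have ha := (h' a).2 (Or.inl rfl)
  have hb := (h' b).2 (Or.inr (Or.inl rfl))
  have hc := (h' c).2 (Or.inr (Or.inr rfl))
  exact ⟨⟨ha.1, hb.1, hc.1⟩, ⟨ha.2, hb.2, hc.2⟩, fun x hx hvx => (h' x).1 ⟨hx, hvx⟩⟩

/-- A set of four vertices closed under adjacency is all of `S`. -/
theorem IsReduced.not_closed_of_five_le (hS : G.IsReduced S) (h5 : 5 ≤ S.card) {a b c d : V}
    (ha : a ∈ S) (hb : b ∈ S) (hc : c ∈ S) (hd : d ∈ S)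
    (h : ∀ y ∈ S, ∀ x ∈ S, G.Adj y x → y = a ∨ y = b ∨ y = c ∨ y = d →
      x = a ∨ x = b ∨ x = c ∨ x = d) : False := by
  have := hS.connected {a, b, c, d} (by simp [Finset.insert_subset_iff, *]) ⟨a, by simp⟩
    fun y hy x hx hyx => by
      simp only [Finset.mem_insert, Finset.mem_singleton] at hy ⊢
      refine h y ?_ x hx hyx hy
      obtain rfl | rfl | rfl | rfl := hy <;> assumption
  have h4 := Finset.card_le_four (a := a) (b := b) (c := c) (d := d)
  rw [this] at h4
  omega

/-- A vertex of degree `2` with adjacent neighbours, one of which also has degree `2`. -/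
theorem IsReduced.lt_of_triangle_two_three (hS : G.IsReduced S)
    (h2 : ∀ x ∈ S, 2 ≤ (G.nbrIn S x).card) {a b : V} (hv : v ∈ S) (hva : G.nbrIn S v = {a, b})
    (ha : G.nbrIn S a = {v, b}) (hb : G.nbrIn S b = {v, a, w}) (hwv : w ≠ v) (hwa : w ≠ a) :
    ((G.maxDissocIn S).card : ℚ) < extremalBound S.card := by
  -- symmetry and irreflexivity of the adjacency relation, for `grind`
  have hs : ∀ x y, G.Adj x y → G.Adj y x := fun _ _ h => h.symm
  have hl : ∀ x, ¬ G.Adj x x := fun x => G.irrefl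
  obtain ⟨m1, a1, c1⟩ := nbrIn_eq_pair hva
  obtain ⟨m2, a2, c2⟩ := nbrIn_eq_pair ha
  obtain ⟨m3, a3, c3⟩ := nbrIn_eq_triple hb
  obtain ⟨y, hy, hyb⟩ := Finset.exists_mem_ne (h2 w m3.2.2) b
  rw [mem_nbrIn] at hy
  have k1 : 3 ≤ (G.closedNbrIn S {v, a}).card :=
    le_card_closedNbrIn_pair [v, a, b] (by simp; grind) (by simp; grind)
  have k2 : 4 ≤ (G.closedNbrIn S {v, b}).card :=
    le_card_closedNbrIn_pair [v, a, b, w] (by simp; grind) (by simp; grind)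
  have k3 : 4 ≤ (G.closedNbrIn S {a, b}).card :=
    le_card_closedNbrIn_pair [v, a, b, w] (by simp; grind) (by simp; grind)
  have k4 : 5 ≤ (G.closedNbrIn S {b, w}).card :=
    le_card_closedNbrIn_pair [v, a, b, w, y] (by simp; grind) (by simp; grind)
  have h := hS.bound.le_of_cover hv [((v, a), 3), ((v, b), 4), ((a, b), 4), ((b, w), 5)]
    (by simp [k1, k2, k3, k4]) (by simp [hva, ha, hb]) (by simp [hva, a2.2, a2.2.symm])
  have h0 : G.countIn S (G.Isolates {v}) = 0 := by
    refine countIn_isolates_eq_zero (u := a) (by simp [hva]) ?_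
    rw [outNbrIn, ha, hva]
    ext x
    simp
    tauto
  rw [h0] at h
  simp at h
  obtain ⟨p, hp, ⟨g5, -⟩, hr⟩ := extremalBound_ratios S.card
  rcases hr with ⟨-, g⟩ | ⟨-, g⟩ | ⟨-, g⟩ | ⟨-, g⟩ | ⟨-, g⟩ <;>
  · obtain ⟨g0, g1, g2, g3, g4⟩ := g
    linarith

/-- A vertex of degree `2` with adjacent neighbours, both of degree `3`. -/
theorem IsReduced.lt_of_triangle_three_three (hS : G.IsReduced S) (h5 : 5 ≤ S.card)
    (h2 : ∀ x ∈ S, 2 ≤ (G.nbrIn S x).card) {a b : V} (hv : v ∈ S) (hva : G.nbrIn S v = {a, b})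
    (ha : G.nbrIn S a = {v, b, w}) (hb : G.nbrIn S b = {v, a, x}) (hwv : w ≠ v) (hwb : w ≠ b)
    (hxv : x ≠ v) (hxa : x ≠ a) :
    ((G.maxDissocIn S).card : ℚ) < extremalBound S.card := by
  have hs : ∀ x y, G.Adj x y → G.Adj y x := fun _ _ h => h.symm
  have hl : ∀ x, ¬ G.Adj x x := fun x => G.irrefl
  obtain ⟨m1, a1, c1⟩ := nbrIn_eq_pair hva
  obtain ⟨m2, a2, c2⟩ := nbrIn_eq_triple ha
  obtain ⟨m3, a3, c3⟩ := nbrIn_eq_triple hb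
  have far (z : V) (hz : z ∈ S) (hzwx : z = w ∨ z = x) : ∃ y ∈ S, G.Adj z y ∧ y ≠ a ∧ y ≠ b := by
    by_contra! hcon
    have hsub : G.nbrIn S z ⊆ {a, b} := fun y hy => by
      rw [mem_nbrIn] at hy
      have := hcon y hy.1 hy.2
      simp only [Finset.mem_insert, Finset.mem_singleton]
      tauto
    have hzab := Finset.eq_of_subset_of_card_le hsub
      ((Finset.card_le_two (a := a) (b := b)).trans (h2 z hz))
    obtain ⟨-, a4, c4⟩ := nbrIn_eq_pair hzab
    have hwx : z = w ∧ z = x := by grind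
    exact hS.not_closed_of_five_le h5 hv m1.1 m1.2 hz (by grind)
  obtain ⟨y, hy, hwy, hya, hyb⟩ := far w m2.2.2 (Or.inl rfl)
  obtain ⟨z, hz, hxz, hza, hzb⟩ := far x m3.2.2 (Or.inr rfl)
  have k1 : 4 ≤ (G.closedNbrIn S {v, a}).card :=
    le_card_closedNbrIn_pair [v, a, b, w] (by simp; grind) (by simp; grind)
  have k2 : 4 ≤ (G.closedNbrIn S {v, b}).card :=
    le_card_closedNbrIn_pair [v, a, b, x] (by simp; grind) (by simp; grind)
  have k3 : 4 ≤ (G.closedNbrIn S {a, b}).card :=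
    le_card_closedNbrIn_pair [v, a, b, w] (by simp; grind) (by simp; grind)
  have k4 : 5 ≤ (G.closedNbrIn S {a, w}).card :=
    le_card_closedNbrIn_pair [v, a, b, w, y] (by simp; grind) (by simp; grind)
  have k5 : 5 ≤ (G.closedNbrIn S {b, x}).card :=
    le_card_closedNbrIn_pair [v, a, b, x, z] (by simp; grind) (by simp; grind)
  have h := hS.bound.le_of_cover hv
    [((v, a), 4), ((v, b), 4), ((a, b), 4), ((a, w), 5), ((b, x), 5)]
    (by simp [k1, k2, k3, k4, k5]) (by simp [hva, ha, hb]) (by simp [hva, a2.2, a3.2])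
  have h0 := hS.bound.isolates_singleton_le hv
  rw [hva, Finset.card_pair (by grind), sub_sub] at h0
  norm_num at h h0
  obtain ⟨p, hp, ⟨g5, -⟩, hr⟩ := extremalBound_ratios S.card
  rcases hr with ⟨-, g⟩ | ⟨-, g⟩ | ⟨-, g⟩ | ⟨-, g⟩ | ⟨-, g⟩ <;>
  · obtain ⟨g0, g1, g2, g3, g4⟩ := g
    linarith

/-- If the vertex `v` of degree `2` is isolated and its neighbour `a` has degree `2`, then the other
neighbour of `a` is forced. -/
theorem IsReduced.isolates_le_of_two (hS : G.IsReduced S) (hΔ : ∀ x ∈ S, (G.nbrIn S x).card ≤ 3)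
    {a b : V} (hv : v ∈ S) (hva : G.nbrIn S v = {a, b}) (hab : a ≠ b) (hnab : ¬ G.Adj a b)
    (ha : G.nbrIn S a = {v, w}) (hwv : w ≠ v) :
    (G.countIn S (G.Isolates {v}) : ℚ) ≤ extremalBound (S.card - 4) ∨
    (G.countIn S (G.Isolates {v}) : ℚ) ≤ 2 * extremalBound (S.card - 5) ∨
    (G.countIn S (G.Isolates {v}) : ℚ) ≤ 3 * extremalBound (S.card - 6) := by
  have hs : ∀ x y, G.Adj x y → G.Adj y x := fun _ _ h => h.symm
  have hl : ∀ x, ¬ G.Adj x x := fun x => G.irrefl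
  obtain ⟨m1, a1, c1⟩ := nbrIn_eq_pair hva
  obtain ⟨m2, a2, c2⟩ := nbrIn_eq_pair ha
  have hout : G.outNbrIn S v a = {w} := by
    ext x
    rw [mem_outNbrIn, Finset.mem_singleton]
    grind
  have hwH := mem_sdiff_of_mem_outNbrIn (G := G) (S := S) (v := v) (u := a) (w := w)
    (by simp [hout])
  have h1 : (G.countIn S (G.Isolates {v}) : ℚ) ≤
      G.countIn (S \ G.closedNbrIn S {v}) (fun F => w ∈ F) :=
    Nat.cast_le.2 (countIn_isolates_singleton_le (Q := fun F => w ∈ F)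
      fun F hF hi => hi.mem_of_outNbrIn hF (by simp [hva]) hout)
  have h2 := (hS.bound.mono (Finset.sdiff_subset (t := G.closedNbrIn S {v}))).mem_le hwH
  have h3 := (card_nbrIn_sdiff_add_le (G := G) (S := S) (v := v) (w := w) (U := {a})
    (by simp [hva]) (by simpa using a2.2)).trans (hΔ w m2.2)
  have hH : ((S \ G.closedNbrIn S {v}).card : ℤ) = S.card - 3 := by
    rw [card_sdiff_closedNbrIn, closedNbrIn_singleton hv, card_insert_nbrIn, hva,
      Finset.card_pair hab]
    rfl
  rw [Finset.card_singleton] at h3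
  rw [hH] at h2
  have h4 := h1.trans h2
  obtain hk | hk | hk : (G.nbrIn (S \ G.closedNbrIn S {v}) w).card = 0 ∨
    (G.nbrIn (S \ G.closedNbrIn S {v}) w).card = 1 ∨
    (G.nbrIn (S \ G.closedNbrIn S {v}) w).card = 2 := by omega
  · left
    rw [hk, sub_sub, sub_sub] at h4
    norm_num at h4
    exact h4
  · right; left
    rw [hk, sub_sub, sub_sub] at h4
    norm_num at h4
    exact h4
  · right; right
    rw [hk, sub_sub, sub_sub] at h4
    norm_num at h4
    exact h4

/-- A vertex of degree `2` with non-adjacent neighbours, both of degree `2`. -/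
theorem IsReduced.lt_of_path_two_two (hS : G.IsReduced S) (h5 : 5 ≤ S.card)
    (h2 : ∀ x ∈ S, 2 ≤ (G.nbrIn S x).card) (hΔ : ∀ x ∈ S, (G.nbrIn S x).card ≤ 3)
    {a b : V} (hv : v ∈ S) (hva : G.nbrIn S v = {a, b}) (hab : a ≠ b) (hnab : ¬ G.Adj a b)
    (ha : G.nbrIn S a = {v, w}) (hwv : w ≠ v) (hb : G.nbrIn S b = {v, x}) (hxv : x ≠ v) :
    ((G.maxDissocIn S).card : ℚ) < extremalBound S.card := by
  have hs : ∀ x y, G.Adj x y → G.Adj y x := fun _ _ h => h.symm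
  have hl : ∀ x, ¬ G.Adj x x := fun x => G.irrefl
  obtain ⟨m1, a1, c1⟩ := nbrIn_eq_pair hva
  obtain ⟨m2, a2, c2⟩ := nbrIn_eq_pair ha
  obtain ⟨m3, a3, c3⟩ := nbrIn_eq_pair hb
  have h0 := hS.isolates_le_of_two hΔ hv hva hab hnab ha hwv
  obtain ⟨p, hp, ⟨g5, g6, -⟩, hr⟩ := extremalBound_ratios S.card
  have k1 : 4 ≤ (G.closedNbrIn S {v, a}).card :=
    le_card_closedNbrIn_pair [v, a, b, w] (by simp; grind) (by simp; grind)
  have k2 : 4 ≤ (G.closedNbrIn S {v, b}).card :=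
    le_card_closedNbrIn_pair [v, a, b, x] (by simp; grind) (by simp; grind)
  by_cases hwx : w = x
  · subst hwx
    obtain ⟨z, hz, hwz, hza, hzb⟩ : ∃ z ∈ S, G.Adj w z ∧ z ≠ a ∧ z ≠ b := by
      by_contra! hcon
      exact hS.not_closed_of_five_le h5 hv m1.1 m1.2 m2.2 (by grind)
    have k3 : 5 ≤ (G.closedNbrIn S {a, w}).card :=
      le_card_closedNbrIn_pair [v, a, b, w, z] (by simp; grind) (by simp; grind)
    have k4 : 5 ≤ (G.closedNbrIn S {b, w}).card :=
      le_card_closedNbrIn_pair [v, a, b, w, z] (by simp; grind) (by simp; grind)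
    have k5 : 4 ≤ (G.closedNbrIn S {a, b}).card :=
      le_card_closedNbrIn_pair [v, a, b, w] (by simp; grind) (by simp; grind)
    have h := hS.bound.le_of_cover hv
      [((v, a), 4), ((v, b), 4), ((a, w), 5), ((b, w), 5), ((a, b), 4)]
      (by simp [k1, k2, k3, k4, k5]) (by simp [hva, ha, hb]) (by simp [hva])
    norm_num at h
    rcases h0 with h0 | h0 | h0 <;>
    rcases hr with ⟨-, g⟩ | ⟨-, g⟩ | ⟨-, g⟩ | ⟨-, g⟩ | ⟨-, g⟩ <;>
    · obtain ⟨g0, g1, g2, g3, g4⟩ := g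
      linarith
  · obtain ⟨y, hy, hya⟩ := Finset.exists_mem_ne (h2 w m2.2) a
    obtain ⟨z, hz, hzb⟩ := Finset.exists_mem_ne (h2 x m3.2) b
    rw [mem_nbrIn] at hy hz
    have k3 : 4 ≤ (G.closedNbrIn S {a, w}).card :=
      le_card_closedNbrIn_pair [v, a, w, y] (by simp; grind) (by simp; grind)
    have k4 : 4 ≤ (G.closedNbrIn S {b, x}).card :=
      le_card_closedNbrIn_pair [v, b, x, z] (by simp; grind) (by simp; grind)
    have k5 : 5 ≤ (G.closedNbrIn S {a, b}).card :=
      le_card_closedNbrIn_pair [v, a, b, w, x] (by simp; grind) (by simp; grind)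
    have h := hS.bound.le_of_cover hv
      [((v, a), 4), ((v, b), 4), ((a, w), 4), ((b, x), 4), ((a, b), 5)]
      (by simp [k1, k2, k3, k4, k5]) (by simp [hva, ha, hb]) (by simp [hva])
    norm_num at h
    rcases h0 with h0 | h0 | h0 <;>
    rcases hr with ⟨-, g⟩ | ⟨-, g⟩ | ⟨-, g⟩ | ⟨-, g⟩ | ⟨-, g⟩ <;>
    · obtain ⟨g0, g1, g2, g3, g4⟩ := g
      linarith

/-- If no vertex of degree `2` lies in a triangle, a neighbour of `b` has a neighbour other than `b`
and any given second neighbour of `b`. -/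
theorem exists_adj_ne_ne (h2 : ∀ x ∈ S, 2 ≤ (G.nbrIn S x).card)
    (hT : ∀ x ∈ S, (G.nbrIn S x).card = 2 → ∀ y ∈ G.nbrIn S x, ∀ z ∈ G.nbrIn S x, ¬ G.Adj y z)
    {b y y' : V} (hy : y ∈ S) (hby : G.Adj b y') :
    ∃ z ∈ S, G.Adj y z ∧ z ≠ b ∧ z ≠ y' := by
  by_contra! hcon
  have hsub : G.nbrIn S y ⊆ {b, y'} := fun z hz => by
    rw [mem_nbrIn] at hz
    have := hcon z hz.1 hz.2
    simp only [Finset.mem_insert, Finset.mem_singleton]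
    tauto
  have heq := Finset.eq_of_subset_of_card_le hsub ((Finset.card_le_two).trans (h2 y hy))
  exact hT y hy (by rw [heq, Finset.card_pair hby.ne]) b (by simp [heq]) y' (by simp [heq]) hby

/-- A vertex of degree `2` with non-adjacent neighbours, of degrees `2` and `3`. -/
theorem IsReduced.lt_of_path_two_three (hS : G.IsReduced S)
    (h2 : ∀ x ∈ S, 2 ≤ (G.nbrIn S x).card) (hΔ : ∀ x ∈ S, (G.nbrIn S x).card ≤ 3)
    (hT : ∀ x ∈ S, (G.nbrIn S x).card = 2 → ∀ y ∈ G.nbrIn S x, ∀ z ∈ G.nbrIn S x, ¬ G.Adj y z)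
    {a b y y' : V} (hv : v ∈ S) (hva : G.nbrIn S v = {a, b}) (hab : a ≠ b) (hnab : ¬ G.Adj a b)
    (ha : G.nbrIn S a = {v, w}) (hwv : w ≠ v) (hb : G.nbrIn S b = {v, y, y'}) (hyv : y ≠ v)
    (hyv' : y' ≠ v) (hyy : y ≠ y') :
    ((G.maxDissocIn S).card : ℚ) < extremalBound S.card := by
  have hs : ∀ x y, G.Adj x y → G.Adj y x := fun _ _ h => h.symm
  have hl : ∀ x, ¬ G.Adj x x := fun x => G.irrefl
  obtain ⟨m1, a1, c1⟩ := nbrIn_eq_pair hva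
  obtain ⟨m2, a2, c2⟩ := nbrIn_eq_pair ha
  obtain ⟨m3, a3, c3⟩ := nbrIn_eq_triple hb
  have h0 := hS.isolates_le_of_two hΔ hv hva hab hnab ha hwv
  obtain ⟨q, hq, hqa⟩ := Finset.exists_mem_ne (h2 w m2.2) a
  rw [mem_nbrIn] at hq
  obtain ⟨z, hz, hyz, hzb, hzy⟩ := exists_adj_ne_ne h2 hT (y := y) m3.2.1 a3.2.2
  obtain ⟨z', hz', hyz', hzb', hzy'⟩ := exists_adj_ne_ne h2 hT (y := y') m3.2.2 a3.2.1
  clear hT h2 hΔ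
  have k1 : 4 ≤ (G.closedNbrIn S {v, a}).card :=
    le_card_closedNbrIn_pair [v, a, b, w] (by simp; grind) (by simp; grind)
  have k2 : 5 ≤ (G.closedNbrIn S {v, b}).card :=
    le_card_closedNbrIn_pair [v, a, b, y, y'] (by simp; grind) (by simp; grind)
  have k3 : 4 ≤ (G.closedNbrIn S {a, w}).card :=
    le_card_closedNbrIn_pair [v, a, w, q] (by simp; grind) (by simp; grind)
  have k4 : 5 ≤ (G.closedNbrIn S {b, y}).card :=
    le_card_closedNbrIn_pair [v, b, y, y', z] (by simp; grind) (by simp; grind)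
  have k5 : 5 ≤ (G.closedNbrIn S {b, y'}).card :=
    le_card_closedNbrIn_pair [v, b, y, y', z'] (by simp; grind) (by simp; grind)
  have k6 : 5 ≤ (G.closedNbrIn S {a, b}).card :=
    le_card_closedNbrIn_pair [v, a, b, y, y'] (by simp; grind) (by simp; grind)
  have h := hS.bound.le_of_cover hv
    [((v, a), 4), ((v, b), 5), ((a, w), 4), ((b, y), 5), ((b, y'), 5), ((a, b), 5)]
    (by simp [k1, k2, k3, k4, k5, k6]) (by simp [hva, ha, hb]) (by simp [hva])
  norm_num at h
  obtain ⟨p, hp, ⟨g5, g6, -⟩, hr⟩ := extremalBound_ratios S.card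
  rcases h0 with h0 | h0 | h0 <;>
  rcases hr with ⟨-, g⟩ | ⟨-, g⟩ | ⟨-, g⟩ | ⟨-, g⟩ | ⟨-, g⟩ <;>
  · obtain ⟨g0, g1, g2, g3, g4⟩ := g
    linarith

/-- A vertex of degree `2` with non-adjacent neighbours, both of degree `3`. -/
theorem IsReduced.lt_of_path_three_three (hS : G.IsReduced S)
    (h2 : ∀ x ∈ S, 2 ≤ (G.nbrIn S x).card)
    (hT : ∀ x ∈ S, (G.nbrIn S x).card = 2 → ∀ y ∈ G.nbrIn S x, ∀ z ∈ G.nbrIn S x, ¬ G.Adj y z)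
    {a b x x' y y' : V} (hv : v ∈ S) (hva : G.nbrIn S v = {a, b}) (hab : a ≠ b)
    (hnab : ¬ G.Adj a b) (ha : G.nbrIn S a = {v, x, x'}) (hxv : x ≠ v) (hxv' : x' ≠ v)
    (hxx : x ≠ x') (hb : G.nbrIn S b = {v, y, y'}) (hyv : y ≠ v) (hyv' : y' ≠ v) (hyy : y ≠ y') :
    ((G.maxDissocIn S).card : ℚ) < extremalBound S.card := by
  have hs : ∀ x y, G.Adj x y → G.Adj y x := fun _ _ h => h.symm
  have hl : ∀ x, ¬ G.Adj x x := fun x => G.irrefl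
  obtain ⟨m1, a1, c1⟩ := nbrIn_eq_pair hva
  obtain ⟨m2, a2, c2⟩ := nbrIn_eq_triple ha
  obtain ⟨m3, a3, c3⟩ := nbrIn_eq_triple hb
  have h0 := hS.bound.isolates_singleton_le hv
  rw [hva, Finset.card_pair hab, sub_sub] at h0
  obtain ⟨z, hz, hyz, hzb, hzy⟩ := exists_adj_ne_ne h2 hT (y := y) m3.2.1 a3.2.2
  obtain ⟨z', hz', hyz', hzb', hzy'⟩ := exists_adj_ne_ne h2 hT (y := y') m3.2.2 a3.2.1
  obtain ⟨q, hq, hxq, hqa, hqx⟩ := exists_adj_ne_ne h2 hT (y := x) m2.2.1 a2.2.2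
  obtain ⟨q', hq', hxq', hqa', hqx'⟩ := exists_adj_ne_ne h2 hT (y := x') m2.2.2 a2.2.1
  clear hT h2
  have k1 : 5 ≤ (G.closedNbrIn S {v, a}).card :=
    le_card_closedNbrIn_pair [v, a, b, x, x'] (by simp; grind) (by simp; grind)
  have k2 : 5 ≤ (G.closedNbrIn S {v, b}).card :=
    le_card_closedNbrIn_pair [v, a, b, y, y'] (by simp; grind) (by simp; grind)
  have k3 : 5 ≤ (G.closedNbrIn S {a, x}).card :=
    le_card_closedNbrIn_pair [v, a, x, x', q] (by simp; grind) (by simp; grind)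
  have k3' : 5 ≤ (G.closedNbrIn S {a, x'}).card :=
    le_card_closedNbrIn_pair [v, a, x, x', q'] (by simp; grind) (by simp; grind)
  have k4 : 5 ≤ (G.closedNbrIn S {b, y}).card :=
    le_card_closedNbrIn_pair [v, b, y, y', z] (by simp; grind) (by simp; grind)
  have k5 : 5 ≤ (G.closedNbrIn S {b, y'}).card :=
    le_card_closedNbrIn_pair [v, b, y, y', z'] (by simp; grind) (by simp; grind)
  have k6 : 5 ≤ (G.closedNbrIn S {a, b}).card :=
    le_card_closedNbrIn_pair [v, a, b, y, y'] (by simp; grind) (by simp; grind)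
  have h := hS.bound.le_of_cover hv
    [((v, a), 5), ((v, b), 5), ((a, x), 5), ((a, x'), 5), ((b, y), 5), ((b, y'), 5), ((a, b), 5)]
    (by simp [k1, k2, k3, k3', k4, k5, k6]) (by simp [hva, ha, hb]) (by simp [hva])
  norm_num at h h0
  obtain ⟨p, hp, ⟨g5, g6, -⟩, hr⟩ := extremalBound_ratios S.card
  rcases hr with ⟨-, g⟩ | ⟨-, g⟩ | ⟨-, g⟩ | ⟨-, g⟩ | ⟨-, g⟩ <;>
  · obtain ⟨g0, g1, g2, g3, g4⟩ := g
    linarith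

/-! ### Cubic graphs and vertices of small degree -/

theorem exists_eq_pair_of_mem {s : Finset V} {a : V} (hs : s.card = 2) (ha : a ∈ s) :
    ∃ b, b ≠ a ∧ s = {a, b} := by
  obtain ⟨x, y, hxy, rfl⟩ := Finset.card_eq_two.1 hs
  simp only [Finset.mem_insert, Finset.mem_singleton] at ha
  obtain rfl | rfl := ha
  exacts [⟨y, hxy.symm, rfl⟩, ⟨x, hxy, Finset.pair_comm _ _⟩]

theorem exists_eq_triple_of_mem {s : Finset V} {a : V} (hs : s.card = 3) (ha : a ∈ s) :
    ∃ b c, b ≠ a ∧ c ≠ a ∧ b ≠ c ∧ s = {a, b, c} := by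
  have h : (s.erase a).card = 2 := by rw [Finset.card_erase_of_mem ha, hs]
  obtain ⟨b, c, hbc, hs'⟩ := Finset.card_eq_two.1 h
  have hb : b ∈ s.erase a := by simp [hs']
  have hc : c ∈ s.erase a := by simp [hs']
  exact ⟨b, c, (Finset.mem_erase.1 hb).1, (Finset.mem_erase.1 hc).1, hbc,
    by rw [← hs', Finset.insert_erase ha]⟩

theorem exists_eq_triple_of_mem_of_mem {s : Finset V} {a b : V} (hs : s.card = 3) (ha : a ∈ s)
    (hb : b ∈ s) (hab : a ≠ b) : ∃ c, c ≠ a ∧ c ≠ b ∧ s = {a, b, c} := by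
  obtain ⟨x, y, hx, hy, hxy, rfl⟩ := exists_eq_triple_of_mem hs ha
  simp only [Finset.mem_insert, Finset.mem_singleton] at hb
  obtain rfl | rfl | rfl := hb
  · exact absurd rfl hab
  · exact ⟨y, hy, hxy.symm, rfl⟩
  · exact ⟨x, hx, hxy, by rw [Finset.pair_comm]⟩

/-- Two adjacent vertices with two common neighbours in a cubic graph. -/
theorem IsReduced.lt_of_diamond (hS : G.IsReduced S) (h5 : 5 ≤ S.card)
    (h3 : ∀ x ∈ S, (G.nbrIn S x).card = 3) {a b : V} (hu : u ∈ S) (hua : G.nbrIn S u = {w, a, b})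
    (hwa : G.nbrIn S w = {u, a, b}) (hab : a ≠ b) :
    ((G.maxDissocIn S).card : ℚ) < extremalBound S.card := by
  have hs : ∀ x y, G.Adj x y → G.Adj y x := fun _ _ h => h.symm
  have hl : ∀ x, ¬ G.Adj x x := fun x => G.irrefl
  obtain ⟨m1, a1, c1⟩ := nbrIn_eq_triple hua
  obtain ⟨m2, a2, c2⟩ := nbrIn_eq_triple hwa
  obtain ⟨y, hyu, hyw, hy⟩ := exists_eq_triple_of_mem_of_mem (h3 a m1.2.1)
    (mem_nbrIn.2 ⟨hu, hs _ _ a1.2.1⟩) (mem_nbrIn.2 ⟨m1.1, hs _ _ a2.2.1⟩) a1.1.ne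
  obtain ⟨z, hzu, hzw, hz⟩ := exists_eq_triple_of_mem_of_mem (h3 b m1.2.2)
    (mem_nbrIn.2 ⟨hu, hs _ _ a1.2.2⟩) (mem_nbrIn.2 ⟨m1.1, hs _ _ a2.2.2⟩) a1.1.ne
  obtain ⟨m3, a3, c3⟩ := nbrIn_eq_triple hy
  obtain ⟨m4, a4, c4⟩ := nbrIn_eq_triple hz
  have hnab : ¬ G.Adj a b := fun h =>
    hS.not_closed_of_five_le h5 hu m1.1 m1.2.1 m1.2.2 (by grind)
  obtain ⟨y', hy', hya'⟩ := Finset.exists_mem_ne (s := G.nbrIn S y)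
    (by rw [h3 y m3.2.2]; omega) a
  obtain ⟨z', hz', hzb'⟩ := Finset.exists_mem_ne (s := G.nbrIn S z)
    (by rw [h3 z m4.2.2]; omega) b
  rw [mem_nbrIn] at hy' hz'
  clear h3
  have k1 : 4 ≤ (G.closedNbrIn S {u, w}).card :=
    le_card_closedNbrIn_pair [u, w, a, b] (by simp; grind) (by simp; grind)
  have k2 : 5 ≤ (G.closedNbrIn S {u, a}).card :=
    le_card_closedNbrIn_pair [u, w, a, b, y] (by simp; grind) (by simp; grind)
  have k3 : 5 ≤ (G.closedNbrIn S {u, b}).card :=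
    le_card_closedNbrIn_pair [u, w, a, b, z] (by simp; grind) (by simp; grind)
  have k4 : 5 ≤ (G.closedNbrIn S {w, a}).card :=
    le_card_closedNbrIn_pair [u, w, a, b, y] (by simp; grind) (by simp; grind)
  have k5 : 5 ≤ (G.closedNbrIn S {w, b}).card :=
    le_card_closedNbrIn_pair [u, w, a, b, z] (by simp; grind) (by simp; grind)
  have k6 : 5 ≤ (G.closedNbrIn S {a, y}).card :=
    le_card_closedNbrIn_pair [u, w, a, y, y'] (by simp; grind) (by simp; grind)
  have k7 : 5 ≤ (G.closedNbrIn S {b, z}).card :=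
    le_card_closedNbrIn_pair [u, w, b, z, z'] (by simp; grind) (by simp; grind)
  have k8 : 5 ≤ (G.closedNbrIn S {a, b}).card :=
    le_card_closedNbrIn_pair [u, w, a, b, y] (by simp; grind) (by simp; grind)
  have h := hS.bound.le_of_cover hu
    [((u, w), 4), ((u, a), 5), ((u, b), 5), ((w, a), 5), ((w, b), 5), ((a, y), 5), ((b, z), 5),
      ((a, b), 5)]
    (by simp [k1, k2, k3, k4, k5, k6, k7, k8]) (by simp [hua, hwa, hy, hz])
    (by simp [hua, a2.2])
  have h0 : G.countIn S (G.Isolates {u}) = 0 := by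
    refine countIn_isolates_eq_zero (u := w) (by simp [hua]) ?_
    rw [outNbrIn, hwa, hua]
    ext x
    simp
    tauto
  rw [h0] at h
  norm_num at h
  obtain ⟨p, hp, ⟨g5, -⟩, hr⟩ := extremalBound_ratios S.card
  rcases hr with ⟨-, g⟩ | ⟨-, g⟩ | ⟨-, g⟩ | ⟨-, g⟩ | ⟨-, g⟩ <;>
  · obtain ⟨g0, g1, g2, g3, g4⟩ := g
    linarith

/-- A triangle in a cubic graph without diamonds. -/
theorem IsReduced.lt_of_cubic_triangle (hS : G.IsReduced S)
    (h3 : ∀ x ∈ S, (G.nbrIn S x).card = 3)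
    (hD : ∀ x ∈ S, ∀ y ∈ S, ∀ z ∈ S, ∀ w ∈ S, G.Adj x y → G.Adj x z → G.Adj y z → G.Adj x w →
      G.Adj y w → z = w) {a b : V} (hv : v ∈ S) (ha : a ∈ S) (hb : b ∈ S) (hva : G.Adj v a)
    (hvb : G.Adj v b) (hab : G.Adj a b) :
    ((G.maxDissocIn S).card : ℚ) < extremalBound S.card := by
  have hs : ∀ x y, G.Adj x y → G.Adj y x := fun _ _ h => h.symm
  have hl : ∀ x, ¬ G.Adj x x := fun x => G.irrefl
  obtain ⟨c, hca, hcb, hc⟩ := exists_eq_triple_of_mem_of_mem (h3 v hv)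
    (mem_nbrIn.2 ⟨ha, hva⟩) (mem_nbrIn.2 ⟨hb, hvb⟩) hab.ne
  obtain ⟨x, hxv, hxb, hx⟩ := exists_eq_triple_of_mem_of_mem (h3 a ha)
    (mem_nbrIn.2 ⟨hv, hva.symm⟩) (mem_nbrIn.2 ⟨hb, hab⟩) hvb.ne
  obtain ⟨y, hyv, hya, hy⟩ := exists_eq_triple_of_mem_of_mem (h3 b hb)
    (mem_nbrIn.2 ⟨hv, hvb.symm⟩) (mem_nbrIn.2 ⟨ha, hab.symm⟩) hva.ne
  obtain ⟨m1, a1, c1⟩ := nbrIn_eq_triple hc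
  obtain ⟨m2, a2, c2⟩ := nbrIn_eq_triple hx
  obtain ⟨m3, a3, c3⟩ := nbrIn_eq_triple hy
  obtain ⟨p, q, hpv, hqv, hpq, hz⟩ := exists_eq_triple_of_mem (h3 c m1.2.2)
    (mem_nbrIn.2 ⟨hv, a1.2.2.symm⟩)
  obtain ⟨m4, a4, c4⟩ := nbrIn_eq_triple hz
  have hac : ¬ G.Adj a c := fun h => hcb (hD v hv a ha b hb c m1.2.2 hva hvb hab a1.2.2 h).symm
  have hbc : ¬ G.Adj b c := fun h =>
    hca (hD v hv b hb a ha c m1.2.2 hvb hva hab.symm a1.2.2 h).symm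
  have hxy : x ≠ y := by
    rintro rfl
    exact hxv (hD a ha b hb v hv x m2.2.2 hab hva.symm hvb.symm a2.2.2 a3.2.2).symm
  obtain ⟨x1, x2, hx1, hx2, hx12, hx'⟩ := exists_eq_triple_of_mem (h3 x m2.2.2)
    (mem_nbrIn.2 ⟨ha, a2.2.2.symm⟩)
  obtain ⟨y1, y2, hy1, hy2, hy12, hy'⟩ := exists_eq_triple_of_mem (h3 y m3.2.2)
    (mem_nbrIn.2 ⟨hb, a3.2.2.symm⟩)
  obtain ⟨m5, a5, c5⟩ := nbrIn_eq_triple hx'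
  obtain ⟨m6, a6, c6⟩ := nbrIn_eq_triple hy'
  have h2 : ∀ x ∈ S, 2 ≤ (G.nbrIn S x).card := fun x hx => by rw [h3 x hx]; omega
  have hT : ∀ x ∈ S, (G.nbrIn S x).card = 2 → ∀ y ∈ G.nbrIn S x, ∀ z ∈ G.nbrIn S x, ¬ G.Adj y z :=
    fun x hx hx2 => by rw [h3 x hx] at hx2; omega
  obtain ⟨p', hp', hpp', hpc', hpq'⟩ := exists_adj_ne_ne h2 hT (y := p) m4.2.1 a4.2.2
  obtain ⟨q', hq', hqq', hqc', hqp'⟩ := exists_adj_ne_ne h2 hT (y := q) m4.2.2 a4.2.1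
  have h0 := hS.bound.isolates_singleton_le hv
  rw [h3 v hv, sub_sub] at h0
  clear h3 hD hT h2
  have k1 : 5 ≤ (G.closedNbrIn S {v, a}).card :=
    le_card_closedNbrIn_pair [v, a, b, c, x] (by simp; grind) (by simp; grind)
  have k2 : 5 ≤ (G.closedNbrIn S {v, b}).card :=
    le_card_closedNbrIn_pair [v, a, b, c, y] (by simp; grind) (by simp; grind)
  have k3 : 5 ≤ (G.closedNbrIn S {a, b}).card :=
    le_card_closedNbrIn_pair [v, a, b, x, y] (by simp; grind) (by simp; grind)
  have k4 : 6 ≤ (G.closedNbrIn S {v, c}).card :=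
    le_card_closedNbrIn_pair [v, a, b, c, p, q] (by simp; grind) (by simp; grind)
  have k5 : 6 ≤ (G.closedNbrIn S {a, x}).card :=
    le_card_closedNbrIn_pair [a, v, b, x, x1, x2] (by simp; grind) (by simp; grind)
  have k6 : 6 ≤ (G.closedNbrIn S {b, y}).card :=
    le_card_closedNbrIn_pair [b, v, a, y, y1, y2] (by simp; grind) (by simp; grind)
  have k7 : 5 ≤ (G.closedNbrIn S {c, p}).card :=
    le_card_closedNbrIn_pair [c, v, p, q, p'] (by simp; grind) (by simp; grind)
  have k8 : 5 ≤ (G.closedNbrIn S {c, q}).card :=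
    le_card_closedNbrIn_pair [c, v, p, q, q'] (by simp; grind) (by simp; grind)
  have k9 : 6 ≤ (G.closedNbrIn S {a, c}).card :=
    le_card_closedNbrIn_pair [a, c, v, b, p, q] (by simp; grind) (by simp; grind)
  have k10 : 6 ≤ (G.closedNbrIn S {b, c}).card :=
    le_card_closedNbrIn_pair [b, c, v, a, p, q] (by simp; grind) (by simp; grind)
  have h := hS.bound.le_of_cover hv
    [((v, a), 5), ((v, b), 5), ((a, b), 5), ((v, c), 6), ((a, x), 6), ((b, y), 6), ((c, p), 5),
      ((c, q), 5), ((a, c), 6), ((b, c), 6)]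
    (by simp [k1, k2, k3, k4, k5, k6, k7, k8, k9, k10]) (by simp [hc, hx, hy, hz])
    (by simp [hc, hab, hab.symm])
  norm_num at h h0
  obtain ⟨p, hp, ⟨g5, g6, -⟩, hr⟩ := extremalBound_ratios S.card
  rcases hr with ⟨-, g⟩ | ⟨-, g⟩ | ⟨-, g⟩ | ⟨-, g⟩ | ⟨-, g⟩ <;>
  · obtain ⟨g0, g1, g2, g3, g4⟩ := g
    linarith

theorem six_le_card_closedNbrIn_pair (hu : u ∈ S) (hw : w ∈ S) (huw : u ≠ w) (hnuw : ¬ G.Adj u w)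
    (h3 : (G.nbrIn S u).card = 3) (h3' : (G.nbrIn S w).card = 3)
    (hne : G.nbrIn S u ≠ G.nbrIn S w) : 6 ≤ (G.closedNbrIn S {u, w}).card := by
  have h4 : 3 < (G.nbrIn S u ∪ G.nbrIn S w).card := by
    by_contra! h
    have e1 := Finset.eq_of_subset_of_card_le (Finset.subset_union_left
      (s₁ := G.nbrIn S u) (s₂ := G.nbrIn S w)) (by omega)
    have e2 := Finset.eq_of_subset_of_card_le (Finset.subset_union_right
      (s₁ := G.nbrIn S u) (s₂ := G.nbrIn S w)) (by omega)
    exact hne (e1.trans e2.symm)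
  have hsub : insert u (insert w (G.nbrIn S u ∪ G.nbrIn S w)) ⊆ G.closedNbrIn S {u, w} := by
    refine Finset.insert_subset (mem_closedNbrIn.2 ⟨hu, by simp⟩)
      (Finset.insert_subset (mem_closedNbrIn.2 ⟨hw, by simp⟩) (Finset.union_subset ?_ ?_))
    · exact nbrIn_subset_closedNbrIn (by simp)
    · exact nbrIn_subset_closedNbrIn (by simp)
  refine le_trans ?_ (Finset.card_le_card hsub)
  rw [Finset.card_insert_of_notMem, Finset.card_insert_of_notMem]
  · omega
  · simp [mem_nbrIn, hnuw]
  · simp only [Finset.mem_insert, Finset.mem_union, mem_nbrIn, not_or]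
    exact ⟨huw, fun h => h.2.ne rfl, fun h => hnuw h.2.symm⟩

theorem five_le_card_closedNbrIn_pair (hu : u ∈ S) (hw : w ∈ S) (huw : u ≠ w)
    (hnuw : ¬ G.Adj u w) (h3 : (G.nbrIn S u).card = 3) : 5 ≤ (G.closedNbrIn S {u, w}).card := by
  have hsub : insert w (insert u (G.nbrIn S u)) ⊆ G.closedNbrIn S {u, w} :=
    Finset.insert_subset (mem_closedNbrIn.2 ⟨hw, by simp⟩)
      (insert_nbrIn_subset_closedNbrIn (by simp) hu)
  refine le_trans ?_ (Finset.card_le_card hsub)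
  rw [Finset.card_insert_of_notMem, card_insert_nbrIn, h3]
  simp [mem_nbrIn, hnuw, huw.symm]

/-- A triangle-free cubic graph. -/
theorem IsReduced.lt_of_cubic_triangleFree (hS : G.IsReduced S)
    (h3 : ∀ x ∈ S, (G.nbrIn S x).card = 3)
    (hT : ∀ x ∈ S, ∀ y ∈ S, ∀ z ∈ S, G.Adj x y → G.Adj x z → ¬ G.Adj y z) (hv : v ∈ S) :
    ((G.maxDissocIn S).card : ℚ) < extremalBound S.card := by
  have hs : ∀ x y, G.Adj x y → G.Adj y x := fun _ _ h => h.symm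
  have hl : ∀ x, ¬ G.Adj x x := fun x => G.irrefl
  obtain ⟨a, b, c, hab, hac, hbc, hN⟩ := Finset.card_eq_three.1 (h3 v hv)
  obtain ⟨m0, a0, c0⟩ := nbrIn_eq_triple hN
  obtain ⟨a1, a2, ha1, ha2, ha12, hNa⟩ := exists_eq_triple_of_mem (h3 a m0.1)
    (mem_nbrIn.2 ⟨hv, a0.1.symm⟩)
  obtain ⟨b1, b2, hb1, hb2, hb12, hNb⟩ := exists_eq_triple_of_mem (h3 b m0.2.1)
    (mem_nbrIn.2 ⟨hv, a0.2.1.symm⟩)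
  obtain ⟨c1, c2, hc1, hc2, hc12, hNc⟩ := exists_eq_triple_of_mem (h3 c m0.2.2)
    (mem_nbrIn.2 ⟨hv, a0.2.2.symm⟩)
  obtain ⟨ma, aa, ca⟩ := nbrIn_eq_triple hNa
  obtain ⟨mb, ab, cb⟩ := nbrIn_eq_triple hNb
  obtain ⟨mc, ac, cc⟩ := nbrIn_eq_triple hNc
  have nab := hT v hv a m0.1 b m0.2.1 a0.1 a0.2.1
  have nac := hT v hv a m0.1 c m0.2.2 a0.1 a0.2.2
  have nbc := hT v hv b m0.2.1 c m0.2.2 a0.2.1 a0.2.2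
  -- an edge lies in no triangle, so its closed neighbourhood has six vertices
  have hedge (x y : V) (hx : x ∈ S) (hy : y ∈ S) (hxy : G.Adj x y) :
      6 ≤ (G.closedNbrIn S {x, y}).card := by
    have hdis : Disjoint (G.nbrIn S x) (G.nbrIn S y) := by
      rw [Finset.disjoint_left]
      intro z hz hz'
      rw [mem_nbrIn] at hz hz'
      exact hT x hx y hy z hz.1 hxy hz.2 hz'.2
    have := Finset.card_le_card (Finset.union_subset
      (nbrIn_subset_closedNbrIn (G := G) (S := S) (A := {x, y}) (v := x) (by simp))
      (nbrIn_subset_closedNbrIn (G := G) (S := S) (A := {x, y}) (v := y) (by simp)))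
    rwa [Finset.card_union_of_disjoint hdis, h3 x hx, h3 y hy] at this
  have h0 := hS.bound.isolates_singleton_le hv
  rw [h3 v hv, sub_sub] at h0
  norm_num at h0
  have hcover (i j k : ℕ) (hi : 1 ≤ i) (hj : 1 ≤ j) (hk : 1 ≤ k)
      (hi' : i ≤ (G.closedNbrIn S {a, b}).card) (hj' : j ≤ (G.closedNbrIn S {a, c}).card)
      (hk' : k ≤ (G.closedNbrIn S {b, c}).card) := hS.bound.le_of_cover hv
    [((v, a), 6), ((v, b), 6), ((v, c), 6), ((a, a1), 6), ((a, a2), 6), ((b, b1), 6), ((b, b2), 6),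
      ((c, c1), 6), ((c, c2), 6), ((a, b), i), ((a, c), j), ((b, c), k)]
    (by
      simp [hi, hj, hk, hi', hj', hk', hedge v a hv m0.1 a0.1, hedge v b hv m0.2.1 a0.2.1,
        hedge v c hv m0.2.2 a0.2.2, hedge a a1 m0.1 ma.2.1 aa.2.1, hedge a a2 m0.1 ma.2.2 aa.2.2,
        hedge b b1 m0.2.1 mb.2.1 ab.2.1, hedge b b2 m0.2.1 mb.2.2 ab.2.2,
        hedge c c1 m0.2.2 mc.2.1 ac.2.1, hedge c c2 m0.2.2 mc.2.2 ac.2.2])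
    (by simp [hN, hNa, hNb, hNc]) (by simp [hN])
  obtain ⟨p, hp, ⟨g5, g6, -⟩, hr⟩ := extremalBound_ratios S.card
  have fab := five_le_card_closedNbrIn_pair m0.1 m0.2.1 hab nab (h3 a m0.1)
  have fac := five_le_card_closedNbrIn_pair m0.1 m0.2.2 hac nac (h3 a m0.1)
  have fbc := five_le_card_closedNbrIn_pair m0.2.1 m0.2.2 hbc nbc (h3 b m0.2.1)
  have sab := six_le_card_closedNbrIn_pair m0.1 m0.2.1 hab nab (h3 a m0.1) (h3 b m0.2.1)
  have sac := six_le_card_closedNbrIn_pair m0.1 m0.2.2 hac nac (h3 a m0.1) (h3 c m0.2.2)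
  have sbc := six_le_card_closedNbrIn_pair m0.2.1 m0.2.2 hbc nbc (h3 b m0.2.1) (h3 c m0.2.2)
  by_cases eab : G.nbrIn S a = G.nbrIn S b
  · by_cases eac : G.nbrIn S a = G.nbrIn S c
    · -- the three neighbours of `v` have the same neighbours, so `G[S]` is `K_{3,3}`
      have hcl : ∀ y ∈ G.nbrIn S a, G.nbrIn S y = {a, b, c} := fun y hy => by
        have hyS := nbrIn_subset hy
        refine (Finset.eq_of_subset_of_card_le ?_ ?_).symm
        · have ya := mem_nbrIn.1 hy
          have yb := mem_nbrIn.1 (eab ▸ hy)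
          have yc := mem_nbrIn.1 (eac ▸ hy)
          simp only [Finset.insert_subset_iff, Finset.singleton_subset_iff, mem_nbrIn]
          exact ⟨⟨m0.1, ya.2.symm⟩, ⟨m0.2.1, yb.2.symm⟩, m0.2.2, yc.2.symm⟩
        · rw [h3 y hyS, Finset.card_eq_three.2 ⟨a, b, c, hab, hac, hbc, rfl⟩]
      have hSeq : {a, b, c} ∪ G.nbrIn S a = S := by
        refine hS.connected _ (Finset.union_subset ?_ nbrIn_subset) ⟨a, by simp⟩
          fun y hy x hx hyx => ?_
        · simp [Finset.insert_subset_iff, m0]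
        · rw [Finset.mem_union] at hy ⊢
          obtain hy | hy := hy
          · right
            simp only [Finset.mem_insert, Finset.mem_singleton] at hy
            obtain rfl | rfl | rfl := hy
            · exact mem_nbrIn.2 ⟨hx, hyx⟩
            · exact eab ▸ mem_nbrIn.2 ⟨hx, hyx⟩
            · exact eac ▸ mem_nbrIn.2 ⟨hx, hyx⟩
          · left
            rw [← hcl y hy]
            exact mem_nbrIn.2 ⟨hx, hyx⟩
      have hS6 : S.card ≤ 6 := by
        rw [← hSeq]
        refine (Finset.card_union_le _ _).trans ?_
        rw [h3 a m0.1, Finset.card_eq_three.2 ⟨a, b, c, hab, hac, hbc, rfl⟩]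
      have hS6' : S.card = 6 := by
        have := (hedge v a hv m0.1 a0.1).trans (Finset.card_le_card closedNbrIn_subset)
        omega
      have h1 : (G.countIn S (G.Isolates {v}) : ℚ) ≤ 1 := by
        have := countIn_isolates_le (G := G) S {v}
        rw [card_maxDissocIn_of_card_le_two] at this
        · exact_mod_cast this
        · have := card_sdiff_closedNbrIn (G := G) (S := S) (A := {v})
          rw [closedNbrIn_singleton hv, card_insert_nbrIn, h3 v hv] at this
          rw [closedNbrIn_singleton hv]
          omega
      have hz : extremalBound ((S.card : ℤ) - 6) = 1 := by
        rw [hS6']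
        norm_num [extremalBound, extremalCoeff]
      have h := hcover 5 5 5 (by omega) (by omega) (by omega) fab fac fbc
      norm_num at h
      rcases hr with ⟨-, g⟩ | ⟨-, g⟩ | ⟨-, g⟩ | ⟨-, g⟩ | ⟨-, g⟩ <;>
      · obtain ⟨g0, g1, g2, g3, g4⟩ := g
        linarith
    · have h := hcover 5 6 6 (by omega) (by omega) (by omega) fab (sac eac)
        (sbc fun h => eac (eab.trans h))
      norm_num at h
      rcases hr with ⟨-, g⟩ | ⟨-, g⟩ | ⟨-, g⟩ | ⟨-, g⟩ | ⟨-, g⟩ <;>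
      · obtain ⟨g0, g1, g2, g3, g4⟩ := g
        linarith
  · by_cases eac : G.nbrIn S a = G.nbrIn S c
    · have h := hcover 6 5 6 (by omega) (by omega) (by omega) (sab eab) fac
        (sbc fun h => eab (eac.trans h.symm))
      norm_num at h
      rcases hr with ⟨-, g⟩ | ⟨-, g⟩ | ⟨-, g⟩ | ⟨-, g⟩ | ⟨-, g⟩ <;>
      · obtain ⟨g0, g1, g2, g3, g4⟩ := g
        linarith
    · have h := hcover 6 6 5 (by omega) (by omega) (by omega) (sab eab) (sac eac) fbc
      norm_num at h
      rcases hr with ⟨-, g⟩ | ⟨-, g⟩ | ⟨-, g⟩ | ⟨-, g⟩ | ⟨-, g⟩ <;>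
      · obtain ⟨g0, g1, g2, g3, g4⟩ := g
        linarith

theorem IsReduced.lt_of_cubic (hS : G.IsReduced S) (h5 : 5 ≤ S.card)
    (h3 : ∀ x ∈ S, (G.nbrIn S x).card = 3) :
    ((G.maxDissocIn S).card : ℚ) < extremalBound S.card := by
  by_cases hD : ∀ x ∈ S, ∀ y ∈ S, ∀ z ∈ S, ∀ w ∈ S, G.Adj x y → G.Adj x z → G.Adj y z → G.Adj x w →
      G.Adj y w → z = w
  · by_cases hT : ∀ x ∈ S, ∀ y ∈ S, ∀ z ∈ S, G.Adj x y → G.Adj x z → ¬ G.Adj y z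
    · obtain ⟨v, hv⟩ := hS.nonempty
      exact hS.lt_of_cubic_triangleFree h3 hT hv
    · push Not at hT
      obtain ⟨x, hx, y, hy, z, hz, hxy, hxz, hyz⟩ := hT
      exact hS.lt_of_cubic_triangle h3 hD hx hy hz hxy hxz hyz
  · push Not at hD
    obtain ⟨x, hx, y, hy, z, hz, w, hw, hxy, hxz, hyz, hxw, hyw, hzw⟩ := hD
    have key (u t : V) (hu : u ∈ S) (ht : t ∈ S) (hut : G.Adj u t) (huz : G.Adj u z)
        (huw : G.Adj u w) (htz : G.Adj t z) (htw : G.Adj t w) : G.nbrIn S u = {t, z, w} := by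
      refine (Finset.eq_of_subset_of_card_le ?_ ?_).symm
      · simp [Finset.insert_subset_iff, mem_nbrIn, *]
      · rw [h3 u hu, Finset.card_eq_three.2 ⟨t, z, w, htz.ne, htw.ne, hzw, rfl⟩]
    exact hS.lt_of_diamond h5 h3 hx (key x y hx hy hxy hxz hxw hyz hyw)
      (key y x hy hx hxy.symm hyz hyw hxz hxw) hzw

/-- A vertex of degree `1`. -/
theorem IsReduced.lt_of_degree_eq_one (hS : G.IsReduced S)
    (hΔ : ∀ x ∈ S, (G.nbrIn S x).card ≤ 3) (hv : v ∈ S) (hd : (G.nbrIn S v).card = 1) :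
    ((G.maxDissocIn S).card : ℚ) < extremalBound S.card := by
  obtain ⟨u, hu⟩ := Finset.card_eq_one.1 hd
  have huS := mem_nbrIn.1 (show u ∈ G.nbrIn S v by simp [hu])
  have hvu : v ∈ G.nbrIn S u := mem_nbrIn.2 ⟨hv, huS.2.symm⟩
  have hk := hΔ u huS.1
  have hk1 : 1 ≤ (G.nbrIn S u).card := Finset.card_pos.2 ⟨v, hvu⟩
  obtain ⟨p, hp, ⟨g5, g6, -⟩, hr⟩ := extremalBound_ratios S.card
  have h1 : (G.maxDissocIn S).card ≤ G.countIn S (G.Isolates {v}) +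
      ∑ w ∈ G.nbrIn S u, G.countIn S (G.Isolates {u, w}) := by
    rw [← countIn_true (G := G) (S := S) (fun F => G.Isolates {v} F ∨
      ∃ w ∈ G.nbrIn S u, G.Isolates {u, w} F) fun F hF => ?_]
    · exact (countIn_or _ _).trans (add_le_add le_rfl (countIn_exists_mem _ _))
    · by_cases hvF : v ∈ F
      · obtain h | ⟨y, hy, h⟩ := isolates_of_mem hF hvF
        · exact Or.inl h
        · rw [hu, Finset.mem_singleton] at hy
          subst hy
          exact Or.inr ⟨v, hvu, Finset.pair_comm v y ▸ h⟩
      · obtain ⟨y, hy, w, hw, -, h⟩ | ⟨y, hy, w, hw, hyw, -⟩ := isolates_of_notMem hF hv hvF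
        · rw [hu, Finset.mem_singleton] at hy
          subst hy
          exact Or.inr ⟨w, hw, h⟩
        · rw [hu, Finset.mem_singleton] at hy hw
          exact absurd (hy.trans hw.symm) hyw
  have h2 : ((G.maxDissocIn S).card : ℚ) ≤ G.countIn S (G.Isolates {v}) +
      ∑ w ∈ G.nbrIn S u, (G.countIn S (G.Isolates {u, w}) : ℚ) := by exact_mod_cast h1
  have h3 := hS.bound.isolates_singleton_le hv
  have h4 := Finset.sum_le_card_nsmul (G.nbrIn S u)
    (fun w => (G.countIn S (G.Isolates {u, w}) : ℚ)) _
    fun w _ => hS.bound.isolates_pair_le_nbrIn huS.1 w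
  rw [nsmul_eq_mul] at h4
  rw [hd, sub_sub] at h3
  norm_num at h3
  obtain hk | hk | hk : (G.nbrIn S u).card = 1 ∨ (G.nbrIn S u).card = 2 ∨
    (G.nbrIn S u).card = 3 := by omega
  · obtain ⟨w, hw⟩ := Finset.card_eq_one.1 hk
    have hSeq : {v, u} = S := by
      refine hS.connected _ (by simp [Finset.insert_subset_iff, hv, huS.1]) ⟨v, by simp⟩
        fun a ha x hx hax => ?_
      have hxa : x ∈ G.nbrIn S a := mem_nbrIn.2 ⟨hx, hax⟩
      simp only [Finset.mem_insert, Finset.mem_singleton] at ha ⊢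
      obtain rfl | rfl := ha
      · rw [hu, Finset.mem_singleton] at hxa
        exact Or.inr hxa
      · rw [hw, Finset.mem_singleton] at hxa hvu
        exact Or.inl (hxa.trans hvu.symm)
    have hS2 : S.card = 2 := by rw [← hSeq, Finset.card_pair huS.2.ne]
    rw [card_maxDissocIn_of_card_le_two hS2.le, hS2]
    norm_num [extremalBound, extremalCoeff]
  · rw [hk, sub_sub] at h4
    norm_num at h4
    rcases hr with ⟨-, g⟩ | ⟨-, g⟩ | ⟨-, g⟩ | ⟨-, g⟩ | ⟨-, g⟩ <;>
    · obtain ⟨g0, g1, g2, g3, g4⟩ := g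
      linarith
  · rw [hk, sub_sub] at h4
    norm_num at h4
    rcases hr with ⟨-, g⟩ | ⟨-, g⟩ | ⟨-, g⟩ | ⟨-, g⟩ | ⟨-, g⟩ <;>
    · obtain ⟨g0, g1, g2, g3, g4⟩ := g
      linarith

theorem IsReduced.lt_of_degree_eq_zero (hS : G.IsReduced S) (hv : v ∈ S)
    (hd : (G.nbrIn S v).card = 0) : ((G.maxDissocIn S).card : ℚ) < extremalBound S.card := by
  have hSeq : {v} = S := by
    refine hS.connected _ (by simpa using hv) ⟨v, by simp⟩ fun a ha x hx hax => ?_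
    rw [Finset.mem_singleton] at ha
    subst ha
    have : x ∈ G.nbrIn S a := mem_nbrIn.2 ⟨hx, hax⟩
    rw [Finset.card_eq_zero.1 hd] at this
    simp at this
  have hS1 : S.card = 1 := by rw [← hSeq, Finset.card_singleton]
  rw [card_maxDissocIn_of_card_le_two (by omega), hS1]
  norm_num [extremalBound, extremalCoeff]

theorem isNearlyComplete_of_card_le_four (h4 : S.card ≤ 4)
    (h2 : ∀ x ∈ S, 2 ≤ (G.nbrIn S x).card) : G.IsNearlyComplete S := by
  intro x hx y hy z hz hxy hxz hnxy hnxz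
  by_contra hyz
  have hdis : Disjoint (G.nbrIn S x) {x, y, z} := by
    simp [mem_nbrIn, hnxy, hnxz]
  have := Finset.card_le_card (Finset.union_subset (nbrIn_subset (G := G) (S := S) (v := x))
    (show ({x, y, z} : Finset V) ⊆ S by simp [Finset.insert_subset_iff, hx, hy, hz]))
  rw [Finset.card_union_of_disjoint hdis,
    Finset.card_eq_three.2 ⟨x, y, z, hxy, hxz, hyz, rfl⟩] at this
  have := h2 x hx
  omega

theorem IsReduced.lt_of_degree_le_three (hS : G.IsReduced S)
    (hΔ : ∀ x ∈ S, (G.nbrIn S x).card ≤ 3) :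
    ((G.maxDissocIn S).card : ℚ) < extremalBound S.card := by
  by_cases h2 : ∀ x ∈ S, 2 ≤ (G.nbrIn S x).card
  swap
  · push Not at h2
    obtain ⟨x, hx, hx2⟩ := h2
    obtain h | h : (G.nbrIn S x).card = 0 ∨ (G.nbrIn S x).card = 1 := by omega
    · exact hS.lt_of_degree_eq_zero hx h
    · exact hS.lt_of_degree_eq_one hΔ hx h
  obtain h4 | h5 : S.card ≤ 4 ∨ 5 ≤ S.card := by omega
  · have hN := isNearlyComplete_of_card_le_four h4 h2
    obtain ⟨v, hv⟩ := hS.nonempty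
    have h3 : 3 ≤ S.card := by
      have := Finset.card_le_card (Finset.insert_subset hv (nbrIn_subset (G := G) (v := v)))
      rw [card_insert_nbrIn] at this
      have := h2 v hv
      omega
    obtain h | h : S.card = 3 ∨ S.card = 4 := by omega
    · rw [hN.card_maxDissocIn (by omega), h]
      norm_num [extremalBound, extremalCoeff]
    · exact absurd hN (hS.not_nearlyComplete (by omega) (by omega))
  have h23 (x : V) (hx : x ∈ S) : (G.nbrIn S x).card = 2 ∨ (G.nbrIn S x).card = 3 := by
    have := h2 x hx
    have := hΔ x hx
    omega
  by_cases hT : ∀ x ∈ S, (G.nbrIn S x).card = 2 → ∀ y ∈ G.nbrIn S x, ∀ z ∈ G.nbrIn S x,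
      ¬ G.Adj y z
  · by_cases h3 : ∀ x ∈ S, (G.nbrIn S x).card = 3
    · exact hS.lt_of_cubic h5 h3
    · push Not at h3
      obtain ⟨v, hv, hv3⟩ := h3
      have hd := (h23 v hv).resolve_right hv3
      obtain ⟨a, b, hab, hva⟩ := Finset.card_eq_two.1 hd
      have haN : a ∈ G.nbrIn S v := by simp [hva]
      have hbN : b ∈ G.nbrIn S v := by simp [hva]
      have hnab := hT v hv hd a haN b hbN
      rw [mem_nbrIn] at haN hbN
      have hvb : G.nbrIn S v = {b, a} := by rw [hva, Finset.pair_comm]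
      have hnba : ¬ G.Adj b a := fun h => hnab h.symm
      obtain hda | hda := h23 a haN.1 <;> obtain hdb | hdb := h23 b hbN.1
      · obtain ⟨w, hw, ha⟩ := exists_eq_pair_of_mem hda (mem_nbrIn.2 ⟨hv, haN.2.symm⟩)
        obtain ⟨x, hx, hb⟩ := exists_eq_pair_of_mem hdb (mem_nbrIn.2 ⟨hv, hbN.2.symm⟩)
        exact hS.lt_of_path_two_two h5 h2 hΔ hv hva hab hnab ha hw hb hx
      · obtain ⟨w, hw, ha⟩ := exists_eq_pair_of_mem hda (mem_nbrIn.2 ⟨hv, haN.2.symm⟩)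
        obtain ⟨y, y', hy, hy', hyy, hb⟩ :=
          exists_eq_triple_of_mem hdb (mem_nbrIn.2 ⟨hv, hbN.2.symm⟩)
        exact hS.lt_of_path_two_three h2 hΔ hT hv hva hab hnab ha hw hb hy hy' hyy
      · obtain ⟨w, hw, hb⟩ := exists_eq_pair_of_mem hdb (mem_nbrIn.2 ⟨hv, hbN.2.symm⟩)
        obtain ⟨y, y', hy, hy', hyy, ha⟩ :=
          exists_eq_triple_of_mem hda (mem_nbrIn.2 ⟨hv, haN.2.symm⟩)
        exact hS.lt_of_path_two_three h2 hΔ hT hv hvb hab.symm hnba hb hw ha hy hy' hyy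
      · obtain ⟨x, x', hx, hx', hxx, ha⟩ :=
          exists_eq_triple_of_mem hda (mem_nbrIn.2 ⟨hv, haN.2.symm⟩)
        obtain ⟨y, y', hy, hy', hyy, hb⟩ :=
          exists_eq_triple_of_mem hdb (mem_nbrIn.2 ⟨hv, hbN.2.symm⟩)
        exact hS.lt_of_path_three_three h2 hT hv hva hab hnab ha hx hx' hxx hb hy hy' hyy
  · push Not at hT
    obtain ⟨v, hv, hd, a, ha, b, hb, hab⟩ := hT
    obtain ⟨b', hb', hva⟩ := exists_eq_pair_of_mem hd ha
    obtain rfl : b = b' := by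
      rw [hva, Finset.mem_insert, Finset.mem_singleton] at hb
      exact hb.resolve_left hab.ne'
    have hvb : G.nbrIn S v = {b, a} := by rw [hva, Finset.pair_comm]
    rw [mem_nbrIn] at ha hb
    have hva' : v ∈ G.nbrIn S a := mem_nbrIn.2 ⟨hv, ha.2.symm⟩
    have hvb' : v ∈ G.nbrIn S b := mem_nbrIn.2 ⟨hv, hb.2.symm⟩
    have hba' : b ∈ G.nbrIn S a := mem_nbrIn.2 ⟨hb.1, hab⟩
    have hab' : a ∈ G.nbrIn S b := mem_nbrIn.2 ⟨ha.1, hab.symm⟩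
    have htwo (x y : V) (hx : (G.nbrIn S x).card = 2) (hvx : v ∈ G.nbrIn S x)
        (hyx : y ∈ G.nbrIn S x) (hyv : v ≠ y) : G.nbrIn S x = {v, y} := by
      obtain ⟨c, hc, h⟩ := exists_eq_pair_of_mem hx hvx
      rw [h, Finset.mem_insert, Finset.mem_singleton] at hyx
      rw [h, hyx.resolve_left hyv.symm]
    obtain hda | hda := h23 a ha.1 <;> obtain hdb | hdb := h23 b hb.1
    · have e1 := htwo a b hda hva' hba' hb.2.ne
      have e2 := htwo b a hdb hvb' hab' ha.2.ne
      have hSeq : {v, a, b} = S := by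
        refine hS.connected _ (by simp [Finset.insert_subset_iff, hv, ha.1, hb.1]) ⟨v, by simp⟩
          fun y hy x hx hyx => ?_
        have hxy : x ∈ G.nbrIn S y := mem_nbrIn.2 ⟨hx, hyx⟩
        simp only [Finset.mem_insert, Finset.mem_singleton] at hy ⊢
        obtain rfl | rfl | rfl := hy
        · rw [hva, Finset.mem_insert, Finset.mem_singleton] at hxy
          tauto
        · rw [e1, Finset.mem_insert, Finset.mem_singleton] at hxy
          tauto
        · rw [e2, Finset.mem_insert, Finset.mem_singleton] at hxy
          tauto
      have := Finset.card_le_three (a := v) (b := a) (c := b)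
      rw [hSeq] at this
      omega
    · obtain ⟨w, hwv, hwa, hw⟩ := exists_eq_triple_of_mem_of_mem hdb hvb' hab' ha.2.ne
      exact hS.lt_of_triangle_two_three h2 hv hva (htwo a b hda hva' hba' hb.2.ne) hw hwv hwa
    · obtain ⟨w, hwv, hwb, hw⟩ := exists_eq_triple_of_mem_of_mem hda hva' hba' hb.2.ne
      exact hS.lt_of_triangle_two_three h2 hv hvb (htwo b a hdb hvb' hab' ha.2.ne) hw hwv hwb
    · obtain ⟨w, hwv, hwb, hw⟩ := exists_eq_triple_of_mem_of_mem hda hva' hba' hb.2.ne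
      obtain ⟨x, hxv, hxa, hx⟩ := exists_eq_triple_of_mem_of_mem hdb hvb' hab' ha.2.ne
      exact hS.lt_of_triangle_three_three h5 h2 hv hva hw hx hwv hwb hxv hxa

/-- In the situation of the induction step the bound is strict. -/
theorem IsReduced.card_lt (hS : G.IsReduced S) :
    ((G.maxDissocIn S).card : ℚ) < extremalBound S.card := by
  by_cases h6 : ∃ v ∈ S, 6 ≤ (G.nbrIn S v).card
  · obtain ⟨v, hv, h⟩ := h6
    exact hS.lt_of_six_le_degree hv h
  by_cases h5 : ∃ v ∈ S, (G.nbrIn S v).card = 5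
  · obtain ⟨v, hv, h⟩ := h5
    exact hS.lt_of_degree_eq_five hv h
  push Not at h6 h5
  have h4' : ∀ x ∈ S, (G.nbrIn S x).card ≤ 4 := fun x hx => by
    have := h6 x hx
    have := h5 x hx
    omega
  by_cases h4 : ∃ v ∈ S, (G.nbrIn S v).card = 4
  · obtain ⟨v, hv, h⟩ := h4
    exact hS.lt_of_degree_eq_four h4' hv h
  push Not at h4
  refine hS.lt_of_degree_le_three fun x hx => ?_
  have := h4' x hx
  have := h4 x hx
  omega

/-! ### Disjoint unions of nearly complete graphs -/

variable (G) in
/-- `G[S]` is a disjoint union of nearly complete graphs whose orders form the given list. -/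
inductive IsNearlyCompleteUnion : List ℕ → Finset V → Prop
  | nil : IsNearlyCompleteUnion [] ∅
  | cons {l : List ℕ} {B T : Finset V} (hB : G.IsNearlyComplete B) (hd : Disjoint B T)
      (h : ∀ b ∈ B, ∀ x ∈ T, ¬ G.Adj b x) (hT : IsNearlyCompleteUnion l T) :
      IsNearlyCompleteUnion (B.card :: l) (B ∪ T)

namespace IsNearlyCompleteUnion

variable {l l' : List ℕ}

theorem card_eq (h : G.IsNearlyCompleteUnion l S) : S.card = l.sum := by
  induction h with
  | nil => simp
  | cons hB hd h hT ih => rw [Finset.card_union_of_disjoint hd, ih, List.sum_cons]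

theorem card_maxDissocIn (h : G.IsNearlyCompleteUnion l S) (hl : ∀ m ∈ l, 2 ≤ m) :
    (G.maxDissocIn S).card = (l.map fun m => m.choose 2).prod := by
  induction h with
  | nil => simpa using card_maxDissocIn_of_card_le_two (G := G) (S := ∅) (by simp)
  | cons hB hd h hT ih =>
    rw [card_maxDissocIn_union hd h, hB.card_maxDissocIn (hl _ (by simp)),
      ih fun m hm => hl m (by simp [hm]), List.map_cons, List.prod_cons]

theorem append (hS : G.IsNearlyCompleteUnion l S) (hT : G.IsNearlyCompleteUnion l' T)
    (hd : Disjoint S T) (h : ∀ a ∈ S, ∀ b ∈ T, ¬ G.Adj a b) :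
    G.IsNearlyCompleteUnion (l ++ l') (S ∪ T) := by
  induction hS with
  | nil => simpa using hT
  | cons hB hd' h' _ ih =>
    rw [Finset.disjoint_union_left] at hd
    rw [List.cons_append, Finset.union_assoc]
    refine cons hB (Finset.disjoint_union_right.2 ⟨hd', hd.1⟩) (fun b hb x hx => ?_)
      (ih hd.2 fun a ha => h a (Finset.mem_union_right _ ha))
    obtain hx | hx := Finset.mem_union.1 hx
    · exact h' b hb x hx
    · exact h b (Finset.mem_union_left _ hb) x hx

theorem perm (hS : G.IsNearlyCompleteUnion l S) (h : l.Perm l') :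
    G.IsNearlyCompleteUnion l' S := by
  induction h generalizing S with
  | nil => exact hS
  | cons m _ ih =>
    cases hS with
    | cons hB hd h hT => exact cons hB hd h (ih hT)
  | swap m k l =>
    cases hS with
    | @cons _ B _ hB hd h hT =>
      cases hT with
      | @cons _ C T hC hd' h' hT =>
        rw [Finset.union_left_comm]
        rw [Finset.disjoint_union_right] at hd
        refine cons hC (Finset.disjoint_union_right.2 ⟨hd.1.symm, hd'⟩) (fun c hc x hx => ?_)
          (cons hB hd.2 (fun b hb x hx => h b hb x (Finset.mem_union_right _ hx)) hT)
        obtain hx | hx := Finset.mem_union.1 hx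
        · exact fun hcx => h x hx c (Finset.mem_union_left _ hc) hcx.symm
        · exact h' c hc x hx
  | trans _ _ ih ih' => exact ih' (ih hS)

theorem exists_block (hS : G.IsNearlyCompleteUnion l S) (hx : x ∈ S) :
    ∃ B ⊆ S, x ∈ B ∧ G.IsNearlyComplete B ∧ B.card ∈ l := by
  induction hS with
  | nil => simp at hx
  | @cons l B T hB hd h hT ih =>
    obtain hx | hx := Finset.mem_union.1 hx
    · exact ⟨B, Finset.subset_union_left, hx, hB, by simp⟩
    · obtain ⟨C, hC, hxC, hC', hm⟩ := ih hx
      exact ⟨C, hC.trans Finset.subset_union_right, hxC, hC', by simp [hm]⟩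

/-- The same notion in terms of a family of blocks. -/
theorem of_family (l : List ℕ) (b : Fin l.length → Finset V)
    (hb : ∀ i, G.IsNearlyComplete (b i)) (hc : ∀ i, (b i).card = l.get i)
    (hd : ∀ i j, i ≠ j → Disjoint (b i) (b j))
    (h : ∀ i j, i ≠ j → ∀ x ∈ b i, ∀ y ∈ b j, ¬ G.Adj x y) :
    G.IsNearlyCompleteUnion l (Finset.univ.biUnion b) := by
  induction l with
  | nil =>
    convert nil (G := G)
    ext x
    simp only [Finset.mem_biUnion, Finset.notMem_empty, iff_false]
    rintro ⟨i, -⟩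
    exact i.elim0
  | cons m l ih =>
    have h1 := ih (fun i => b i.succ) (fun i => hb _) (fun i => hc i.succ)
      (fun i j hij => hd _ _ (by simpa using hij)) (fun i j hij => h _ _ (by simpa using hij))
    have h0 : (b 0).card = m := hc 0
    have hU : Finset.univ.biUnion b =
        b 0 ∪ Finset.univ.biUnion (fun i : Fin l.length => b i.succ) := by
      ext x
      simp only [Finset.mem_biUnion, Finset.mem_union, Finset.mem_univ, true_and]
      exact Fin.exists_fin_succ (P := fun i => x ∈ b i)
    rw [hU, ← h0]
    refine cons (hb 0) ?_ ?_ h1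
    · rw [Finset.disjoint_biUnion_right]
      exact fun i _ => hd _ _ (Fin.succ_ne_zero i).symm
    · intro x hx y hy
      obtain ⟨i, -, hy⟩ := Finset.mem_biUnion.1 hy
      exact h _ _ (Fin.succ_ne_zero i).symm x hx y hy

theorem exists_family (hS : G.IsNearlyCompleteUnion l S) :
    ∃ b : Fin l.length → Finset V, (∀ i, G.IsNearlyComplete (b i)) ∧
      (∀ i, (b i).card = l.get i) ∧ (∀ i j, i ≠ j → Disjoint (b i) (b j)) ∧
      (∀ i j, i ≠ j → ∀ x ∈ b i, ∀ y ∈ b j, ¬ G.Adj x y) ∧ ∀ x, x ∈ S ↔ ∃ i, x ∈ b i := by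
  induction hS with
  | nil => exact ⟨fun i => i.elim0, fun i => i.elim0, fun i => i.elim0, fun i => i.elim0,
      fun i => i.elim0, fun x => by simp⟩
  | @cons l B T hB hd h hT ih =>
    obtain ⟨b, hb, hc, hd', h', hU⟩ := ih
    have hbT (i) : b i ⊆ T := fun x hx => (hU x).2 ⟨i, hx⟩
    refine ⟨Fin.cons B b, fun i => ?_, fun i => ?_, fun i j => ?_, fun i j => ?_, fun x => ?_⟩
    · cases i using Fin.cases with
      | zero => exact hB
      | succ i => exact hb i
    · cases i using Fin.cases with
      | zero => rfl
      | succ i => exact hc i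
    · cases i using Fin.cases with
      | zero =>
        cases j using Fin.cases with
        | zero => exact fun h => absurd rfl h
        | succ j => exact fun _ => hd.mono_right (hbT j)
      | succ i =>
        cases j using Fin.cases with
        | zero => exact fun _ => (hd.mono_right (hbT i)).symm
        | succ j => exact fun hij => hd' i j (by simpa using hij)
    · cases i using Fin.cases with
      | zero =>
        cases j using Fin.cases with
        | zero => exact fun h => absurd rfl h
        | succ j => exact fun _ x hx y hy => h x hx y (hbT j hy)
      | succ i =>
        cases j using Fin.cases with
        | zero => exact fun _ x hx y hy hxy => h y hy x (hbT i hx) hxy.symm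
        | succ j => exact fun hij => h' i j (by simpa using hij)
    · rw [Finset.mem_union, hU]
      exact (Fin.exists_fin_succ (P := fun i => x ∈ (Fin.cons B b : Fin _ → Finset V) i)).symm

end IsNearlyCompleteUnion

/-! ### Extremal lists of orders -/

theorem extremalBound_five_mul_add (c : ℕ) (z : ℤ) :
    extremalBound (5 * c + z) = 10 ^ c * extremalBound z := by
  induction c with
  | zero => simp
  | succ c ih =>
    have h := extremalBound_sub_five (5 * (c + 1 : ℕ) + z)
    rw [show 5 * ((c + 1 : ℕ) : ℤ) + z - 5 = 5 * c + z by push_cast; ring, ih] at h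
    rw [pow_succ]
    linarith

theorem extremalBound_zero : extremalBound 0 = 1 := by norm_num [extremalBound, extremalCoeff]

theorem extremalBound_eight : extremalBound 8 = 36 := by norm_num [extremalBound, extremalCoeff]

theorem extremalBound_twelve : extremalBound 12 = 225 := by norm_num [extremalBound, extremalCoeff]

theorem extremalBound_six : extremalBound 6 = 15 := by norm_num [extremalBound, extremalCoeff]

theorem pow_mul_pow_le_extremalBound (a b : ℕ) :
    (6 : ℚ) ^ a * 15 ^ b ≤ extremalBound (4 * a + 6 * b) := by
  induction a with
  | zero =>
    induction b with
    | zero => norm_num [extremalBound, extremalCoeff]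
    | succ b ih =>
      have h := extremalBound_mul_le (4 * (0 : ℕ) + 6 * b) 6
      rw [extremalBound_six] at h
      rw [show 4 * ((0 : ℕ) : ℤ) + 6 * ((b + 1 : ℕ) : ℤ) = 4 * (0 : ℕ) + 6 * b + 6 by
        push_cast; ring, pow_succ]
      linarith
  | succ a ih =>
    have h := extremalBound_mul_le (4 * a + 6 * b) 4
    rw [extremalBound_four] at h
    rw [show 4 * ((a + 1 : ℕ) : ℤ) + 6 * b = 4 * a + 6 * b + 4 by push_cast; ring, pow_succ]
    linarith

/-- An extremal list of orders does not contain both `4` and `6`, since `6 * 15 < 10 ^ 2` at order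
`10`, and contains each at most twice, since `6 ^ 3 < 15 ^ 2` at order `12` and
`15 ^ 3 < 6 ^ 2 * 10 ^ 2` at order `18`. -/
theorem eq_of_pow_mul_pow_eq_extremalBound {a b : ℕ}
    (h : (6 : ℚ) ^ a * 15 ^ b = extremalBound (4 * a + 6 * b)) :
    a = 0 ∧ b = 0 ∨ a = 0 ∧ b = 1 ∨ a = 0 ∧ b = 2 ∨ a = 2 ∧ b = 0 ∨ a = 1 ∧ b = 0 := by
  have key (i j a' b' : ℕ) (ha : a = a' + i) (hb : b = b' + j)
      (hij : (6 : ℚ) ^ i * 15 ^ j < extremalBound (4 * i + 6 * j)) : False := by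
    subst ha hb
    have h1 := pow_mul_pow_le_extremalBound a' b'
    have h2 := extremalBound_mul_le (4 * a' + 6 * b') (4 * i + 6 * j)
    rw [show (4 * a' + 6 * b' + (4 * i + 6 * j) : ℤ) =
      4 * ((a' + i : ℕ) : ℤ) + 6 * ((b' + j : ℕ) : ℤ) by push_cast; ring, ← h] at h2
    have h3 : (6 : ℚ) ^ (a' + i) * 15 ^ (b' + j) = 6 ^ a' * 15 ^ b' * (6 ^ i * 15 ^ j) := by
      ring
    have h4 : (0 : ℚ) < 6 ^ a' * 15 ^ b' := by positivity
    have h5 : (0 : ℚ) < 6 ^ i * 15 ^ j := by positivity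
    have h6 := mul_lt_mul' h1 hij h5.le (h4.trans_le h1)
    linarith
  by_contra hcon
  obtain h' | h' | h' : 3 ≤ a ∨ 3 ≤ b ∨ 1 ≤ a ∧ 1 ≤ b := by omega
  · exact key 3 0 (a - 3) b (by omega) rfl (by norm_num [extremalBound, extremalCoeff])
  · exact key 0 3 a (b - 3) rfl (by omega) (by norm_num [extremalBound, extremalCoeff])
  · exact key 1 1 (a - 1) (b - 1) (by omega) (by omega)
      (by norm_num [extremalBound, extremalCoeff])

theorem exists_perm_replicate {l : List ℕ} (hl : ∀ m ∈ l, m = 4 ∨ m = 5 ∨ m = 6) :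
    ∃ a b c, l.Perm (List.replicate a 4 ++ (List.replicate b 6 ++ List.replicate c 5)) := by
  induction l with
  | nil => exact ⟨0, 0, 0, by simp⟩
  | cons m l ih =>
    obtain ⟨a, b, c, h⟩ := ih fun m hm => hl m (by simp [hm])
    obtain rfl | rfl | rfl := hl m (by simp)
    · exact ⟨a + 1, b, c, by simpa [List.replicate_succ] using h⟩
    · refine ⟨a, b, c + 1, (h.cons 5).trans ?_⟩
      rw [List.replicate_succ, ← List.append_assoc, ← List.append_assoc]
      exact List.perm_middle.symm
    · refine ⟨a, b + 1, c, (h.cons 6).trans ?_⟩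
      rw [List.replicate_succ, List.cons_append]
      exact List.perm_middle.symm

/-- The lists of orders at which the product of the counts attains the bound. -/
theorem perm_of_prod_eq_extremalBound {l : List ℕ} (hl : ∀ m ∈ l, m = 4 ∨ m = 5 ∨ m = 6)
    (h : (((l.map fun m => m.choose 2).prod : ℕ) : ℚ) = extremalBound l.sum) :
    ∃ c, l.Perm (List.replicate c 5) ∨ l.Perm (6 :: List.replicate c 5) ∨
      l.Perm (6 :: 6 :: List.replicate c 5) ∨ l.Perm (4 :: 4 :: List.replicate c 5) ∨
      l.Perm (4 :: List.replicate c 5) := by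
  obtain ⟨a, b, c, hp⟩ := exists_perm_replicate hl
  rw [(hp.map _).prod_eq, hp.sum_eq] at h
  have h1 : extremalBound (5 * c + (4 * a + 6 * b)) = 10 ^ c * (6 ^ a * 15 ^ b) := by
    rw [show (5 * c + (4 * a + 6 * b) : ℤ) = ((List.replicate a 4 ++
      (List.replicate b 6 ++ List.replicate c 5)).sum : ℕ) by simp; ring, ← h]
    simp only [List.map_append, List.map_replicate, List.prod_append, List.prod_replicate,
      show Nat.choose 4 2 = 6 from rfl, show Nat.choose 5 2 = 10 from rfl,
      show Nat.choose 6 2 = 15 from rfl]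
    push_cast
    ring
  rw [extremalBound_five_mul_add] at h1
  refine ⟨c, ?_⟩
  obtain ⟨rfl, rfl⟩ | ⟨rfl, rfl⟩ | ⟨rfl, rfl⟩ | ⟨rfl, rfl⟩ | ⟨rfl, rfl⟩ :=
    eq_of_pow_mul_pow_eq_extremalBound (mul_left_cancel₀ (by positivity) h1).symm
  all_goals simp only [List.replicate_zero, List.nil_append, List.replicate_succ,
    List.cons_append] at hp
  · exact Or.inl hp
  · exact Or.inr (Or.inl hp)
  · exact Or.inr (Or.inr (Or.inl hp))
  · exact Or.inr (Or.inr (Or.inr (Or.inl hp)))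
  · exact Or.inr (Or.inr (Or.inr (Or.inr hp)))

/-! ### The extremal bound and the case of equality -/

theorem choose_two_eq_extremalBound {m : ℕ} (hm : m = 4 ∨ m = 5 ∨ m = 6) :
    (m.choose 2 : ℚ) = extremalBound m := by
  obtain rfl | rfl | rfl := hm
  · exact extremalBound_four.symm
  · norm_num [extremalBound, extremalCoeff, Nat.choose_two_right]
  · exact extremalBound_six.symm

/-- The extremal bound together with the structure of the sets attaining it. Both parts are proved
in one induction, as strictness for reduced sets uses the equality case on smaller sets. -/
theorem card_maxDissocIn_le_and (G : SimpleGraph V) (S : Finset V) :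
    ((G.maxDissocIn S).card : ℚ) ≤ extremalBound S.card ∧
      (((G.maxDissocIn S).card : ℚ) = extremalBound S.card →
        ∃ l : List ℕ, (∀ m ∈ l, m = 4 ∨ m = 5 ∨ m = 6) ∧ G.IsNearlyCompleteUnion l S) := by
  induction S using Finset.strongInduction with
  | H S ih =>
  obtain rfl | hne := S.eq_empty_or_nonempty
  · refine ⟨?_, fun _ => ⟨[], by simp, .nil⟩⟩
    rw [card_maxDissocIn_of_card_le_two (by simp)]
    norm_num [extremalBound, extremalCoeff]
  by_cases hcl : ∀ A ⊆ S, A.Nonempty → (∀ a ∈ A, ∀ x ∈ S, G.Adj a x → x ∈ A) → A = S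
  swap
  · -- the counts and the bounds multiply over the two parts of a disconnected set
    push Not at hcl
    obtain ⟨A, hAS, hA, hcl, hneS⟩ := hcl
    have hd : Disjoint A (S \ A) := Finset.disjoint_sdiff
    have he : ∀ a ∈ A, ∀ b ∈ S \ A, ¬ G.Adj a b := fun a ha b hb hab =>
      (Finset.mem_sdiff.1 hb).2 (hcl a ha b (Finset.mem_sdiff.1 hb).1 hab)
    have hU : A ∪ S \ A = S := Finset.union_sdiff_of_subset hAS
    have hφ := card_maxDissocIn_union hd he
    have hc := Finset.card_union_of_disjoint hd
    rw [hU] at hφ hc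
    obtain ⟨h1, h1'⟩ := ih A (Finset.ssubset_iff_subset_ne.2 ⟨hAS, hneS⟩)
    obtain ⟨h2, h2'⟩ := ih (S \ A) (Finset.sdiff_ssubset hAS hA)
    have h3 := extremalBound_mul_le A.card (S \ A).card
    rw [hφ, hc]
    push_cast
    have p1 := extremalBound_pos A.card
    have p2 := extremalBound_pos (S \ A).card
    have p3 : (0 : ℚ) ≤ (G.maxDissocIn A).card := by positivity
    have p4 : (0 : ℚ) ≤ (G.maxDissocIn (S \ A)).card := by positivity
    refine ⟨(mul_le_mul h1 h2 p4 p1.le).trans h3, fun h => ?_⟩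
    have e1 : ((G.maxDissocIn A).card : ℚ) = extremalBound A.card := by
      by_contra hne
      have := mul_lt_mul_of_pos_right (lt_of_le_of_ne h1 hne) p2
      have := mul_le_mul_of_nonneg_left h2 p3
      linarith
    have e2 : ((G.maxDissocIn (S \ A)).card : ℚ) = extremalBound (S \ A).card := by
      by_contra hne
      have := mul_lt_mul_of_pos_left (lt_of_le_of_ne h2 hne) p1
      have := mul_le_mul_of_nonneg_right h1 p4
      linarith
    obtain ⟨l, hl, hAl⟩ := h1' e1
    obtain ⟨l', hl', hAl'⟩ := h2' e2
    refine ⟨l ++ l', fun m hm => (List.mem_append.1 hm).elim (hl m) (hl' m), ?_⟩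
    have := hAl.append hAl' hd he
    rwa [hU] at this
  by_cases hnc : 4 ≤ S.card ∧ S.card ≤ 6 ∧ G.IsNearlyComplete S
  · obtain ⟨h4, h6, hnc⟩ := hnc
    have hm : S.card = 4 ∨ S.card = 5 ∨ S.card = 6 := by omega
    rw [hnc.card_maxDissocIn (by omega), choose_two_eq_extremalBound hm]
    refine ⟨le_rfl, fun _ => ⟨[S.card], by simpa using hm, ?_⟩⟩
    simpa using IsNearlyCompleteUnion.cons hnc (Finset.disjoint_empty_right S) (by simp) .nil
  · have hS : G.IsReduced S :=
      { bound := fun T hT => (ih T hT).1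
        block := fun T hT hTe x hx => by
          obtain ⟨l, hl, hTl⟩ := (ih T hT).2 hTe
          obtain ⟨B, hBT, hxB, hB, hBl⟩ := hTl.exists_block hx
          have hB' := hl _ hBl
          refine ⟨B, hBT, hxB, hB, by omega, fun hmod => ?_⟩
          rw [hTl.card_maxDissocIn fun m hm => by have := hl m hm; omega, hTl.card_eq] at hTe
          obtain ⟨c, hp⟩ := perm_of_prod_eq_extremalBound hl hTe
          have hmem {l' : List ℕ} (hp : l.Perm l') : T.card = l'.sum ∧ B.card ∈ l' :=
            ⟨hTl.card_eq.trans hp.sum_eq, hp.mem_iff.1 hBl⟩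
          rcases hp with hp | hp | hp | hp | hp <;> have := hmem hp <;>
            simp [List.mem_replicate] at this <;> omega
        connected := hcl
        not_nearlyComplete := fun h4 h6 h => hnc ⟨h4, h6, h⟩
        nonempty := hne }
    exact ⟨hS.card_lt.le, fun h => absurd h hS.card_lt.ne⟩

end

/-! ### Back to graphs -/

theorem maximal_isDissociationSet_iff {V : Type*} [DecidableEq V] {G : SimpleGraph V} {F : Set V} :
    Maximal G.IsDissociationSet F ↔
      G.IsDissociationSet F ∧ ∀ x, x ∉ F → ¬ G.IsDissociationSet (insert x F) := by
  refine and_congr_right fun _ => ⟨fun h x hx hd => ?_, fun h F' hF' hFF' => ?_⟩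
  · exact hx (h hd (Set.subset_insert x F) (Set.mem_insert x F))
  · intro x hx
    by_contra hxF
    exact h x hxF (hF'.mono (Set.insert_subset hx hFF'))

theorem numMaximalDissociationSets_eq {V : Type*} [DecidableEq V] [Fintype V]
    (G : SimpleGraph V) :
    G.numMaximalDissociationSets = (G.maxDissocIn Finset.univ).card := by
  rw [numMaximalDissociationSets, ← Set.ncard_coe_finset,
    ← Set.ncard_image_of_injective _ (Finset.coe_injective (α := V))]
  congr 1
  ext F
  simp only [maximalDissociationSets, Set.mem_ofPred_eq, Set.mem_image, Finset.mem_coe,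
    maximal_isDissociationSet_iff, mem_maxDissocIn]
  constructor
  · rintro ⟨h1, h2⟩
    lift F to Finset V using F.toFinite
    exact ⟨F, ⟨Finset.subset_univ _, h1, fun x _ hx => by simpa using h2 x hx⟩, rfl⟩
  · rintro ⟨F, ⟨-, h1, h2⟩, rfl⟩
    exact ⟨h1, fun x hx => by simpa using h2 x (Finset.mem_univ x) hx⟩

/-- A graph is complete up to a deleted matching iff no vertex has two non-neighbours. -/
theorem isCompleteMinusMatching_iff {m : ℕ} {H : SimpleGraph (Fin m)} :
    H.IsCompleteMinusMatching ↔ H.IsNearlyComplete Finset.univ := by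
  constructor
  · rintro ⟨D, -, -, hD, rfl⟩ x - y - z - hxy hxz hny hnz
    have key (w : Fin m) (hxw : x ≠ w) (hn : ¬ ((⊤ : SimpleGraph (Fin m)).deleteEdges
        (D : Set (Sym2 (Fin m)))).Adj x w) : s(x, w) ∈ D := by
      simpa [deleteEdges_adj, hxw] using hn
    have hy := key y hxy hny
    have hz := key z hxz hnz
    by_contra hyz
    refine hD _ hy _ hz (fun h => hyz ?_) x ⟨by simp, by simp⟩
    exact (Sym2.congr_right).1 h
  · intro h
    classical
    let D : Finset (Sym2 (Fin m)) := Finset.univ.filter fun e => e ∈ Hᶜ.edgeSet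
    have hD {e} : e ∈ D ↔ e ∈ Hᶜ.edgeSet := by simp [D]
    have hmatch : ∀ e ∈ D, ∀ f ∈ D, e ≠ f → ∀ v, ¬ (v ∈ e ∧ v ∈ f) := by
      rintro e he f hf hef v ⟨hve, hvf⟩
      obtain ⟨y, rfl⟩ := hve
      obtain ⟨z, rfl⟩ := hvf
      rw [hD, mem_edgeSet, compl_adj] at he hf
      exact hef (by rw [h v (Finset.mem_univ _) y (Finset.mem_univ _) z (Finset.mem_univ _)
        he.1 hf.1 he.2 hf.2])
    refine ⟨D, fun e he => ?_, ?_, hmatch, ?_⟩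
    · exact edgeSet_mono le_top (hD.1 he)
    · -- the pairs in `D` are disjoint
      have hdisj : (D : Set (Sym2 (Fin m))).PairwiseDisjoint Sym2.toFinset := by
        intro e he f hf hef
        refine Finset.disjoint_left.2 fun v hve hvf => hmatch e he f hf hef v ?_
        exact ⟨Sym2.mem_toFinset.1 hve, Sym2.mem_toFinset.1 hvf⟩
      have hcard := Finset.card_biUnion hdisj
      rw [Finset.sum_congr rfl fun e he => Sym2.card_toFinset_of_not_isDiag e
        (not_isDiag_of_mem_edgeSet _ (hD.1 he)), Finset.sum_const, smul_eq_mul] at hcard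
      have := Finset.card_le_univ (D.biUnion Sym2.toFinset)
      rw [Fintype.card_fin] at this
      omega
    · ext x y
      rw [deleteEdges_adj, top_adj, Finset.mem_coe, hD, mem_edgeSet, compl_adj]
      constructor
      · exact fun hxy => ⟨hxy.ne, fun h => h.2 hxy⟩
      · exact fun ⟨hne, hn⟩ => by_contra fun hxy => hn ⟨hne, hxy⟩

theorem isUnionOfCompleteMinusMatching_iff {V : Type*} [DecidableEq V] [Fintype V]
    {G : SimpleGraph V} {l : List ℕ} :
    G.IsUnionOfCompleteMinusMatching l ↔ G.IsNearlyCompleteUnion l Finset.univ := by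
  constructor
  · rintro ⟨H, hH, ⟨e⟩⟩
    have hadj (p q) : G.Adj (e.symm p) (e.symm q) ↔ (disjointUnion H).Adj p q :=
      e.symm.map_adj_iff
    have hinj (i) : Function.Injective fun a => e.symm ⟨i, a⟩ := fun a b hab => by
      simpa using hab
    have h := IsNearlyCompleteUnion.of_family (G := G) l
      (fun i => Finset.univ.image fun a => e.symm ⟨i, a⟩) ?_ ?_ ?_ ?_
    · convert h
      ext x
      simp only [Finset.mem_univ, Finset.mem_biUnion, Finset.mem_image, true_and, true_iff]
      exact ⟨(e x).1, (e x).2, e.symm_apply_apply x⟩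
    · intro i x hx y hy z hz
      simp only [Finset.mem_image, Finset.mem_univ, true_and] at hx hy hz
      obtain ⟨a, rfl⟩ := hx
      obtain ⟨b, rfl⟩ := hy
      obtain ⟨c, rfl⟩ := hz
      have hiff (a b) : G.Adj (e.symm ⟨i, a⟩) (e.symm ⟨i, b⟩) ↔ (H i).Adj a b := by
        rw [hadj]
        constructor
        · rintro ⟨j, a', b', h, h1, h2⟩
          cases h1
          cases h2
          exact h
        · exact fun h => ⟨i, a, b, h, rfl, rfl⟩
      rw [hiff, hiff, (hinj i).ne_iff, (hinj i).ne_iff, (hinj i).eq_iff]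
      exact isCompleteMinusMatching_iff.1 (hH i) a (Finset.mem_univ _) b (Finset.mem_univ _) c
        (Finset.mem_univ _)
    · intro i
      rw [Finset.card_image_of_injective _ (hinj i), Finset.card_univ, Fintype.card_fin]
    · intro i j hij
      refine Finset.disjoint_left.2 fun x hx hx' => hij ?_
      simp only [Finset.mem_image, Finset.mem_univ, true_and] at hx hx'
      obtain ⟨a, rfl⟩ := hx
      obtain ⟨b, hb⟩ := hx'
      exact (congrArg Sigma.fst (e.symm.injective hb)).symm
    · intro i j hij x hx y hy hxy
      simp only [Finset.mem_image, Finset.mem_univ, true_and] at hx hy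
      obtain ⟨a, rfl⟩ := hx
      obtain ⟨b, rfl⟩ := hy
      obtain ⟨k, a', b', -, h1, h2⟩ := (hadj _ _).1 hxy
      exact hij ((congrArg Sigma.fst h1).trans (congrArg Sigma.fst h2).symm)
  · intro h
    obtain ⟨b, hb, hc, hd, hn, hU⟩ := h.exists_family
    let f : ∀ i, Fin (l.get i) ≃ b i := fun i => ((b i).equivFinOfCardEq (hc i)).symm
    have hidx (x) : ∃ i, x ∈ b i := (hU x).1 (Finset.mem_univ x)
    have huniq {i j : Fin l.length} {x : V} (hi : x ∈ b i) (hj : x ∈ b j) : i = j := by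
      by_contra hij
      exact Finset.disjoint_left.1 (hd i j hij) hi hj
    let g : (Σ i, Fin (l.get i)) → V := fun p => f p.1 p.2
    have hg : Function.Bijective g := by
      constructor
      · rintro ⟨i, a⟩ ⟨j, c⟩ hac
        have hac' : ((f i a : V)) = f j c := hac
        obtain rfl : i = j := huniq (f i a).2 (hac' ▸ (f j c).2)
        rw [(f i).injective (Subtype.ext hac')]
      · intro x
        obtain ⟨i, hi⟩ := hidx x
        exact ⟨⟨i, (f i).symm ⟨x, hi⟩⟩, by simp [g]⟩
    refine ⟨fun i => G.comap fun a => (f i a : V), fun i => ?_, ⟨RelIso.symm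
      ⟨Equiv.ofBijective g hg, ?_⟩⟩⟩
    · rw [isCompleteMinusMatching_iff]
      intro x _ y _ z _ hxy hxz hy hz
      have hne {a c : Fin (l.get i)} (h : a ≠ c) : (f i a : V) ≠ f i c := fun h' =>
        h ((f i).injective (Subtype.ext h'))
      exact (f i).injective (Subtype.ext (hb i _ (f i x).2 _ (f i y).2 _ (f i z).2 (hne hxy)
        (hne hxz) hy hz))
    · rintro ⟨i, a⟩ ⟨j, c⟩
      simp only [Equiv.ofBijective_apply, g]
      constructor
      · intro h
        obtain rfl : i = j := by
          by_contra hij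
          exact hn i j hij _ (f i a).2 _ (f j c).2 h
        exact ⟨i, a, c, h, rfl, rfl⟩
      · rintro ⟨k, a', c', h, h1, h2⟩
        cases h1
        cases h2
        exact h

theorem exists_isUnionOfCompleteMinusMatching {V : Type*} [Fintype V] {l : List ℕ}
    (h : l.sum = Fintype.card V) : ∃ G : SimpleGraph V, G.IsUnionOfCompleteMinusMatching l := by
  have hcard : Fintype.card (Σ i : Fin l.length, Fin (l.get i)) = Fintype.card V := by
    rw [← h, Fintype.card_sigma]
    simp
  let e := Fintype.equivOfCardEq hcard
  let H : ∀ i : Fin l.length, SimpleGraph (Fin (l.get i)) := fun _ => ⊤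
  exact ⟨(disjointUnion H).comap e.symm, H,
    fun i => isCompleteMinusMatching_iff.2 fun x _ y _ z _ hxy _ hny _ => absurd hxy hny,
    ⟨SimpleGraph.Iso.comap e.symm _⟩⟩

/-- The extremal problem on `V`, given that `l` is the only extremal list of orders with sum
`Fintype.card V`. -/
theorem isGreatest_numMaximalDissociationSets {V : Type*} [Fintype V] {l : List ℕ} {N : ℕ}
    (hl : ∀ m ∈ l, m = 4 ∨ m = 5 ∨ m = 6) (hsum : l.sum = Fintype.card V)
    (hN : (l.map fun m => m.choose 2).prod = N) (hM : (N : ℚ) = extremalBound (Fintype.card V))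
    (huniq : ∀ l' : List ℕ, l'.sum = Fintype.card V → (∃ c,
      l'.Perm (List.replicate c 5) ∨ l'.Perm (6 :: List.replicate c 5) ∨
      l'.Perm (6 :: 6 :: List.replicate c 5) ∨ l'.Perm (4 :: 4 :: List.replicate c 5) ∨
      l'.Perm (4 :: List.replicate c 5)) → l'.Perm l) :
    IsGreatest (Set.range fun G : SimpleGraph V => G.numMaximalDissociationSets) N ∧
      ∀ G : SimpleGraph V, G.numMaximalDissociationSets = N ↔
        G.IsUnionOfCompleteMinusMatching l := by
  classical
  have two_le {l : List ℕ} (hl : ∀ m ∈ l, m = 4 ∨ m = 5 ∨ m = 6) : ∀ m ∈ l, 2 ≤ m :=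
    fun m hm => by have := hl m hm; omega
  have hiff (G : SimpleGraph V) : G.numMaximalDissociationSets = N ↔
      G.IsUnionOfCompleteMinusMatching l := by
    rw [isUnionOfCompleteMinusMatching_iff, numMaximalDissociationSets_eq]
    refine ⟨fun h => ?_, fun h => by rw [h.card_maxDissocIn (two_le hl), hN]⟩
    obtain ⟨l', hl', hG⟩ := (card_maxDissocIn_le_and G Finset.univ).2 (by
      rw [h, Finset.card_univ, hM])
    have hs : l'.sum = Fintype.card V := by rw [← hG.card_eq, Finset.card_univ]
    refine hG.perm (huniq l' hs (perm_of_prod_eq_extremalBound hl' ?_))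
    rw [← hG.card_maxDissocIn (two_le hl'), h, hM, hs]
  refine ⟨⟨?_, ?_⟩, hiff⟩
  · obtain ⟨G, hG⟩ := exists_isUnionOfCompleteMinusMatching hsum
    exact ⟨G, (hiff G).2 hG⟩
  · rintro _ ⟨G, rfl⟩
    have h := (card_maxDissocIn_le_and G Finset.univ).1
    rw [Finset.card_univ, ← hM, ← numMaximalDissociationSets_eq] at h
    exact_mod_cast h

end SimpleGraph

theorem theorem5p1 {V : Type*} [Fintype V] (t : ℕ) (hn : 8 ≤ Fintype.card V) :
    (Fintype.card V = 5 * t →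
      IsGreatest (Set.range fun G : SimpleGraph V => G.numMaximalDissociationSets) (10 ^ t) ∧
      ∀ G : SimpleGraph V, G.numMaximalDissociationSets = 10 ^ t ↔
        G.IsUnionOfCompleteMinusMatching (List.replicate t 5)) ∧
    (Fintype.card V = 5 * t + 1 →
      IsGreatest (Set.range fun G : SimpleGraph V => G.numMaximalDissociationSets)
        (15 * 10 ^ (t - 1)) ∧
      ∀ G : SimpleGraph V, G.numMaximalDissociationSets = 15 * 10 ^ (t - 1) ↔
        G.IsUnionOfCompleteMinusMatching (6 :: List.replicate (t - 1) 5)) ∧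
    (Fintype.card V = 5 * t + 2 →
      IsGreatest (Set.range fun G : SimpleGraph V => G.numMaximalDissociationSets)
        (225 * 10 ^ (t - 2)) ∧
      ∀ G : SimpleGraph V, G.numMaximalDissociationSets = 225 * 10 ^ (t - 2) ↔
        G.IsUnionOfCompleteMinusMatching (6 :: 6 :: List.replicate (t - 2) 5)) ∧
    (Fintype.card V = 5 * t + 3 →
      IsGreatest (Set.range fun G : SimpleGraph V => G.numMaximalDissociationSets)
        (36 * 10 ^ (t - 1)) ∧
      ∀ G : SimpleGraph V, G.numMaximalDissociationSets = 36 * 10 ^ (t - 1) ↔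
        G.IsUnionOfCompleteMinusMatching (4 :: 4 :: List.replicate (t - 1) 5)) ∧
    (Fintype.card V = 5 * t + 4 →
      IsGreatest (Set.range fun G : SimpleGraph V => G.numMaximalDissociationSets)
        (6 * 10 ^ t) ∧
      ∀ G : SimpleGraph V, G.numMaximalDissociationSets = 6 * 10 ^ t ↔
        G.IsUnionOfCompleteMinusMatching (4 :: List.replicate t 5)) := by
  have hM (c : ℕ) (k N : ℕ) (hk : SimpleGraph.extremalBound k = N)
      (hc : Fintype.card V = 5 * c + k) :
      ((N * 10 ^ c : ℕ) : ℚ) = SimpleGraph.extremalBound (Fintype.card V) := by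
    rw [hc]
    push_cast
    rw [SimpleGraph.extremalBound_five_mul_add, hk, mul_comm]
  -- the order determines which of the extremal lists occurs, and the number of its entries `5`
  have huniq (c : ℕ) (l : List ℕ) (hc : l.sum = Fintype.card V)
      (hl : l = List.replicate c 5 ∨ l = 6 :: List.replicate c 5 ∨
        l = 6 :: 6 :: List.replicate c 5 ∨ l = 4 :: 4 :: List.replicate c 5 ∨
        l = 4 :: List.replicate c 5)
      (l' : List ℕ) (hs : l'.sum = Fintype.card V) (h : ∃ c,
        l'.Perm (List.replicate c 5) ∨ l'.Perm (6 :: List.replicate c 5) ∨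
        l'.Perm (6 :: 6 :: List.replicate c 5) ∨ l'.Perm (4 :: 4 :: List.replicate c 5) ∨
        l'.Perm (4 :: List.replicate c 5)) : l'.Perm l := by
    obtain ⟨d, hp⟩ := h
    rw [← hs] at hc
    rcases hp with hp | hp | hp | hp | hp <;> rcases hl with rfl | rfl | rfl | rfl | rfl <;>
      rw [hp.sum_eq] at hc <;>
      simp only [List.sum_cons, List.sum_replicate, smul_eq_mul] at hc <;>
      first
      | omega
      | rwa [show c = d by omega]
  refine ⟨fun h => ?_, fun h => ?_, fun h => ?_, fun h => ?_, fun h => ?_⟩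
  · have hs : (List.replicate t 5).sum = Fintype.card V := by simp; omega
    refine SimpleGraph.isGreatest_numMaximalDissociationSets (by simp) hs (by simp [Nat.choose]) ?_
      (huniq t _ hs (by simp))
    rw [← hM t 0 1 (by exact_mod_cast SimpleGraph.extremalBound_zero) (by omega), one_mul]
  · have hs : (6 :: List.replicate (t - 1) 5).sum = Fintype.card V := by simp; omega
    exact SimpleGraph.isGreatest_numMaximalDissociationSets (by simp) hs
      (by simp [Nat.choose])
      (hM (t - 1) 6 15 (by exact_mod_cast SimpleGraph.extremalBound_six) (by omega))
      (huniq (t - 1) _ hs (by simp))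
  · have hs : (6 :: 6 :: List.replicate (t - 2) 5).sum = Fintype.card V := by simp; omega
    exact SimpleGraph.isGreatest_numMaximalDissociationSets (by simp) hs
      (by simp [Nat.choose, ← mul_assoc])
      (hM (t - 2) 12 225 (by exact_mod_cast SimpleGraph.extremalBound_twelve) (by omega))
      (huniq (t - 2) _ hs (by simp))
  · have hs : (4 :: 4 :: List.replicate (t - 1) 5).sum = Fintype.card V := by simp; omega
    exact SimpleGraph.isGreatest_numMaximalDissociationSets (by simp) hs
      (by simp [Nat.choose, ← mul_assoc])
      (hM (t - 1) 8 36 (by exact_mod_cast SimpleGraph.extremalBound_eight) (by omega))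
      (huniq (t - 1) _ hs (by simp))
  · have hs : (4 :: List.replicate t 5).sum = Fintype.card V := by simp; omega
    exact SimpleGraph.isGreatest_numMaximalDissociationSets (by simp) hs
      (by simp [Nat.choose])
      (hM t 4 6 (by exact_mod_cast SimpleGraph.extremalBound_four) (by omega))
      (huniq t _ hs (by simp))
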